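/- Let $d\in\{2,3\}$, let $\Omega\subset\mathbb R^d$ be open, bounded, polygonal/polyhedral with Lipschitz boundary, and let $\mathcal M$ be a (finite) matching simplicial mesh of $\Omega$: the cells are closed $d$-simplices with union $\overline\Omega$, and for all $K,K'\in\mathcal M$ the set $K\cap K'$ is the convex hull of a (possibly empty) subset of the vertices of $K$. Let $\mathcal F_K$ be the set of the $d+1$ faces of $K$, let $\Sigma$ be the union of all faces, and call a face a boundary face if it lies in $\partial\Omega$. Let $p\ge 0$. Let $\mathbb P_n(\mathcal M)\subset L^2(\Omega)$ be the functions that are polynomials of total degree $\le n$ on each cell, and let $\mathbb P_p(\Sigma)\subset L^2(\Sigma)$ be the functions that are polynomials of total degree $\le p$ on each face and vanish on the boundary faces. Let $\Pi_{\mathcal M}$, $\Pi_\Sigma$ be the $L^2$-orthogonal projections onto $\mathbb P_p(\mathcal M)$ and $\mathbb P_p(\Sigma)$, and for each face $F$ (boundary faces included) let $\Pi_F$ be the $L^2(F)$-orthogonal projection onto the polynomials of degree $\le p$ on $F$. Put $$\hat S:=\mathbb P_p(\mathcal M)\times\mathbb P_p(\Sigma),\qquad \hat H:=\{\hat v=(v_{\mathcal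 M},v_\Sigma): v_{\mathcal M}\in H^1_0(\Omega),\ v_\Sigma=(v_{\mathcal M})_{|\Sigma}\},\qquad \hat{\mathcal I}v_{\mathcal M}:=(\Pi_{\mathcal M}v_{\mathcal M},\Pi_\Sigma v_\Sigma),$$ where $(\cdot)_{|\Sigma}$ is the trace on $\Sigma$. For $\hat s=(s_{\mathcal M},s_\Sigma)\in\hat S$ let $\mathcal R\hat s\in\mathbb P_{p+1}(\mathcal M)$ be determined by $$\int_K\nabla\mathcal R\hat s\cdot\nabla q=-\int_K s_{\mathcal M}\Delta q+\int_{\partial K}s_\Sigma\,\nabla q\cdot n_K,\qquad \int_K\mathcal R\hat s=\int_K s_{\mathcal M}$$ for all $K\in\mathcal M$ and all polynomials $q$ of degree $\le p+1$, where $n_K$ is the outer unit normal; let $\mathcal S\hat s:=s_{\mathcal M}+(\mathrm{Id}-\Pi_{\mathcal M})\mathcal R\hat s$. Fix any weights $\omega_F>0$ (for instance $\omega_F=1$, or $\omega_F=h_F^{-1}$ with $h_F$ the diameter of $F$), and set $$\theta(\hat s,\hat\sigma):=\sum_{K\in\mathcal M}\sum_{F\in\mathcal F_K}\omega_F\int_F\Pi_F\big(s_\Sigma-(\mathcal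 S\hat s)_{|K}\big)\,\Pi_F\big(\sigma_\Sigma-(\mathcal S\hat\sigma)_{|K}\big).$$ With the broken gradient $\nabla_{\mathcal M}$, define the extended form on $\hat H+\hat S\subset L^2(\Omega)\times L^2(\Sigma)$ by $$\widetilde a(\hat v+\hat s,\hat w+\hat\sigma):=\int_\Omega\nabla_{\mathcal M}(v_{\mathcal M}+\mathcal R\hat s)\cdot\nabla_{\mathcal M}(w_{\mathcal M}+\mathcal R\hat\sigma)+\theta(\hat s,\hat\sigma)\qquad(\hat v,\hat w\in\hat H,\ \hat s,\hat\sigma\in\hat S),$$ and let $|\hat x|:=\sqrt{\widetilde a(\hat x,\hat x)}$. Then $\widetilde a$ is well defined (independent of the decompositions) and positive semi-definite on $\hat H+\hat S$. For all $\hat v=(v_{\mathcal M},v_\Sigma)\in\hat H$ and $\hat s\in\hat S$, $$|\hat v-\hat s|=0\iff v_{\mathcal M}\in\mathbb P_{p+1}(\mathcal M)\ \text{ and }\ \hat s=\hat{\mathcal I}v_{\mathcal M}.$$ Consequently $\widetilde a$ fails to be positive definite, i.e. $\widetilde a(\hat x,\hat x)=0$ for some $0\ne\hat x\in\hat H+\hat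 S$, if and only if there is $v\in H^1_0(\Omega)\cap\mathbb P_{p+1}(\mathcal M)$ with $v\notin\mathbb P_p(\mathcal M)$. -/

import Mathlib

open MeasureTheory Filter Topology
open scoped ContDiff RealInnerProductSpace

namespace HHO

noncomputable section

/-- Euclidean space `ℝ^d`. -/
abbrev E (d : ℕ) : Type := EuclideanSpace ℝ (Fin d)

/-- The Hilbert space `L²(μ)` of (classes of) real functions on `ℝ^d`. -/
abbrev L2 {d : ℕ} (μ : Measure (E d)) : Type := Lp ℝ 2 μ

/-! ### Polynomials -/

/-- The polynomials in `d` variables of total degree `≤ n`. -/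
abbrev Poly (d n : ℕ) : Submodule ℝ (MvPolynomial (Fin d) ℝ) :=
  MvPolynomial.restrictTotalDegree (Fin d) ℝ n

/-- The function on `ℝ^d` given by a polynomial. -/
def polyFun {d : ℕ} (q : MvPolynomial (Fin d) ℝ) (x : E d) : ℝ :=
  MvPolynomial.eval (fun i => x i) q

/-- The gradient of a polynomial. -/
def polyGrad {d : ℕ} (q : MvPolynomial (Fin d) ℝ) (x : E d) : E d :=
  WithLp.toLp 2 (fun i => polyFun (MvPolynomial.pderiv i q) x)

/-- The Laplacian of a polynomial. -/
def polyLapl {d : ℕ} (q : MvPolynomial (Fin d) ℝ) (x : E d) : ℝ :=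
  ∑ i, polyFun (MvPolynomial.pderiv i (MvPolynomial.pderiv i q)) x

/-- The elements of `L²(μ)` that coincide, on each set of the family `𝓕`, with a polynomial of
total degree `≤ n`. -/
def piecewisePoly {d : ℕ} (μ : Measure (E d)) (𝓕 : Set (Set (E d))) (n : ℕ) :
    Submodule ℝ (L2 μ) where
  carrier := {s | ∀ A ∈ 𝓕, ∃ q ∈ Poly d n, ∀ᵐ x ∂μ, x ∈ A → s x = polyFun q x}
  zero_mem' := by
    intro A _
    refine ⟨0, Submodule.zero_mem _, ?_⟩
    filter_upwards [Lp.coeFn_zero ℝ 2 μ] with x hx _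
    refine hx.trans ?_
    simp [polyFun]
  add_mem' := by
    intro s t hs ht A hA
    obtain ⟨q, hq, hsq⟩ := hs A hA
    obtain ⟨r, hr, htr⟩ := ht A hA
    refine ⟨q + r, Submodule.add_mem _ hq hr, ?_⟩
    filter_upwards [Lp.coeFn_add s t, hsq, htr] with x hx h1 h2 hxA
    rw [hx, Pi.add_apply, h1 hxA, h2 hxA]
    simp [polyFun]
  smul_mem' := by
    intro c s hs A hA
    obtain ⟨q, hq, hsq⟩ := hs A hA
    refine ⟨c • q, Submodule.smul_mem _ c hq, ?_⟩
    filter_upwards [Lp.coeFn_smul c s, hsq] with x hx h1 hxA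
    rw [hx, Pi.smul_apply, h1 hxA]
    simp [polyFun]

/-- Piecewise polynomials on a finite family covering almost everything form a
finite-dimensional space; in particular there is an orthogonal projection onto it. -/
theorem finiteDimensional_piecewisePoly {d : ℕ} (μ : Measure (E d)) (𝓕 : Set (Set (E d)))
    (n : ℕ) (hfin : 𝓕.Finite) (hcov : ∀ᵐ x ∂μ, ∃ A ∈ 𝓕, x ∈ A) :
    FiniteDimensional ℝ (piecewisePoly μ 𝓕 n) := by
  have : Finite 𝓕 := hfin
  let W : Submodule ℝ (piecewisePoly μ 𝓕 n × (𝓕 → Poly d n)) :=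
    { carrier := {z | ∀ A : 𝓕, ∀ᵐ x ∂μ, x ∈ A.1 → (z.1 : L2 μ) x = polyFun (z.2 A).1 x}
      zero_mem' := by
        intro A
        filter_upwards [Lp.coeFn_zero ℝ 2 μ] with x hx _
        refine hx.trans ?_
        simp [polyFun]
      add_mem' := by
        intro s t hs ht A
        filter_upwards [Lp.coeFn_add (s.1 : L2 μ) (t.1 : L2 μ), hs A, ht A] with x hx h1 h2 hxA
        refine hx.trans ?_
        rw [Pi.add_apply, h1 hxA, h2 hxA]
        simp [polyFun]
      smul_mem' := by
        intro c s hs A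
        filter_upwards [Lp.coeFn_smul c (s.1 : L2 μ), hs A] with x hx h1 hxA
        refine hx.trans ?_
        rw [Pi.smul_apply, h1 hxA]
        simp [polyFun] }
  have : FiniteDimensional ℝ W := by
    refine Module.Finite.of_injective
      ((LinearMap.snd ℝ (piecewisePoly μ 𝓕 n) (𝓕 → Poly d n)).comp W.subtype) ?_
    rintro ⟨⟨s, q⟩, hs⟩ ⟨⟨t, r⟩, ht⟩ h
    have hqr : q = r := h
    subst hqr
    have hst : (s : L2 μ) = t := by
      apply Lp.ext
      have h1 : ∀ᵐ x ∂μ, ∀ A : 𝓕, x ∈ A.1 → (s : L2 μ) x = polyFun (q A).1 x :=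
        ae_all_iff.2 hs
      have h2 : ∀ᵐ x ∂μ, ∀ A : 𝓕, x ∈ A.1 → (t : L2 μ) x = polyFun (q A).1 x :=
        ae_all_iff.2 ht
      filter_upwards [h1, h2, hcov] with x hx1 hx2 ⟨A, hA, hxA⟩
      rw [hx1 ⟨A, hA⟩ hxA, hx2 ⟨A, hA⟩ hxA]
    have hst' : s = t := Subtype.ext hst
    subst hst'
    rfl
  refine Module.Finite.of_surjective
    ((LinearMap.fst ℝ (piecewisePoly μ 𝓕 n) (𝓕 → Poly d n)).comp W.subtype) ?_
  intro s
  choose q hq hsq using s.2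
  exact ⟨⟨(s, fun A => ⟨q A.1 A.2, hq A.1 A.2⟩), fun A => hsq A.1 A.2⟩, rfl⟩

/-! ### Domains and meshes -/

/-- `Ω` has a Lipschitz boundary: near each boundary point, after a rotation, `Ω` is the set of
points above the graph of a Lipschitz function. -/
def HasLipschitzBoundary {d : ℕ} (Ω : Set (E d)) : Prop :=
  ∀ x ∈ frontier Ω, ∃ e : E d, ‖e‖ = 1 ∧ ∃ r > 0, ∃ (L : NNReal) (g : (ℝ ∙ e)ᗮ → ℝ),
    LipschitzWith L g ∧
      ∀ y ∈ Metric.ball x r, (y ∈ Ω ↔ g ((ℝ ∙ e)ᗮ.orthogonalProjectionOnto y) < ⟪e, y⟫)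

/-- An open bounded set with Lipschitz boundary. (It is polygonal or polyhedral as soon as it
carries a simplicial mesh.) -/
structure Domain (d : ℕ) where
  carrier : Set (E d)
  isOpen : IsOpen carrier
  isBounded : Bornology.IsBounded carrier
  lipschitz : HasLipschitzBoundary carrier

/-- The closed simplex with the given vertices. -/
def hull {d : ℕ} (K : Finset (E d)) : Set (E d) := convexHull ℝ (K : Set (E d))

/-- A matching simplicial mesh of `Ω`. A cell is given by the set of its `d + 1` vertices. -/
structure Mesh {d : ℕ} (Ω : Domain d) where
  cells : Finset (Finset (E d))
  card_eq : ∀ K ∈ cells, K.card = d + 1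
  affineIndependent : ∀ K ∈ cells, AffineIndependent ℝ (fun a : K => (a : E d))
  cover : closure Ω.carrier = ⋃ K ∈ cells, hull K
  matching : ∀ K ∈ cells, ∀ K' ∈ cells, ∃ W ⊆ K, hull K ∩ hull K' = hull W

/-- The face of the simplex `K` opposite to its vertex `a`. -/
def facet {d : ℕ} (K : Finset (E d)) (a : E d) : Set (E d) :=
  convexHull ℝ ((K : Set (E d)) \ {a})

/-- The outer unit normal of the simplex `K` on the face opposite to the vertex `a`: the normalized
component, orthogonal to that face, of the vector from `a` to the barycentre of `K`. -/
def outerNormal {d : ℕ} (K : Finset (E d)) (a : E d) : E d :=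
  let u := (vectorSpan ℝ ((K : Set (E d)) \ {a}))ᗮ.starProjection
    (((K.card : ℝ)⁻¹ • (∑ b ∈ K, b)) - a)
  ‖u‖⁻¹ • u

/-- The `(d-1)`-dimensional surface measure. -/
def surf (d : ℕ) : Measure (E d) := μHE[d - 1]

variable {d : ℕ} {Ω : Domain d}

/-- The closed cells of the mesh, as sets. -/
def Mesh.cellSets (M : Mesh Ω) : Set (Set (E d)) := {A | ∃ K ∈ M.cells, A = hull K}

/-- The set of all faces of the mesh. -/
def Mesh.faces (M : Mesh Ω) : Set (Set (E d)) := {F | ∃ K ∈ M.cells, ∃ a ∈ K, F = facet K a}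

/-- The boundary faces. -/
def Mesh.boundaryFaces (M : Mesh Ω) : Set (Set (E d)) :=
  {F | F ∈ M.faces ∧ F ⊆ frontier Ω.carrier}

/-- The skeleton `Σ`. -/
def Mesh.skeleton (M : Mesh Ω) : Set (E d) := ⋃ F ∈ M.faces, F

/-- Lebesgue measure on `Ω`. -/
def Domain.vol (Ω : Domain d) : Measure (E d) := volume.restrict Ω.carrier

/-- Surface measure on the skeleton. -/
def Mesh.skel (M : Mesh Ω) : Measure (E d) := (surf d).restrict M.skeleton

theorem Mesh.finite_cellSets (M : Mesh Ω) : M.cellSets.Finite := by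
  refine (M.cells.finite_toSet.image hull).subset ?_
  rintro A ⟨K, hK, rfl⟩
  exact ⟨K, hK, rfl⟩

theorem Mesh.finite_faces (M : Mesh Ω) : M.faces.Finite := by
  refine (M.cells.finite_toSet.biUnion
    (t := fun K => (facet K) '' (K : Set (E d))) fun K _ => K.finite_toSet.image _).subset ?_
  rintro F ⟨K, hK, a, ha, rfl⟩
  exact Set.mem_biUnion (Finset.mem_coe.2 hK) ⟨a, ha, rfl⟩

theorem Mesh.measurableSet_skeleton (M : Mesh Ω) : MeasurableSet M.skeleton := by
  refine MeasurableSet.biUnion M.finite_faces.countable ?_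
  rintro F ⟨K, _, a, _, rfl⟩
  exact ((K.finite_toSet.subset Set.sdiff_subset).isCompact_convexHull ℝ).isClosed.measurableSet

/-! ### The Sobolev space `H¹₀(Ω)`, traces, and the space of pairs -/

/-- Test functions: smooth with compact support in `Ω`. -/
def IsTest (Ω : Domain d) (φ : E d → ℝ) : Prop :=
  ContDiff ℝ ∞ φ ∧ HasCompactSupport φ ∧ tsupport φ ⊆ Ω.carrier

/-- `G` is the weak gradient of `v` in `Ω`. -/
def HasWeakGradient (v : L2 Ω.vol) (G : Lp (E d) 2 Ω.vol) : Prop :=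
  ∀ φ : E d → ℝ, IsTest Ω φ → ∫ x, v x • gradient φ x ∂Ω.vol = -∫ x, φ x • G x ∂Ω.vol

open Classical in
/-- The weak gradient of `v` (the zero field if `v` is not in `H¹(Ω)`). -/
def weakGradient (v : L2 Ω.vol) : Lp (E d) 2 Ω.vol :=
  if h : ∃ G, HasWeakGradient v G then h.choose else 0

/-- The functions `φ n` converge to `v` in the norm of `H¹(Ω)`. -/
def TendstoH1 (φ : ℕ → E d → ℝ) (v : L2 Ω.vol) : Prop :=
  Tendsto (fun n => eLpNorm (fun x => φ n x - v x) 2 Ω.vol) atTop (𝓝 0) ∧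
  Tendsto (fun n => eLpNorm (fun x => gradient (φ n) x - weakGradient v x) 2 Ω.vol) atTop (𝓝 0)

/-- `v ∈ H¹₀(Ω)`: `v` has a weak gradient in `L²` and lies in the `H¹`-closure of the test
functions. -/
def MemH10 (v : L2 Ω.vol) : Prop :=
  (∃ G, HasWeakGradient v G) ∧ ∃ φ : ℕ → E d → ℝ, (∀ n, IsTest Ω (φ n)) ∧ TendstoH1 φ v

/-- `g ∈ L²(Σ)` is the trace on the skeleton of `v ∈ H¹₀(Ω)`: the trace operator is the continuous
extension to `H¹₀(Ω)` of the restriction of test functions to `Σ`. -/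
def Mesh.IsTrace (M : Mesh Ω) (v : L2 Ω.vol) (g : L2 M.skel) : Prop :=
  ∃ φ : ℕ → E d → ℝ, (∀ n, IsTest Ω (φ n)) ∧ TendstoH1 φ v ∧
    Tendsto (fun n => eLpNorm (fun x => φ n x - g x) 2 M.skel) atTop (𝓝 0)

/-- Pairs of a function on `Ω` and a function on the skeleton. -/
abbrev Mesh.Pairs (M : Mesh Ω) : Type := L2 Ω.vol × L2 M.skel

/-- The space of all pairs `(v, trace of v)` with `v ∈ H¹₀(Ω)`. -/
def Mesh.contSpace (M : Mesh Ω) : Set M.Pairs := {v | MemH10 v.1 ∧ M.IsTrace v.1 v.2}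

/-! ### Discrete spaces, projections and interpolant -/

/-- The broken polynomials of degree `≤ n` on the cells. -/
def Mesh.brokenPoly (M : Mesh Ω) (n : ℕ) : Submodule ℝ (L2 Ω.vol) :=
  piecewisePoly Ω.vol M.cellSets n

/-- The functions on the skeleton vanishing on all boundary faces. -/
def Mesh.zeroOnBoundary (M : Mesh Ω) : Submodule ℝ (L2 M.skel) where
  carrier := {s | ∀ F ∈ M.boundaryFaces, ∀ᵐ x ∂M.skel, x ∈ F → s x = 0}
  zero_mem' := by
    intro F _
    filter_upwards [Lp.coeFn_zero ℝ 2 M.skel] with x hx _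
    exact hx
  add_mem' := by
    intro s t hs ht F hF
    filter_upwards [Lp.coeFn_add s t, hs F hF, ht F hF] with x hx h1 h2 hxF
    rw [hx, Pi.add_apply, h1 hxF, h2 hxF, add_zero]
  smul_mem' := by
    intro c s hs F hF
    filter_upwards [Lp.coeFn_smul c s, hs F hF] with x hx h1 hxF
    rw [hx, Pi.smul_apply, h1 hxF, smul_zero]

/-- The piecewise polynomials of degree `≤ n` on the faces that vanish on the boundary faces. -/
def Mesh.skeletonPoly (M : Mesh Ω) (n : ℕ) : Submodule ℝ (L2 M.skel) :=
  piecewisePoly M.skel M.faces n ⊓ M.zeroOnBoundary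

/-- The HHO space of degree `p`. -/
def Mesh.hhoSpace (M : Mesh Ω) (p : ℕ) : Submodule ℝ M.Pairs :=
  (M.brokenPoly p).prod (M.skeletonPoly p)

instance (M : Mesh Ω) (n : ℕ) : FiniteDimensional ℝ (M.brokenPoly n) := by
  refine finiteDimensional_piecewisePoly _ _ n M.finite_cellSets ?_
  filter_upwards [ae_restrict_mem Ω.isOpen.measurableSet] with x hx
  have hx' : x ∈ ⋃ K ∈ M.cells, hull K := M.cover ▸ subset_closure hx
  obtain ⟨K, hK, hxK⟩ := Set.mem_iUnion₂.1 hx'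
  exact ⟨hull K, ⟨K, hK, rfl⟩, hxK⟩

instance (M : Mesh Ω) (n : ℕ) : FiniteDimensional ℝ (M.skeletonPoly n) := by
  have : FiniteDimensional ℝ (piecewisePoly M.skel M.faces n) := by
    refine finiteDimensional_piecewisePoly _ _ n M.finite_faces ?_
    filter_upwards [ae_restrict_mem M.measurableSet_skeleton] with x hx
    obtain ⟨F, hF, hxF⟩ := Set.mem_iUnion₂.1 hx
    exact ⟨F, hF, hxF⟩
  exact Submodule.finiteDimensional_inf_left _ _

/-- The `L²`-orthogonal projection onto the broken polynomials of degree `≤ p`. -/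
def Mesh.projCells (M : Mesh Ω) (p : ℕ) (v : L2 Ω.vol) : L2 Ω.vol :=
  (M.brokenPoly p).starProjection v

/-- The `L²`-orthogonal projection onto the face-wise polynomials of degree `≤ p` that vanish on
the boundary faces. -/
def Mesh.projSkeleton (M : Mesh Ω) (p : ℕ) (g : L2 M.skel) : L2 M.skel :=
  (M.skeletonPoly p).starProjection g

/-- The HHO interpolant; `v ∈ H¹₀(Ω)` is given together with its trace on the skeleton. -/
def Mesh.interpolant (M : Mesh Ω) (p : ℕ) (v : M.Pairs) : M.Pairs :=
  (M.projCells p v.1, M.projSkeleton p v.2)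

/-- The polynomials of degree `≤ p` on a face `F`, as elements of `L²(F)`. -/
def facePoly (F : Set (E d)) (p : ℕ) : Submodule ℝ (L2 ((surf d).restrict F)) :=
  piecewisePoly ((surf d).restrict F) {Set.univ} p

instance (F : Set (E d)) (p : ℕ) : FiniteDimensional ℝ (facePoly F p) :=
  finiteDimensional_piecewisePoly _ _ p (Set.finite_singleton _)
    (Eventually.of_forall fun _ => ⟨Set.univ, rfl, trivial⟩)

open Classical in
/-- The `L²(F)`-orthogonal projection onto the polynomials of degree `≤ p` on the face `F`, applied
to a function that is square-integrable on `F`. -/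
def faceProj (F : Set (E d)) (p : ℕ) (f : E d → ℝ) : E d → ℝ :=
  if h : MemLp f 2 ((surf d).restrict F) then (facePoly F p).starProjection (h.toLp f) else 0

/-! ### Reconstruction, stabilization, and the extended form -/

open Classical in
/-- The polynomial with which the broken polynomial `s` coincides on the cell `K`. -/
def cellPoly (s : L2 Ω.vol) (K : Finset (E d)) : MvPolynomial (Fin d) ℝ :=
  if h : ∃ q : MvPolynomial (Fin d) ℝ, ∀ᵐ x ∂Ω.vol, x ∈ hull K → s x = polyFun q x
  then h.choose else 0

/-- The conditions that determine the reconstruction `r` of the pair `s`. -/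
def Mesh.IsReconstruction (M : Mesh Ω) (p : ℕ) (s : M.Pairs) (r : L2 Ω.vol) : Prop :=
  r ∈ M.brokenPoly (p + 1) ∧ ∀ K ∈ M.cells,
    (∀ q ∈ Poly d (p + 1),
      ∫ x in hull K, ⟪polyGrad (cellPoly r K) x, polyGrad q x⟫ =
        -(∫ x in hull K, s.1 x * polyLapl q x) +
          ∑ a ∈ K, ∫ x in facet K a, s.2 x * ⟪polyGrad q x, outerNormal K a⟫ ∂(surf d)) ∧
    ∫ x in hull K, r x = ∫ x in hull K, s.1 x

open Classical in
/-- The reconstruction operator, from the HHO space to the broken polynomials of degree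
`≤ p + 1`. -/
def Mesh.reconstruction (M : Mesh Ω) (p : ℕ) (s : M.Pairs) : L2 Ω.vol :=
  if h : ∃ r, M.IsReconstruction p s r then h.choose else 0

/-- The stabilization operator. -/
def Mesh.stabOp (M : Mesh Ω) (p : ℕ) (s : M.Pairs) : L2 Ω.vol :=
  s.1 + (M.reconstruction p s - M.projCells p (M.reconstruction p s))

/-- The projected difference, on the face of `K` opposite to `a`, between the face component of `s`
and the trace from `K` of the stabilization operator. -/
def Mesh.stabDiff (M : Mesh Ω) (p : ℕ) (s : M.Pairs) (K : Finset (E d)) (a : E d) : E d → ℝ :=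
  faceProj (facet K a) p (fun x => s.2 x - polyFun (cellPoly (M.stabOp p s) K) x)

/-- The stabilization bilinear form, with face weights `w`. -/
def Mesh.stab (M : Mesh Ω) (p : ℕ) (w : Set (E d) → ℝ) (s σ : M.Pairs) : ℝ :=
  ∑ K ∈ M.cells, ∑ a ∈ K, w (facet K a) *
    ∫ x in facet K a, M.stabDiff p s K a x * M.stabDiff p σ K a x ∂(surf d)

/-- The broken gradient on the cell `K` of `v + R s`, for `v ∈ H¹₀(Ω)` and `s` in the HHO space. -/
def Mesh.brokenGrad (M : Mesh Ω) (p : ℕ) (v s : M.Pairs) (K : Finset (E d)) (x : E d) : E d :=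
  weakGradient v.1 x + polyGrad (cellPoly (M.reconstruction p s) K) x

/-- The formula for the extended form at `v + s` and `z + σ`. -/
def Mesh.extFormula (M : Mesh Ω) (p : ℕ) (w : Set (E d) → ℝ) (v s z σ : M.Pairs) : ℝ :=
  (∑ K ∈ M.cells, ∫ x in hull K, ⟪M.brokenGrad p v s K x, M.brokenGrad p z σ K x⟫) +
    M.stab p w s σ

/-- The sum of the continuous space and the HHO space. -/
def Mesh.sumSpace (M : Mesh Ω) (p : ℕ) : Set M.Pairs :=
  {x | ∃ v ∈ M.contSpace, ∃ s ∈ M.hhoSpace p, x = v + s}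

open Classical in
/-- A decomposition of an element of the sum space. -/
def Mesh.split (M : Mesh Ω) (p : ℕ) (x : M.Pairs) : M.Pairs × M.Pairs :=
  if h : ∃ y : M.Pairs × M.Pairs, y.1 ∈ M.contSpace ∧ y.2 ∈ M.hhoSpace p ∧ x = y.1 + y.2
  then h.choose else 0

/-- The extended bilinear form on the sum space. -/
def Mesh.extForm (M : Mesh Ω) (p : ℕ) (w : Set (E d) → ℝ) (x y : M.Pairs) : ℝ :=
  M.extFormula p w (M.split p x).1 (M.split p x).2 (M.split p y).1 (M.split p y).2

/-- The extended energy semi-norm. -/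
def Mesh.extSeminorm (M : Mesh Ω) (p : ℕ) (w : Set (E d) → ℝ) (x : M.Pairs) : ℝ :=
  Real.sqrt (M.extForm p w x x)

end

end HHO

namespace HHO

noncomputable section

/-! The form evaluated at v - s is a sum of squares. It vanishes exactly when ∇v = ∇R s on every
cell and every projected difference Π_F(s_Σ - S s) is zero. Cells are convex, so the first condition
makes v differ from the polynomial R s by a constant on each cell (`exists_eq_add_const`), and v is
a broken polynomial of degree p + 1.

The reconstruction sees a pair only through cell moments against Δq, face moments against ∇q·n, and
cell means. All these weights have degree at most p, and interpolation preserves such moments. On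
boundary faces this holds because the trace and its projection both vanish there. Comparing with
Green's formula, R Î v = v for every conforming broken polynomial v of degree p + 1
(`reconstruction_interpolant`). Hence S Î v = v, and the stabilization vanishes at Î v
(`stabDiff_interpolant`). This settles one direction.

For the other direction, δ = s - Î v has a locally constant reconstruction and no stabilization, and
`eq_zero_of_energy_eq_zero` shows δ = 0. Indeed S δ = δ_M, because Rδ is already a broken polynomial
of degree p. The face projections act on polynomials of degree p, so δ_Σ is the trace of δ_M from
both sides. Green's formula then turns the equation for Rδ, tested with δ_M, into ∫|∇δ_M|² = 0. So
δ_M is constant on each cell, with equal constants across common facets and the value zero at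
boundary facets. A segment leaving the domain through relative interiors of facets only
(`eq_zero_of_forall_facet`) shows that all constants vanish; Ω need not be connected.

Two decompositions of one element differ by some u lying in both spaces. Such u is its own
interpolant, so R u = u_M and its stabilization is zero. The form is therefore well defined. For the
last equivalence, Î v = v when v has degree p, and otherwise the first component of v - Î v is
nonzero.

The analytic input rests on one formula: the field f(x)(x - a) on a simplex with vertex a is
tangential to every facet through a, so only the opposite facet contributes to its flux. It yields
the divergence theorem and the trace estimate (`integral_fderiv`, `tendsto_trace`). Statements about
H¹₀ are obtained by approximation with test functions. -/

/-! ### Slices orthogonal to a unit vector and the surface measure of hyperplanes -/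

/-- Orthogonal coordinates `(s, y) ↦ a + s n + y` with `y ⟂ n`. -/
def sliceMap {d : ℕ} (a n : E d) (z : ℝ × (ℝ ∙ n)ᗮ) : E d := a + (z.1 • n + (z.2 : E d))

theorem continuous_sliceMap {d : ℕ} (a n : E d) : Continuous (sliceMap a n) := by
  unfold sliceMap; fun_prop

theorem isometry_slice {d : ℕ} (a n : E d) (h : ℝ) :
    Isometry (fun y : (ℝ ∙ n)ᗮ => sliceMap a n (h, y)) := by
  refine Isometry.of_dist_eq fun x y => ?_
  simp only [sliceMap, dist_add_left]
  rfl

/-- The orthogonal splitting into the line of n and its complement preserves volume, and the unit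
vector n identifies ℝ isometrically with that line. -/
theorem measurePreserving_sliceMap {d : ℕ} (a : E d) {n : E d} (hn : ‖n‖ = 1) :
    MeasurePreserving (sliceMap a n) (volume : Measure (ℝ × (ℝ ∙ n)ᗮ)) volume := by
  have h1 := ((ℝ ∙ n).measurePreserving_measurableEquivProd a).symm
  have hE : (μHE[Module.finrank ℝ (E d)] : Measure (E d)) = volume :=
    InnerProductSpace.euclideanHausdorffMeasure_eq_volume
  rw [hE] at h1
  have h2 := (LinearIsometryEquiv.toSpanUnitSingleton (𝕜 := ℝ) n hn).measurePreserving
  have h3 := h1.comp (h2.prod (MeasurePreserving.id (volume : Measure (ℝ ∙ n)ᗮ)))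
  have he : sliceMap a n = ((ℝ ∙ n).measurableEquivProd a).symm ∘
      Prod.map (LinearIsometryEquiv.toSpanUnitSingleton (𝕜 := ℝ) n hn) id := by
    funext z
    simp [sliceMap, add_comm, LinearIsometryEquiv.toSpanUnitSingleton_apply]
  rw [he]
  exact h3

theorem measurableEmbedding_sliceMap {d : ℕ} (a : E d) {n : E d} (hn : ‖n‖ = 1) :
    MeasurableEmbedding (sliceMap a n) := by
  have h1 := ((ℝ ∙ n).measurableEquivProd a).symm.measurableEmbedding
  have h2 := (MeasurableEquiv.prodCongr
    (LinearIsometryEquiv.toSpanUnitSingleton (𝕜 := ℝ) n hn).toMeasurableEquiv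
    (MeasurableEquiv.refl (ℝ ∙ n)ᗮ)).measurableEmbedding
  convert h1.comp h2 using 1
  funext z
  simp [sliceMap, add_comm, LinearIsometryEquiv.toSpanUnitSingleton_apply, MeasurableEquiv.prodCongr]

theorem inner_sliceMap {d : ℕ} (a : E d) {n : E d} (hn : ‖n‖ = 1) (z : ℝ × (ℝ ∙ n)ᗮ) :
    ⟪sliceMap a n z - a, n⟫ = z.1 := by
  have : ⟪(z.2 : E d), n⟫ = 0 := by
    rw [real_inner_comm]; exact Submodule.mem_orthogonal_singleton_iff_inner_right.1 z.2.2
  simp [sliceMap, inner_add_left, inner_smul_left, this, hn]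

theorem exists_sliceMap_eq {d : ℕ} (a : E d) {n : E d} (hn : ‖n‖ = 1) (x : E d) :
    ∃ y : (ℝ ∙ n)ᗮ, sliceMap a n (⟪x - a, n⟫, y) = x := by
  refine ⟨⟨x - a - ⟪x - a, n⟫ • n, ?_⟩, by simp [sliceMap]⟩
  rw [Submodule.mem_orthogonal_singleton_iff_inner_right, inner_sub_right, inner_smul_right,
    real_inner_comm]
  simp [hn]

theorem finrank_orthogonal_unit {d : ℕ} {n : E d} (hn : ‖n‖ = 1) :
    Module.finrank ℝ (ℝ ∙ n)ᗮ = d - 1 := by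
  have h := (ℝ ∙ n).finrank_add_finrank_orthogonal
  rw [finrank_span_singleton (by rintro rfl; simp at hn), finrank_euclideanSpace_fin] at h
  omega

/-- The surface measure on a hyperplane is Lebesgue measure in orthogonal coordinates. -/
theorem surf_restrict_hyperplane {d : ℕ} (a : E d) {n : E d} (hn : ‖n‖ = 1) (h : ℝ) :
    (volume : Measure (ℝ ∙ n)ᗮ).map (fun y => sliceMap a n (h, y)) =
      (surf d).restrict {x | ⟪x - a, n⟫ = h} := by
  have hiso := isometry_slice a n h
  -- The complement of n has dimension d - 1, so the normalised Hausdorff measure of that order is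
  -- its Lebesgue measure; isometries transport it to the hyperplane.
  have h1 : (μHE[d - 1] : Measure (ℝ ∙ n)ᗮ) = volume := by
    rw [← finrank_orthogonal_unit hn]
    exact InnerProductSpace.euclideanHausdorffMeasure_eq_volume
  rw [← h1, hiso.map_euclideanHausdorffMeasure]
  congr 1
  ext x
  constructor
  · rintro ⟨y, rfl⟩
    exact inner_sliceMap a hn (h, y)
  · rintro rfl
    obtain ⟨y, hy⟩ := exists_sliceMap_eq a hn x
    exact ⟨y, hy⟩

theorem measurableEmbedding_slice {d : ℕ} (a n : E d) (h : ℝ) :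
    MeasurableEmbedding (fun y : (ℝ ∙ n)ᗮ => sliceMap a n (h, y)) := by
  exact (isometry_slice a n h).isClosedEmbedding.measurableEmbedding

theorem setIntegral_hyperplane {d : ℕ} (a : E d) {n : E d} (hn : ‖n‖ = 1) {h : ℝ} {F : Set (E d)}
    (hF : ∀ x ∈ F, ⟪x - a, n⟫ = h) (hFm : MeasurableSet F) (f : E d → ℝ) :
    ∫ x in F, f x ∂(surf d) =
      ∫ y in (fun y => sliceMap a n (h, y)) ⁻¹' F, f (sliceMap a n (h, y)) := by
  have h1 : (surf d).restrict F = ((surf d).restrict {x | ⟪x - a, n⟫ = h}).restrict F := by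
    rw [Measure.restrict_restrict hFm, Set.inter_eq_left.2 (show F ⊆ {x | ⟪x - a, n⟫ = h} from hF)]
  rw [h1, ← surf_restrict_hyperplane a hn, (measurableEmbedding_slice a n h).setIntegral_map]

theorem surf_lt_top {d : ℕ} {a n : E d} (hn : ‖n‖ = 1) {h : ℝ} {F : Set (E d)}
    (hF : ∀ x ∈ F, ⟪x - a, n⟫ = h) (hFm : IsCompact F) : surf d F < ⊤ := by
  have h1 : surf d F = ((surf d).restrict {x | ⟪x - a, n⟫ = h}) F := by
    rw [Measure.restrict_apply hFm.measurableSet, Set.inter_eq_left.2 (show F ⊆ {x | ⟪x - a, n⟫ = h} from hF)]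
  have he := measurableEmbedding_slice a n h
  rw [h1, ← surf_restrict_hyperplane a hn, he.map_apply]
  refine IsCompact.measure_lt_top ?_
  exact (isometry_slice a n h).isClosedEmbedding.isCompact_preimage hFm

/-! ### Cones over a flat base and the divergence theorem for radial fields -/

/-- The cone with apex `a` over the set `F`. -/
def cone {d : ℕ} (a : E d) (F : Set (E d)) : Set (E d) :=
  (fun z : ℝ × E d => a + z.1 • (z.2 - a)) '' (Set.Icc 0 1 ×ˢ F)

theorem isCompact_cone {d : ℕ} (a : E d) {F : Set (E d)} (hF : IsCompact F) :
    IsCompact (cone a F) :=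
  (isCompact_Icc.prod hF).image (by fun_prop)

/-- The slice at height s is the base shrunk about the apex by the ratio s/h. Height zero is
excluded because the ratio must be invertible. -/
theorem sliceMap_mem_cone_iff {d : ℕ} {a n : E d} (hn : ‖n‖ = 1) {h : ℝ} (hh : 0 < h)
    {F : Set (E d)} (hF : ∀ x ∈ F, ⟪x - a, n⟫ = h) {s : ℝ} (hs : s ∈ Set.Ioc 0 h)
    (y : (ℝ ∙ n)ᗮ) :
    sliceMap a n (s, (s / h) • y) ∈ cone a F ↔ sliceMap a n (h, y) ∈ F := by
  have key : sliceMap a n (s, (s / h) • y) = a + (s / h) • (sliceMap a n (h, y) - a) := by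
    simp only [sliceMap, add_sub_cancel_left, smul_add, smul_smul, Submodule.coe_smul]
    rw [div_mul_cancel₀ _ hh.ne']
  constructor
  · rintro ⟨⟨t, x⟩, ⟨_, hx⟩, hxe⟩
    have h1 := inner_sliceMap a hn (s, (s / h) • y)
    rw [← hxe] at h1
    simp only [add_sub_cancel_left, inner_smul_left, hF x hx, conj_trivial] at h1
    have ht : t = s / h := by rw [← h1]; field_simp
    rw [key] at hxe
    have h2 : t • (x - a) = (s / h) • (sliceMap a n (h, y) - a) := by simpa using hxe
    rw [ht] at h2
    have h3 : x - a = sliceMap a n (h, y) - a :=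
      smul_right_injective _ (div_pos hs.1 hh).ne' h2
    rw [sub_left_injective h3] at hx
    exact hx
  · intro hx
    exact ⟨(s / h, _), ⟨⟨(div_pos hs.1 hh).le, (div_le_one hh).2 hs.2⟩, hx⟩, key.symm⟩

theorem sliceMap_mem_cone_range {d : ℕ} {a n : E d} (hn : ‖n‖ = 1) {h : ℝ} (hh : 0 < h)
    {F : Set (E d)} (hF : ∀ x ∈ F, ⟪x - a, n⟫ = h) {z : ℝ × (ℝ ∙ n)ᗮ}
    (hz : sliceMap a n z ∈ cone a F) : z.1 ∈ Set.Icc 0 h := by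
  obtain ⟨⟨t, x⟩, ⟨ht, hx⟩, hxe⟩ := hz
  have h1 := inner_sliceMap a hn z
  rw [← hxe] at h1
  simp only [add_sub_cancel_left, inner_smul_left, hF x hx, conj_trivial] at h1
  rw [← h1]
  exact ⟨mul_nonneg ht.1 hh.le, mul_le_of_le_one_left hh.le ht.2⟩

/-- Integration over a cone, by slices parallel to the base. -/
theorem setIntegral_cone {d : ℕ} {a n : E d} (hn : ‖n‖ = 1) {h : ℝ} (hh : 0 < h)
    {F : Set (E d)} (hF : ∀ x ∈ F, ⟪x - a, n⟫ = h) (hFc : IsCompact F) {g : E d → ℝ}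
    (hg : Continuous g) :
    ∫ x in cone a F, g x =
      ∫ s in Set.Ioc 0 h, ∫ y in (fun y => sliceMap a n (h, y)) ⁻¹' F,
        (s / h) ^ (d - 1) * g (sliceMap a n (s, (s / h) • y)) := by
  have hC := isCompact_cone a hFc
  have hmp := measurePreserving_sliceMap a hn
  have hme := measurableEmbedding_sliceMap a hn
  have hint : Integrable ((cone a F).indicator g) :=
    (hg.continuousOn.integrableOn_compact hC).integrable_indicator hC.measurableSet
  rw [← integral_indicator hC.measurableSet, ← hmp.integral_comp hme, Measure.volume_eq_prod,
    integral_prod (fun z => (cone a F).indicator g (sliceMap a n z))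
    ((hmp.integrable_comp_emb hme).2 hint)]
  have hzero : ∀ s ∉ Set.Icc 0 h,
      ∫ y : (ℝ ∙ n)ᗮ, (cone a F).indicator g (sliceMap a n (s, y)) = 0 := by
    intro s hs
    refine integral_eq_zero_of_ae (Eventually.of_forall fun y => ?_)
    refine Set.indicator_of_notMem (fun hmem => hs ?_) g
    exact sliceMap_mem_cone_range hn hh hF hmem
  rw [← setIntegral_eq_integral_of_forall_compl_eq_zero hzero, integral_Icc_eq_integral_Ioc]
  refine setIntegral_congr_fun measurableSet_Ioc fun s hs => ?_
  have hsh : 0 < s / h := div_pos hs.1 hh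
  -- Rescaling the slice, which has dimension d - 1, to the size of the base produces the Jacobian
  -- (s/h)^(d-1).
  have h2 := Measure.integral_comp_smul (volume : Measure (ℝ ∙ n)ᗮ)
    (fun y => (cone a F).indicator g (sliceMap a n (s, y))) (s / h)
  rw [finrank_orthogonal_unit hn, abs_of_pos (by positivity), smul_eq_mul] at h2
  have h3 : ∫ y : (ℝ ∙ n)ᗮ, (cone a F).indicator g (sliceMap a n (s, y)) =
      (s / h) ^ (d - 1) *
        ∫ y : (ℝ ∙ n)ᗮ, (cone a F).indicator g (sliceMap a n (s, (s / h) • y)) := by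
    rw [h2, mul_inv_cancel_left₀ (by positivity)]
  rw [integral_const_mul]
  refine h3.trans ?_
  congr 1
  rw [← integral_indicator ((measurableEmbedding_slice a n h).measurable hFc.measurableSet)]
  refine integral_congr_ae (Eventually.of_forall fun y => ?_)
  have hiff := sliceMap_mem_cone_iff hn hh hF hs y
  beta_reduce
  by_cases hy : sliceMap a n (h, y) ∈ F
  · rw [Set.indicator_of_mem (hiff.2 hy), Set.indicator_of_mem (by exact hy)]
  · rw [Set.indicator_of_notMem (fun hm => hy (hiff.1 hm)), Set.indicator_of_notMem (by exact hy)]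

/-- The divergence theorem for the field `f (x - a)` on a cone with apex `a`. -/
theorem integral_cone_div {d : ℕ} (hd : 1 ≤ d) {a n : E d} (hn : ‖n‖ = 1) {h : ℝ} (hh : 0 < h)
    {F : Set (E d)} (hF : ∀ x ∈ F, ⟪x - a, n⟫ = h) (hFc : IsCompact F) {f : E d → ℝ}
    (hf : ContDiff ℝ 1 f) :
    h * ∫ x in F, f x ∂(surf d) = ∫ x in cone a F, (d * f x + fderiv ℝ f x (x - a)) := by
  have hf' : Continuous (fderiv ℝ f) := hf.continuous_fderiv one_ne_zero
  have hfc : Continuous f := hf.continuous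
  have hg : Continuous fun x => d * f x + fderiv ℝ f x (x - a) := by fun_prop
  rw [setIntegral_cone hn hh hF hFc hg, setIntegral_hyperplane a hn hF hFc.measurableSet]
  set F' := (fun y : (ℝ ∙ n)ᗮ => sliceMap a n (h, y)) ⁻¹' F with hF'
  have hF'c : IsCompact F' := by
    exact (isometry_slice a n h).isClosedEmbedding.isCompact_preimage hFc
  have hcont : Continuous fun z : ℝ × (ℝ ∙ n)ᗮ => (z.1 / h) ^ (d - 1) *
      (d * f (sliceMap a n (z.1, (z.1 / h) • z.2)) +
        fderiv ℝ f (sliceMap a n (z.1, (z.1 / h) • z.2))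
          (sliceMap a n (z.1, (z.1 / h) • z.2) - a)) := by
    have h0 : Continuous fun z : ℝ × (ℝ ∙ n)ᗮ => sliceMap a n (z.1, (z.1 / h) • z.2) :=
      (continuous_sliceMap a n).comp (by fun_prop)
    fun_prop
  rw [integral_integral_swap]
  · rw [← integral_const_mul]
    refine setIntegral_congr_fun hF'c.measurableSet fun y _ => ?_
    -- Along a ray from the apex the integrand is a total derivative in s. Its primitive h (s/h)^d f
    -- vanishes at the apex since d ≥ 1, and equals h f at the base.
    have hderiv : ∀ s : ℝ, HasDerivAt
        (fun s => h * ((s / h) ^ d * f (a + (s / h) • (sliceMap a n (h, y) - a))))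
        ((s / h) ^ (d - 1) * (d * f (sliceMap a n (s, (s / h) • y)) +
          fderiv ℝ f (sliceMap a n (s, (s / h) • y)) (sliceMap a n (s, (s / h) • y) - a))) s := by
      intro s
      have key : sliceMap a n (s, (s / h) • y) = a + (s / h) • (sliceMap a n (h, y) - a) := by
        simp only [sliceMap, add_sub_cancel_left, smul_add, smul_smul, Submodule.coe_smul]
        rw [div_mul_cancel₀ _ hh.ne']
      rw [key]
      set v := sliceMap a n (h, y) - a
      have hs : HasDerivAt (fun s : ℝ => s / h) (1 / h) s := (hasDerivAt_id s).div_const h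
      have hc : HasDerivAt (fun s : ℝ => a + (s / h) • v) ((1 / h) • v) s :=
        (hs.smul_const v).const_add a
      have hfd := (hf.differentiable one_ne_zero (a + (s / h) • v)).hasFDerivAt
      have h1 := ((hs.pow d).mul (hfd.comp_hasDerivAt s hc)).const_mul h
      refine HasDerivAt.congr_deriv h1 ?_
      have hpow : (s / h) ^ d = (s / h) ^ (d - 1) * (s / h) := by
        rw [← pow_succ]; congr 1; omega
      simp only [map_smul, smul_eq_mul, add_sub_cancel_left, Function.comp, Pi.pow_apply]
      rw [hpow]
      field_simp
    have hFTC := intervalIntegral.integral_eq_sub_of_hasDerivAt (a := 0) (b := h)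
      (fun s _ => hderiv s)
      ((hcont.comp (Continuous.prodMk continuous_id continuous_const)).intervalIntegrable _ _)
    rw [intervalIntegral.integral_of_le hh.le] at hFTC
    refine Eq.trans ?_ hFTC.symm
    have : d ≠ 0 := by omega
    simp [hh.ne', this]
  · have h1 := hcont.continuousOn.integrableOn_compact ((isCompact_Icc (a := (0 : ℝ)) (b := h)).prod hF'c)
      (μ := volume.prod volume)
    rw [Measure.prod_restrict]
    exact h1.mono_set (Set.prod_mono_left Set.Ioc_subset_Icc_self)

/-! ### Simplices -/

/-- `K` is the vertex set of a nondegenerate simplex of full dimension. -/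
structure IsSimplex {d : ℕ} (K : Finset (E d)) : Prop where
  card_eq : K.card = d + 1
  affineIndependent : AffineIndependent ℝ (fun a : K => (a : E d))

theorem Mesh.isSimplex {d : ℕ} {Ω : Domain d} (M : Mesh Ω) {K : Finset (E d)} (hK : K ∈ M.cells) :
    IsSimplex K := ⟨M.card_eq K hK, M.affineIndependent K hK⟩

theorem isCompact_hull {d : ℕ} (K : Finset (E d)) : IsCompact (hull K) :=
  K.finite_toSet.isCompact_convexHull ℝ

theorem convex_hull {d : ℕ} (K : Finset (E d)) : Convex ℝ (hull K) := convex_convexHull ℝ _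

theorem hull_mono {d : ℕ} {K L : Finset (E d)} (h : K ⊆ L) : hull K ⊆ hull L :=
  convexHull_mono (Finset.coe_subset.2 h)

theorem subset_hull {d : ℕ} {K : Finset (E d)} {a : E d} (ha : a ∈ K) : a ∈ hull K :=
  subset_convexHull ℝ _ (Finset.mem_coe.2 ha)

open Classical in
theorem facet_eq_hull {d : ℕ} (K : Finset (E d)) (a : E d) : facet K a = hull (K.erase a) := by
  simp [facet, hull]

theorem isCompact_facet {d : ℕ} (K : Finset (E d)) (a : E d) : IsCompact (facet K a) := by
  classical
  rw [facet_eq_hull]; exact isCompact_hull _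

theorem facet_subset_hull {d : ℕ} (K : Finset (E d)) (a : E d) : facet K a ⊆ hull K :=
  convexHull_mono Set.sdiff_subset

namespace IsSimplex

variable {d : ℕ} {K : Finset (E d)}

/-- Barycentric coordinates. -/
def bary (hK : IsSimplex K) : AffineBasis K ℝ (E d) :=
  ⟨fun a => (a : E d), hK.affineIndependent, by
    rw [hK.affineIndependent.affineSpan_eq_top_iff_card_eq_finrank_add_one]
    simp [hK.card_eq]⟩

@[simp]
theorem bary_apply (hK : IsSimplex K) (a : K) : hK.bary a = a := rfl

theorem range_bary (hK : IsSimplex K) : Set.range hK.bary = K := by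
  ext x; simp

theorem mem_hull_iff (hK : IsSimplex K) {x : E d} : x ∈ hull K ↔ ∀ b, 0 ≤ hK.bary.coord b x := by
  rw [hull, ← hK.range_bary, hK.bary.convexHull_eq_nonneg_coord]; rfl

theorem mem_interior_hull_iff (hK : IsSimplex K) {x : E d} :
    x ∈ interior (hull K) ↔ ∀ b, 0 < hK.bary.coord b x := by
  rw [hull, ← hK.range_bary, hK.bary.interior_convexHull]; rfl

theorem coord_vertex (hK : IsSimplex K) (a b : K) [Decidable (a = b)] :
    hK.bary.coord a b = if a = b then 1 else 0 := by
  classical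
  have := hK.bary.coord_apply a b
  rw [bary_apply] at this
  rw [this]
  congr

theorem continuous_coord (hK : IsSimplex K) (b : K) : Continuous (hK.bary.coord b) :=
  continuous_barycentric_coord hK.bary b

theorem sum_coord_smul (hK : IsSimplex K) (x : E d) :
    ∑ b, hK.bary.coord b x • (b : E d) = x := hK.bary.linear_combination_coord_eq_self x

/-- Discarding the zero terms of the barycentric expansion leaves a convex combination of W.
Incidence questions about faces thereby become questions about which coordinates vanish. -/
theorem mem_hull_subset_iff (hK : IsSimplex K) {W : Finset (E d)} (hW : W ⊆ K) {x : E d} :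
    x ∈ hull W ↔ x ∈ hull K ∧ ∀ b : K, (b : E d) ∉ W → hK.bary.coord b x = 0 := by
  classical
  constructor
  · intro hx
    refine ⟨hull_mono hW hx, fun b hb => ?_⟩
    have hsub : hull W ⊆ (hK.bary.coord b : E d → ℝ) ⁻¹' {0} := by
      refine convexHull_min ?_ ((convex_singleton (0 : ℝ)).affine_preimage _)
      intro y hy
      have hyK : y ∈ K := hW hy
      have := hK.coord_vertex b ⟨y, hyK⟩
      rw [if_neg (by rintro rfl; exact hb hy)] at this
      exact this
    exact hsub hx
  · rintro ⟨hx, h0⟩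
    rw [hK.mem_hull_iff] at hx
    rw [← hK.sum_coord_smul x]
    have hs1 : ∑ b : K, hK.bary.coord b x = 1 := hK.bary.sum_coord_apply_eq_one x
    rw [← Finset.sum_filter_of_ne (s := Finset.univ) (p := fun b : K => (b : E d) ∈ W)
      (f := fun b : K => hK.bary.coord b x • (b : E d))
      (fun b _ hb => by by_contra h; exact hb (by simp [h0 b h]))]
    refine (convex_convexHull ℝ (W : Set (E d))).sum_mem (fun b _ => hx b) ?_
      fun b hb => subset_hull (Finset.mem_filter.1 hb).2
    rw [← hs1]
    refine Finset.sum_filter_of_ne fun b _ hb => ?_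
    by_contra h
    exact hb (h0 b h)

theorem mem_facet_iff (hK : IsSimplex K) {a : E d} (ha : a ∈ K) {x : E d} :
    x ∈ facet K a ↔ x ∈ hull K ∧ hK.bary.coord ⟨a, ha⟩ x = 0 := by
  classical
  rw [facet_eq_hull, hK.mem_hull_subset_iff (Finset.erase_subset a K)]
  refine and_congr_right fun _ => ⟨fun h => h _ (by simp), fun h b hb => ?_⟩
  have : b = ⟨a, ha⟩ := by
    ext1
    by_contra hne
    exact hb (Finset.mem_erase.2 ⟨hne, b.2⟩)
  rw [this, h]

theorem interior_nonempty (hK : IsSimplex K) : (interior (hull K)).Nonempty := by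
  rw [hull, ← hK.range_bary]
  exact ⟨_, hK.bary.centroid_mem_interior_convexHull⟩

theorem volume_frontier (K : Finset (E d)) : volume (frontier (hull K)) = 0 :=
  (convex_hull K).addHaar_frontier _

theorem volume_pos (hK : IsSimplex K) : 0 < volume (hull K) :=
  lt_of_lt_of_le (isOpen_interior.measure_pos _ hK.interior_nonempty)
    (measure_mono interior_subset)

theorem volume_lt_top (K : Finset (E d)) : volume (hull K) < ⊤ := (isCompact_hull K).measure_lt_top

/-- The outer unit normal and the height of a simplex. -/
theorem outerNormal_spec (hK : IsSimplex K) (hd : 1 ≤ d) {a : E d} (ha : a ∈ K) :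
    ‖outerNormal K a‖ = 1 ∧ ∃ h > 0, ∀ b ∈ K, b ≠ a → ⟪b - a, outerNormal K a⟫ = h := by
  set S := vectorSpan ℝ ((K : Set (E d)) \ {a}) with hS
  set P := Sᗮ.starProjection with hP
  obtain ⟨b₀, hb₀, hba⟩ : ∃ b ∈ K, b ≠ a := Finset.exists_mem_ne (by rw [hK.card_eq]; omega) a
  -- Differences of vertices of the facet lie in its direction space, which P annihilates. All edges
  -- from a thus have the same normal component N.
  have hPeq : ∀ b ∈ K, b ≠ a → P (b - a) = P (b₀ - a) := by
    intro b hb hne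
    have h1 : b - b₀ ∈ S := vsub_mem_vectorSpan ℝ (s := (K : Set (E d)) \ {a}) ⟨hb, hne⟩ ⟨hb₀, hba⟩
    have h2 : P (b - b₀) = 0 := by
      rw [hP, Submodule.starProjection_apply_eq_zero_iff]
      exact Submodule.le_orthogonal_orthogonal S h1
    have h3 : b - a = (b - b₀) + (b₀ - a) := by abel
    rw [h3, map_add, h2, zero_add]
  set N := P (b₀ - a) with hN
  -- N = 0 would place a in the affine span of the other vertices, against affine independence.
  have hN0 : N ≠ 0 := by
    intro h0
    rw [hN, hP, Submodule.starProjection_apply_eq_zero_iff, Submodule.orthogonal_orthogonal] at h0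
    have h1 : a ∈ affineSpan ℝ ((K : Set (E d)) \ {a}) := by
      have h2 : -(b₀ - a) +ᵥ b₀ ∈ affineSpan ℝ ((K : Set (E d)) \ {a}) := by
        refine AffineSubspace.vadd_mem_of_mem_direction ?_ (mem_affineSpan ℝ ⟨hb₀, hba⟩)
        rw [direction_affineSpan]
        exact S.neg_mem h0
      simpa using h2
    have h3 := hK.affineIndependent.notMem_affineSpan_sdiff ⟨a, ha⟩ Set.univ
    refine h3 ?_
    convert h1 using 2
    ext x
    constructor
    · rintro ⟨y, ⟨_, hy⟩, rfl⟩
      exact ⟨y.2, fun h => hy (Subtype.ext h)⟩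
    · rintro ⟨hx, hne⟩
      exact ⟨⟨x, hx⟩, ⟨trivial, fun h => hne (congrArg Subtype.val h)⟩, rfl⟩
  -- In the mean of the d + 1 vectors b - a, the term b = a is zero and the other d project to N.
  -- The factor d/(d+1) is positive, so normalising removes it.
  have hbar : P (((K.card : ℝ)⁻¹ • (∑ b ∈ K, b)) - a) = ((d : ℝ) / (d + 1)) • N := by
    have hc : (K.card : ℝ) = d + 1 := by rw [hK.card_eq]; push_cast; ring
    have hc0 : (d : ℝ) + 1 ≠ 0 := by positivity
    have h1 : ((K.card : ℝ)⁻¹ • (∑ b ∈ K, b)) - a = (K.card : ℝ)⁻¹ • ∑ b ∈ K, (b - a) := by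
      rw [Finset.sum_sub_distrib, smul_sub, Finset.sum_const, ← Nat.cast_smul_eq_nsmul ℝ,
        smul_smul, inv_mul_cancel₀ (by rw [hc]; exact hc0), one_smul]
    rw [h1, map_smul, map_sum]
    classical
    rw [← Finset.add_sum_erase _ _ ha, sub_self, map_zero, zero_add,
      Finset.sum_congr rfl (fun b hb => hPeq b (Finset.mem_of_mem_erase hb)
        (Finset.ne_of_mem_erase hb)), Finset.sum_const, Finset.card_erase_of_mem ha, hK.card_eq,
      ← Nat.cast_smul_eq_nsmul ℝ, smul_smul]
    congr 1
    rw [Nat.add_sub_cancel]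
    push_cast
    field_simp
  have hout : outerNormal K a = ‖N‖⁻¹ • N := by
    have hd0 : (0 : ℝ) < (d : ℝ) / (d + 1) := by
      have : (0 : ℝ) < d := by exact_mod_cast hd
      positivity
    have : outerNormal K a = ‖((d : ℝ) / (d + 1)) • N‖⁻¹ • (((d : ℝ) / (d + 1)) • N) := by
      rw [← hbar]; rfl
    rw [this, norm_smul, Real.norm_of_nonneg hd0.le, smul_smul, mul_inv, mul_right_comm,
      inv_mul_cancel₀ hd0.ne', one_mul]
  have hNn : 0 < ‖N‖ := norm_pos_iff.2 hN0
  refine ⟨by rw [hout, norm_smul, norm_inv, norm_norm, inv_mul_cancel₀ hNn.ne'], ‖N‖, hNn, ?_⟩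
  intro b hb hne
  have h1 : ⟪b - a, N⟫ = ‖N‖ ^ 2 := by
    rw [← real_inner_self_eq_norm_sq, ← hPeq b hb hne, hP]
    conv_rhs => rw [Submodule.inner_starProjection_left_eq_right]
    rw [Submodule.starProjection_eq_self_iff.2 (Submodule.starProjection_apply_mem _ _)]
  rw [hout, inner_smul_right, h1]
  field_simp


theorem norm_outerNormal (hK : IsSimplex K) (hd : 1 ≤ d) {a : E d} (ha : a ∈ K) :
    ‖outerNormal K a‖ = 1 := (hK.outerNormal_spec hd ha).1

theorem exists_height (hK : IsSimplex K) (hd : 1 ≤ d) {a : E d} (ha : a ∈ K) :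
    ∃ h > 0, ∀ x ∈ facet K a, ⟪x - a, outerNormal K a⟫ = h := by
  obtain ⟨h, hh, hb⟩ := (hK.outerNormal_spec hd ha).2
  refine ⟨h, hh, fun x hx => ?_⟩
  have hconv : Convex ℝ {x : E d | ⟪x - a, outerNormal K a⟫ = h} := by
    intro x hx y hy s t _ _ hst
    have h1 : s • x + t • y - a = s • (x - a) + t • (y - a) := by
      have : a = (s + t) • a := by rw [hst, one_smul]
      conv_lhs => rw [this]
      rw [add_smul, smul_sub, smul_sub]; abel
    have hx' : ⟪x - a, outerNormal K a⟫ = h := hx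
    have hy' : ⟪y - a, outerNormal K a⟫ = h := hy
    show ⟪s • x + t • y - a, outerNormal K a⟫ = h
    rw [h1, inner_add_left, inner_smul_left, inner_smul_left, hx', hy']
    simp [← add_mul, hst]
  exact convexHull_min (fun b hb' => hb b hb'.1 hb'.2) hconv hx

theorem vertex_mem_facet {a b : E d} (hb : b ∈ K) (hne : b ≠ a) : b ∈ facet K a :=
  subset_convexHull ℝ _ ⟨hb, hne⟩

/-- A simplex is the join of a vertex with the opposite facet, so the slicing of cones applies from
each of its vertices. -/
theorem cone_facet (hK : IsSimplex K) (hd : 1 ≤ d) {a : E d} (ha : a ∈ K) :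
    cone a (facet K a) = hull K := by
  obtain ⟨b₀, hb₀, hba⟩ : ∃ b ∈ K, b ≠ a := Finset.exists_mem_ne (by rw [hK.card_eq]; omega) a
  have hins : hull K = convexJoin ℝ {a} (facet K a) := by
    rw [facet, ← convexHull_insert (s := (K : Set (E d)) \ {a}) ⟨b₀, hb₀, hba⟩, Set.insert_sdiff_singleton,
      Set.insert_eq_of_mem (Finset.mem_coe.2 ha), hull]
  rw [hins]
  ext x
  simp only [convexJoin_singleton_left, Set.mem_iUnion, segment_eq_image', cone, Set.mem_image,
    Set.mem_prod, Prod.exists]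
  constructor
  · rintro ⟨t, y, ⟨ht, hy⟩, rfl⟩
    exact ⟨y, hy, t, ht, rfl⟩
  · rintro ⟨y, hy, t, ht, rfl⟩
    exact ⟨t, y, ⟨ht, hy⟩, rfl⟩

theorem surf_facet_lt_top (hK : IsSimplex K) (hd : 1 ≤ d) {a : E d} (ha : a ∈ K) :
    surf d (facet K a) < ⊤ := by
  obtain ⟨h, _, hF⟩ := hK.exists_height hd ha
  exact surf_lt_top (hK.norm_outerNormal hd ha) hF (isCompact_facet K a)

/-- The faces of a facet are null sets for the surface measure. -/
theorem surf_facet_inter_coord_eq_zero (hK : IsSimplex K) (hd : 1 ≤ d) {a b : E d} (ha : a ∈ K)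
    (hb : b ∈ K) (hab : b ≠ a) :
    surf d (facet K a ∩ {x | hK.bary.coord ⟨b, hb⟩ x = 0}) = 0 := by
  obtain ⟨h, hh, hF⟩ := hK.exists_height hd ha
  set n := outerNormal K a with hn'
  have hn : ‖n‖ = 1 := hK.norm_outerNormal hd ha
  have hZ : IsClosed {x | hK.bary.coord ⟨b, hb⟩ x = 0} :=
    isClosed_singleton.preimage (hK.continuous_coord _)
  have hsub : facet K a ⊆ {x | ⟪x - a, n⟫ = h} := hF
  refine le_antisymm ?_ zero_le
  calc surf d (facet K a ∩ {x | hK.bary.coord ⟨b, hb⟩ x = 0})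
      ≤ surf d ({x | hK.bary.coord ⟨b, hb⟩ x = 0} ∩ {x | ⟪x - a, n⟫ = h}) :=
        measure_mono fun x hx => ⟨hx.2, hsub hx.1⟩
    _ = ((surf d).restrict {x | ⟪x - a, n⟫ = h}) {x | hK.bary.coord ⟨b, hb⟩ x = 0} :=
        (Measure.restrict_apply hZ.measurableSet).symm
    _ = 0 := by
        rw [← surf_restrict_hyperplane a hn, (measurableEmbedding_slice a n h).map_apply]
        -- In hyperplane coordinates the barycentric coordinate of b is affine and takes the value 1
        -- at b. Its zero set is a proper affine subspace, hence null.
        let g : (ℝ ∙ n)ᗮ →ᵃ[ℝ] ℝ := (hK.bary.coord ⟨b, hb⟩).comp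
          ((ℝ ∙ n)ᗮ.subtype.toAffineMap + AffineMap.const ℝ _ (a + h • n))
        have hg : ∀ y, g y = hK.bary.coord ⟨b, hb⟩ (sliceMap a n (h, y)) := by
          intro y
          simp only [g, sliceMap, AffineMap.comp_apply]
          congr 1
          show (y : E d) + (a + h • n) = _
          abel
        let S : AffineSubspace ℝ (ℝ ∙ n)ᗮ := (AffineSubspace.mk' (0 : ℝ) ⊥).comap g
        have hS : ((fun y => sliceMap a n (h, y)) ⁻¹' {x | hK.bary.coord ⟨b, hb⟩ x = 0}) = S := by
          ext y
          simp [S, ← hg]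
        rw [hS]
        refine Measure.addHaar_affineSubspace _ _ fun htop => ?_
        obtain ⟨y, hy⟩ := exists_sliceMap_eq a hn b
        rw [hF b (vertex_mem_facet hb hab)] at hy
        have hyS : y ∈ S := htop ▸ AffineSubspace.mem_top _ _ _
        have h0 : g y = 0 := by simpa [S] using hyS
        rw [hg, hy] at h0
        classical
        have h1 := hK.coord_vertex ⟨b, hb⟩ ⟨b, hb⟩
        rw [if_pos rfl] at h1
        exact one_ne_zero (h1.symm.trans h0)

/-- The divergence theorem for the field `f (x - a)`. -/
theorem integral_div_vertex (hK : IsSimplex K) (hd : 1 ≤ d) {a : E d} (ha : a ∈ K) {h : ℝ}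
    (hh : 0 < h) (hF : ∀ x ∈ facet K a, ⟪x - a, outerNormal K a⟫ = h) {f : E d → ℝ}
    (hf : ContDiff ℝ 1 f) :
    h * ∫ x in facet K a, f x ∂(surf d) =
      ∫ x in hull K, (d * f x + fderiv ℝ f x (x - a)) := by
  rw [integral_cone_div hd (hK.norm_outerNormal hd ha) hh hF (isCompact_facet K a) hf,
    hK.cone_facet hd ha]

/-- The divergence theorem on a simplex. -/
theorem integral_fderiv (hK : IsSimplex K) (hd : 1 ≤ d) {f : E d → ℝ} (hf : ContDiff ℝ 1 f)
    (e : E d) :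
    ∫ x in hull K, fderiv ℝ f x e =
      ∑ a ∈ K, ∫ x in facet K a, f x * ⟪e, outerNormal K a⟫ ∂(surf d) := by
  have hf' : Continuous (fderiv ℝ f) := hf.continuous_fderiv one_ne_zero
  have hfc : Continuous f := hf.continuous
  have hint : ∀ g : E d → ℝ, Continuous g → IntegrableOn g (hull K) := fun g hg =>
    hg.continuousOn.integrableOn_compact (isCompact_hull K)
  simp_rw [integral_mul_const]
  -- both sides are linear in `e`
  let L : E d →ₗ[ℝ] ℝ :=
    { toFun := fun e => (∫ x in hull K, fderiv ℝ f x e) -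
        ∑ a ∈ K, (∫ x in facet K a, f x ∂(surf d)) * ⟪e, outerNormal K a⟫
      map_add' := by
        intro u v
        simp_rw [map_add, inner_add_left, mul_add, Finset.sum_add_distrib]
        rw [integral_add (hint _ (by fun_prop)) (hint _ (by fun_prop))]
        ring
      map_smul' := by
        intro c u
        simp_rw [map_smul, inner_smul_left, smul_eq_mul, integral_const_mul, conj_trivial,
          mul_left_comm _ c, ← Finset.mul_sum, RingHom.id_apply]
        ring }
  suffices hL : L = 0 by
    have := LinearMap.congr_fun hL e
    exact sub_eq_zero.1 this
  obtain ⟨c, hc⟩ : K.Nonempty := Finset.card_pos.1 (by rw [hK.card_eq]; omega)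
  have hspan : vectorSpan ℝ (K : Set (E d)) = ⊤ := by
    have h1 := hK.bary.tot
    rw [hK.range_bary] at h1
    rw [← direction_affineSpan, h1, AffineSubspace.direction_top]
  -- Edge directions b - c with c fixed span the space, so by linearity only these need checking.
  rw [← LinearMap.ker_eq_top, eq_top_iff, ← hspan,
    vectorSpan_eq_span_vsub_set_right ℝ (Finset.mem_coe.2 hc), Submodule.span_le]
  rintro _ ⟨b, hb, rfl⟩
  rw [Finset.mem_coe] at hb
  show L (b - c) = 0
  by_cases hbc : b = c
  · rw [hbc, sub_self, map_zero]
  obtain ⟨hc', hhc, hFc⟩ := hK.exists_height hd hc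
  obtain ⟨hb', hhb, hFb⟩ := hK.exists_height hd hb
  have h1 := hK.integral_div_vertex hd hc hhc hFc hf
  have h2 := hK.integral_div_vertex hd hb hhb hFb hf
  -- The constant direction b - c is (x - c) - (x - b): the two radial formulas with apexes c and b
  -- are subtracted, and the zeroth-order terms cancel.
  have h3 : ∫ x in hull K, fderiv ℝ f x (b - c) =
      hc' * (∫ x in facet K c, f x ∂(surf d)) - hb' * ∫ x in facet K b, f x ∂(surf d) := by
    rw [h1, h2, ← integral_sub (hint _ (by fun_prop)) (hint _ (by fun_prop))]
    refine integral_congr_ae (Eventually.of_forall fun x => ?_)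
    simp only [map_sub]
    ring
  -- Any facet opposite to a third vertex contains both b and c, so b - c is tangential to it.
  have h4 : ∑ a ∈ K, (∫ x in facet K a, f x ∂(surf d)) * ⟪b - c, outerNormal K a⟫ =
      ∑ a ∈ {b, c}, (∫ x in facet K a, f x ∂(surf d)) * ⟪b - c, outerNormal K a⟫ := by
    classical
    refine (Finset.sum_subset (by simp [Finset.insert_subset_iff, hb, hc]) ?_).symm
    intro a ha hne
    simp only [Finset.mem_insert, Finset.mem_singleton, not_or] at hne
    obtain ⟨h, _, hF⟩ := hK.exists_height hd ha
    have e1 := hF b (vertex_mem_facet hb (Ne.symm hne.1))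
    have e2 := hF c (vertex_mem_facet hc (Ne.symm hne.2))
    have : b - c = (b - a) - (c - a) := by abel
    rw [this, inner_sub_left, e1, e2, sub_self, mul_zero]
  show (∫ x in hull K, fderiv ℝ f x (b - c)) -
    ∑ a ∈ K, (∫ x in facet K a, f x ∂(surf d)) * ⟪b - c, outerNormal K a⟫ = 0
  rw [h3, h4, Finset.sum_pair hbc, hFc b (vertex_mem_facet hb hbc),
    show b - c = -(c - b) by abel, inner_neg_left, hFb c (vertex_mem_facet hc (Ne.symm hbc))]
  ring

end IsSimplex

/-! ### Polynomial functions -/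

section Polynomials

variable {d : ℕ}

@[simp] theorem polyFun_zero (x : E d) : polyFun 0 x = 0 := by simp [polyFun]
@[simp] theorem polyFun_one (x : E d) : polyFun 1 x = 1 := by simp [polyFun]
@[simp] theorem polyFun_C (c : ℝ) (x : E d) : polyFun (MvPolynomial.C c) x = c := by simp [polyFun]
@[simp] theorem polyFun_X (i : Fin d) (x : E d) : polyFun (MvPolynomial.X i) x = x i := by
  simp [polyFun]
@[simp] theorem polyFun_add (q r : MvPolynomial (Fin d) ℝ) (x : E d) :
    polyFun (q + r) x = polyFun q x + polyFun r x := by simp [polyFun]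
@[simp] theorem polyFun_sub (q r : MvPolynomial (Fin d) ℝ) (x : E d) :
    polyFun (q - r) x = polyFun q x - polyFun r x := by simp [polyFun]
@[simp] theorem polyFun_mul (q r : MvPolynomial (Fin d) ℝ) (x : E d) :
    polyFun (q * r) x = polyFun q x * polyFun r x := by simp [polyFun]
@[simp] theorem polyFun_smul (c : ℝ) (q : MvPolynomial (Fin d) ℝ) (x : E d) :
    polyFun (c • q) x = c * polyFun q x := by simp [polyFun]
@[simp] theorem polyFun_sum {ι : Type*} (s : Finset ι) (q : ι → MvPolynomial (Fin d) ℝ) (x : E d) :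
    polyFun (∑ i ∈ s, q i) x = ∑ i ∈ s, polyFun (q i) x := by simp [polyFun]

@[simp] theorem polyGrad_apply (q : MvPolynomial (Fin d) ℝ) (x : E d) (i : Fin d) :
    polyGrad q x i = polyFun (MvPolynomial.pderiv i q) x := rfl
@[simp] theorem polyGrad_add (q r : MvPolynomial (Fin d) ℝ) (x : E d) :
    polyGrad (q + r) x = polyGrad q x + polyGrad r x := by ext i; simp
@[simp] theorem polyGrad_sub (q r : MvPolynomial (Fin d) ℝ) (x : E d) :
    polyGrad (q - r) x = polyGrad q x - polyGrad r x := by ext i; simp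
@[simp] theorem polyGrad_smul (c : ℝ) (q : MvPolynomial (Fin d) ℝ) (x : E d) :
    polyGrad (c • q) x = c • polyGrad q x := by ext i; simp
@[simp] theorem polyGrad_C (c : ℝ) (x : E d) : polyGrad (MvPolynomial.C c) x = 0 := by ext i; simp
@[simp] theorem polyGrad_zero (x : E d) : polyGrad 0 x = 0 := by ext i; simp

theorem hasGradientAt_polyFun (q : MvPolynomial (Fin d) ℝ) (x : E d) :
    HasGradientAt (polyFun q) (polyGrad q x) x := by
  rw [hasGradientAt_iff_hasFDerivAt]
  induction q using MvPolynomial.induction_on with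
  | C c =>
    have h : (polyFun (MvPolynomial.C c) : E d → ℝ) = fun _ => c := by funext y; simp
    rw [h, polyGrad_C, map_zero]
    exact hasFDerivAt_const c x
  | add q r hq hr =>
    have h : polyFun (q + r) = fun y : E d => polyFun q y + polyFun r y := by funext y; simp
    rw [h, polyGrad_add, map_add]
    exact hq.add hr
  | mul_X q i hq =>
    have h : polyFun (q * MvPolynomial.X i) = fun y : E d => polyFun q y * y i := by
      funext y; simp
    rw [h]
    have hx : HasFDerivAt (fun y : E d => y i) (EuclideanSpace.proj i : E d →L[ℝ] ℝ) x :=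
      (EuclideanSpace.proj i : E d →L[ℝ] ℝ).hasFDerivAt
    refine (hq.mul hx).congr_fderiv ?_
    ext v
    simp only [add_apply, smul_apply,
      InnerProductSpace.toDual_apply_apply, smul_eq_mul]
    simp only [PiLp.inner_apply, polyGrad_apply, Derivation.leibniz, MvPolynomial.pderiv_X,
      polyFun_add, smul_eq_mul, polyFun_mul, polyFun_X]
    simp only [RCLike.inner_apply, conj_trivial, mul_add, Finset.sum_add_distrib]
    have hs : ∑ j, v j * (polyFun q x *
        polyFun (Pi.single (M := fun _ => MvPolynomial (Fin d) ℝ) j 1 i) x) = polyFun q x * v i := by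
      rw [Finset.sum_eq_single i (fun j _ hj => by simp [Pi.single_eq_of_ne hj.symm]) (by simp)]
      simp [mul_comm]
    rw [hs]
    simp [Finset.mul_sum, mul_left_comm]

theorem gradient_polyFun (q : MvPolynomial (Fin d) ℝ) : gradient (polyFun q) = polyGrad q :=
  funext fun x => (hasGradientAt_polyFun q x).gradient

theorem contDiff_polyFun (q : MvPolynomial (Fin d) ℝ) : ContDiff ℝ ∞ (polyFun q) := by
  induction q using MvPolynomial.induction_on with
  | C c =>
    have h : (polyFun (MvPolynomial.C c) : E d → ℝ) = fun _ => c := by funext y; simp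
    rw [h]; exact contDiff_const
  | add q r hq hr =>
    have h : polyFun (q + r) = fun y : E d => polyFun q y + polyFun r y := by funext y; simp
    rw [h]; exact hq.add hr
  | mul_X q i hq =>
    have h : polyFun (q * MvPolynomial.X i) = fun y : E d => polyFun q y * y i := by
      funext y; simp
    rw [h]
    exact hq.mul (EuclideanSpace.proj i : E d →L[ℝ] ℝ).contDiff

theorem contDiff_one_polyFun (q : MvPolynomial (Fin d) ℝ) : ContDiff ℝ 1 (polyFun q) :=
  (contDiff_polyFun q).of_le (by exact_mod_cast le_top)

@[fun_prop]
theorem continuous_polyFun (q : MvPolynomial (Fin d) ℝ) : Continuous (polyFun q) :=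
  (contDiff_polyFun q).continuous

@[fun_prop]
theorem continuous_polyGrad (q : MvPolynomial (Fin d) ℝ) : Continuous (polyGrad q) := by
  unfold polyGrad
  exact (PiLp.continuous_toLp 2 _).comp (continuous_pi fun i => continuous_polyFun _)

@[fun_prop]
theorem continuous_polyLapl (q : MvPolynomial (Fin d) ℝ) : Continuous (polyLapl q) := by
  unfold polyLapl
  fun_prop

theorem inner_eq_fderiv {f : E d → ℝ} {x : E d} (hf : DifferentiableAt ℝ f x) (v : E d) :
    ⟪gradient f x, v⟫ = fderiv ℝ f x v := by
  have h := hf.hasGradientAt.hasFDerivAt.fderiv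
  rw [h, InnerProductSpace.toDual_apply_apply]

/-- An open set contains a product of nontrivial intervals, and a polynomial vanishing on a product
of infinite sets is zero. -/
theorem eq_zero_of_eqOn_open {q : MvPolynomial (Fin d) ℝ} {U : Set (E d)} (hU : IsOpen U)
    (hne : U.Nonempty) (h : ∀ x ∈ U, polyFun q x = 0) : q = 0 := by
  obtain ⟨x₀, hx₀⟩ := hne
  let V : Set (Fin d → ℝ) := (WithLp.toLp 2 : (Fin d → ℝ) → E d) ⁻¹' U
  have hV : IsOpen V := hU.preimage (PiLp.continuous_toLp 2 _)
  obtain ⟨ε, hε, hball⟩ := Metric.isOpen_iff.1 hV (fun i => x₀ i) hx₀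
  refine MvPolynomial.funext_set (fun i => Metric.ball (x₀ i) ε) (fun i => ?_) fun x hx => ?_
  · rw [Real.ball_eq_Ioo]
    exact Set.Ioo_infinite (by linarith)
  · rw [map_zero]
    have hxV : x ∈ V := by
      refine hball ?_
      rw [Metric.mem_ball, dist_pi_lt_iff hε]
      exact fun i => hx i trivial
    exact h _ hxV

theorem eq_of_ae_eq_on {q r : MvPolynomial (Fin d) ℝ} {A : Set (E d)}
    (hne : (interior A).Nonempty) (h : ∀ᵐ x ∂(volume : Measure (E d)), x ∈ A → polyFun q x = polyFun r x) :
    q = r := by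
  rw [← sub_eq_zero]
  refine eq_zero_of_eqOn_open isOpen_interior hne ?_
  have h1 : polyFun (q - r) =ᵐ[volume.restrict (interior A)] fun _ => (0 : ℝ) := by
    rw [EventuallyEq, ae_restrict_iff' isOpen_interior.measurableSet]
    filter_upwards [h] with x hx hxA
    simp [hx (interior_subset hxA)]
  exact Measure.eqOn_open_of_ae_eq h1 isOpen_interior (continuous_polyFun _).continuousOn
    continuousOn_const

theorem exists_eq_C_of_polyGrad_eq_zero {q : MvPolynomial (Fin d) ℝ} {A : Set (E d)}
    (hne : (interior A).Nonempty) (h : ∀ᵐ x ∂(volume : Measure (E d)), x ∈ A → polyGrad q x = 0) :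
    ∃ c, q = MvPolynomial.C c := by
  have hp : ∀ i, MvPolynomial.pderiv i q = 0 := fun i => by
    refine eq_of_ae_eq_on hne ?_
    filter_upwards [h] with x hx hxA
    rw [← polyGrad_apply, hx hxA]
    simp
  have hgrad : ∀ x : E d, polyGrad q x = 0 := fun x => by ext i; simp [hp i]
  refine ⟨polyFun q (0 : E d), ?_⟩
  rw [← sub_eq_zero]
  refine eq_zero_of_eqOn_open (d := d) isOpen_univ ⟨0, trivial⟩ fun x _ => ?_
  have hc := is_const_of_fderiv_eq_zero (𝕜 := ℝ) (f := polyFun q)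
    (fun x => (hasGradientAt_polyFun q x).hasFDerivAt.differentiableAt) (fun x => by
      rw [(hasGradientAt_polyFun q x).hasFDerivAt.fderiv, hgrad, map_zero]) x 0
  simp [hc]

theorem C_mem_Poly (c : ℝ) (n : ℕ) : (MvPolynomial.C c : MvPolynomial (Fin d) ℝ) ∈ Poly d n := by
  rw [MvPolynomial.mem_restrictTotalDegree]; simp

theorem Poly_mono {m n : ℕ} (h : m ≤ n) : Poly d m ≤ Poly d n := fun q hq => by
  rw [MvPolynomial.mem_restrictTotalDegree] at *; omega

theorem pderiv_mem_Poly {n : ℕ} {q : MvPolynomial (Fin d) ℝ} (hq : q ∈ Poly d (n + 1)) (i : Fin d) :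
    MvPolynomial.pderiv i q ∈ Poly d n := by
  rw [q.as_sum, map_sum]
  refine Submodule.sum_mem _ fun s hs => ?_
  rw [MvPolynomial.pderiv_monomial]
  by_cases hsi : s i = 0
  · simp [hsi]
  rw [MvPolynomial.mem_restrictTotalDegree] at hq ⊢
  refine (MvPolynomial.totalDegree_monomial_le _ _).trans ?_
  have h1 : s.degree ≤ n + 1 := (MvPolynomial.le_totalDegree hs).trans hq
  have hle : Finsupp.single i 1 ≤ s := by
    rw [Finsupp.single_le_iff]; omega
  have h2 : (s - Finsupp.single i 1).degree + 1 = s.degree := by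
    conv_rhs => rw [← tsub_add_cancel_of_le hle]
    rw [map_add, Finsupp.degree_single]
  show (s - Finsupp.single i 1).degree ≤ n
  omega

/-- The Laplacian as a polynomial. -/
theorem exists_polyLapl_eq {n : ℕ} {q : MvPolynomial (Fin d) ℝ} (hq : q ∈ Poly d (n + 1)) :
    ∃ r ∈ Poly d n, ∀ x, polyLapl q x = polyFun r x := by
  refine ⟨∑ i, MvPolynomial.pderiv i (MvPolynomial.pderiv i q),
    Submodule.sum_mem _ fun i _ => ?_, fun x => by simp [polyLapl]⟩
  -- The bound on the first derivative is relaxed from n back to n + 1 so that the same lemma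
  -- applies again. Degree n suffices, since cell moments are preserved up to that degree.
  exact pderiv_mem_Poly (Poly_mono (Nat.le_succ n) (pderiv_mem_Poly hq i)) i

/-- The derivative in a fixed direction as a polynomial. -/
theorem exists_inner_polyGrad_eq {n : ℕ} {q : MvPolynomial (Fin d) ℝ} (hq : q ∈ Poly d (n + 1))
    (v : E d) : ∃ r ∈ Poly d n, ∀ x, ⟪polyGrad q x, v⟫ = polyFun r x := by
  refine ⟨∑ i, v i • MvPolynomial.pderiv i q,
    Submodule.sum_mem _ fun i _ => Submodule.smul_mem _ _ (pderiv_mem_Poly hq i), fun x => ?_⟩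
  simp [PiLp.inner_apply]

end Polynomials

/-! ### Convergence in `L²` -/

section L2

variable {α : Type*} [MeasurableSpace α] {μ : Measure α} {F : Type*} [NormedAddCommGroup F]
  [InnerProductSpace ℝ F]

/-- Continuity of the L² inner product, phrased for functions so that limits can be taken term by
term in Green's formula. -/
theorem tendsto_integral_inner {f : ℕ → α → F} {g k : α → F} (hf : ∀ n, MemLp (f n) 2 μ)
    (hg : MemLp g 2 μ) (hk : MemLp k 2 μ)
    (h : Tendsto (fun n => eLpNorm (fun x => f n x - g x) 2 μ) atTop (𝓝 0)) :
    Tendsto (fun n => ∫ x, ⟪f n x, k x⟫ ∂μ) atTop (𝓝 (∫ x, ⟪g x, k x⟫ ∂μ)) := by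
  have h1 : Tendsto (fun n => (hf n).toLp (f n)) atTop (𝓝 (hg.toLp g)) :=
    (Lp.tendsto_Lp_iff_tendsto_eLpNorm'' f hf g hg).2 h
  have h2 : Tendsto (fun n => ⟪(hf n).toLp (f n), hk.toLp k⟫) atTop
      (𝓝 ⟪hg.toLp g, hk.toLp k⟫) := h1.inner tendsto_const_nhds
  have h3 : ∀ (u : α → F) (hu : MemLp u 2 μ),
      ⟪hu.toLp u, hk.toLp k⟫ = ∫ x, ⟪u x, k x⟫ ∂μ := by
    intro u hu
    rw [L2.inner_def]
    refine integral_congr_ae ?_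
    filter_upwards [hu.coeFn_toLp, hk.coeFn_toLp] with x h1 h2
    rw [h1, h2]
  simpa only [h3] using h2

theorem eLpNorm_two_eq {F : Type*} [NormedAddCommGroup F] {f : α → F} (hf : MemLp f 2 μ) :
    eLpNorm f 2 μ = ENNReal.ofReal (Real.sqrt (∫ x, ‖f x‖ ^ 2 ∂μ)) := by
  rw [hf.eLpNorm_eq_integral_rpow_norm two_ne_zero ENNReal.ofNat_ne_top, Real.sqrt_eq_rpow]
  simp

theorem tendsto_eLpNorm_two_iff {F : Type*} [NormedAddCommGroup F] {f : ℕ → α → F}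
    (hf : ∀ n, MemLp (f n) 2 μ) :
    Tendsto (fun n => eLpNorm (f n) 2 μ) atTop (𝓝 0) ↔
      Tendsto (fun n => ∫ x, ‖f n x‖ ^ 2 ∂μ) atTop (𝓝 0) := by
  simp_rw [fun n => eLpNorm_two_eq (hf n)]
  have hnn : ∀ n, 0 ≤ ∫ x, ‖f n x‖ ^ 2 ∂μ := fun n => integral_nonneg fun x => by positivity
  constructor
  · intro h
    have h1 := (ENNReal.tendsto_toReal ENNReal.zero_ne_top).comp h
    have h2 := h1.pow 2
    simpa [Function.comp_def, ENNReal.toReal_ofReal, Real.sq_sqrt, hnn] using h2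
  · intro h
    have h1 := ENNReal.tendsto_ofReal ((Real.continuous_sqrt.tendsto 0).comp h)
    simpa [Function.comp_def] using h1

end L2

theorem memLp_of_continuous {d : ℕ} {F : Type*} [NormedAddCommGroup F] {μ : Measure (E d)}
    {A : Set (E d)} (hA : IsCompact A) (hμ : μ A < ⊤) {f : E d → F} (hf : Continuous f)
    (p : ENNReal) : MemLp f p (μ.restrict A) := by
  have : IsFiniteMeasure (μ.restrict A) := ⟨by simpa using hμ⟩
  obtain ⟨C, hC⟩ := hA.exists_bound_of_continuousOn hf.continuousOn
  have : SecondCountableTopologyEither (E d) F := inferInstance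
  refine MemLp.of_bound hf.aestronglyMeasurable C ?_
  filter_upwards [ae_restrict_mem hA.measurableSet] with x hx using hC x hx

/-! ### Green's formula and traces on a simplex -/

namespace IsSimplex

variable {d : ℕ} {K : Finset (E d)}

theorem memLp_hull (K : Finset (E d)) {F : Type*} [NormedAddCommGroup F] {f : E d → F}
    (hf : Continuous f) (p : ENNReal) : MemLp f p (volume.restrict (hull K)) :=
  memLp_of_continuous (isCompact_hull K) (volume_lt_top K) hf p

theorem memLp_facet (hK : IsSimplex K) (hd : 1 ≤ d) {a : E d} (ha : a ∈ K)
    {F : Type*} [NormedAddCommGroup F] {f : E d → F}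
    (hf : Continuous f) (p : ENNReal) : MemLp f p ((surf d).restrict (facet K a)) :=
  memLp_of_continuous (isCompact_facet K a) (hK.surf_facet_lt_top hd ha) hf p

/-- Green's formula. -/
theorem green (hK : IsSimplex K) (hd : 1 ≤ d) {f : E d → ℝ} (hf : ContDiff ℝ 1 f)
    (q : MvPolynomial (Fin d) ℝ) :
    ∫ x in hull K, ⟪gradient f x, polyGrad q x⟫ =
      -(∫ x in hull K, f x * polyLapl q x) +
        ∑ a ∈ K, ∫ x in facet K a, f x * ⟪polyGrad q x, outerNormal K a⟫ ∂(surf d) := by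
  have hf' : Continuous (fderiv ℝ f) := hf.continuous_fderiv one_ne_zero
  have hfc : Continuous f := hf.continuous
  have hint : ∀ g : E d → ℝ, Continuous g → IntegrableOn g (hull K) := fun g hg =>
    hg.continuousOn.integrableOn_compact (isCompact_hull K)
  let e : Fin d → E d := fun i => EuclideanSpace.single i (1 : ℝ)
  let D : Fin d → MvPolynomial (Fin d) ℝ := fun i => MvPolynomial.pderiv i q
  have hfderiv : ∀ i x, fderiv ℝ (fun y => f y * polyFun (D i) y) x (e i) =
      fderiv ℝ f x (e i) * polyFun (D i) x +
        f x * polyFun (MvPolynomial.pderiv i (D i)) x := by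
    intro i x
    have h1 := (hf.differentiable one_ne_zero x).hasFDerivAt.mul
      (hasGradientAt_polyFun (D i) x).hasFDerivAt
    have h2 : fderiv ℝ (fun y => f y * polyFun (D i) y) x = _ := h1.fderiv
    rw [h2]
    simp [e, EuclideanSpace.inner_single_right]
    ring
  -- This is the divergence theorem for the scalar f ∂ᵢq in the direction eᵢ; summation over i gives
  -- Green's formula.
  have hdiv : ∀ i, (∫ x in hull K, fderiv ℝ f x (e i) * polyFun (D i) x) +
      ∫ x in hull K, f x * polyFun (MvPolynomial.pderiv i (D i)) x =
      ∑ a ∈ K, ∫ x in facet K a, f x * polyFun (D i) x * ⟪e i, outerNormal K a⟫ ∂(surf d) := by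
    intro i
    rw [← hK.integral_fderiv hd (hf.mul (contDiff_one_polyFun (D i))) (e i),
      ← integral_add (hint _ (by fun_prop)) (hint _ (by fun_prop))]
    exact integral_congr_ae (Eventually.of_forall fun x => (hfderiv i x).symm)
  have hsum := Finset.sum_congr rfl fun i (_ : i ∈ Finset.univ) => hdiv i
  rw [Finset.sum_add_distrib, Finset.sum_comm,
    ← integral_finsetSum _ (fun i _ => hint _ (by fun_prop)),
    ← integral_finsetSum _ (fun i _ => hint _ (by fun_prop))] at hsum
  have e1 : ∫ x in hull K, ⟪gradient f x, polyGrad q x⟫ =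
      ∫ x in hull K, ∑ i, fderiv ℝ f x (e i) * polyFun (D i) x := by
    refine integral_congr_ae (Eventually.of_forall fun x => ?_)
    simp only
    rw [inner_eq_fderiv (hf.differentiable one_ne_zero x)]
    have : polyGrad q x = ∑ i, polyFun (D i) x • e i := by
      ext j
      simp only [e, D, polyGrad_apply, WithLp.ofLp_sum, WithLp.ofLp_smul, Finset.sum_apply,
        Pi.smul_apply, smul_eq_mul, PiLp.single_apply]
      simp
    rw [this, map_sum]
    simp [mul_comm]
  have e2 : ∫ x in hull K, f x * polyLapl q x =
      ∫ x in hull K, ∑ i, f x * polyFun (MvPolynomial.pderiv i (D i)) x := by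
    refine integral_congr_ae (Eventually.of_forall fun x => ?_)
    simp [polyLapl, D, Finset.mul_sum]
  have e3 : ∀ a ∈ K, ∫ x in facet K a, f x * ⟪polyGrad q x, outerNormal K a⟫ ∂(surf d) =
      ∑ i, ∫ x in facet K a, f x * polyFun (D i) x * ⟪e i, outerNormal K a⟫ ∂(surf d) := by
    intro a ha
    rw [← integral_finsetSum _ fun i _ =>
      memLp_one_iff_integrable.1 (hK.memLp_facet hd ha (by fun_prop) 1)]
    refine integral_congr_ae (Eventually.of_forall fun x => ?_)
    simp [e, D, PiLp.inner_apply, Finset.mul_sum, mul_comm,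
      mul_left_comm]
  rw [e1, e2, Finset.sum_congr rfl e3]
  linarith

/-- If a sequence tends to zero in `H¹` of a simplex, then its traces tend to zero in `L²`. -/
theorem tendsto_trace (hK : IsSimplex K) (hd : 1 ≤ d) {a : E d} (ha : a ∈ K) {f : ℕ → E d → ℝ}
    (hf : ∀ n, ContDiff ℝ 1 (f n))
    (h0 : Tendsto (fun n => eLpNorm (f n) 2 (volume.restrict (hull K))) atTop (𝓝 0))
    (h1 : Tendsto (fun n => eLpNorm (gradient (f n)) 2 (volume.restrict (hull K))) atTop (𝓝 0)) :
    Tendsto (fun n => eLpNorm (f n) 2 ((surf d).restrict (facet K a))) atTop (𝓝 0) := by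
  have hgc : ∀ n, Continuous (gradient (f n)) := fun n => by
    unfold gradient
    exact (LinearIsometryEquiv.continuous _).comp ((hf n).continuous_fderiv one_ne_zero)
  rw [tendsto_eLpNorm_two_iff (fun n => memLp_hull K (hf n).continuous 2)] at h0
  rw [tendsto_eLpNorm_two_iff (fun n => memLp_hull K (hgc n) 2)] at h1
  rw [tendsto_eLpNorm_two_iff (fun n => hK.memLp_facet hd ha (hf n).continuous 2)]
  obtain ⟨h, hh, hF⟩ := hK.exists_height hd ha
  obtain ⟨D, hD⟩ := (isCompact_hull K).exists_bound_of_continuousOn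
    (f := fun x => x - a) (by fun_prop)
  have hint : ∀ g : E d → ℝ, Continuous g → IntegrableOn g (hull K) := fun g hg =>
    hg.continuousOn.integrableOn_compact (isCompact_hull K)
  -- The radial formula for f² expresses h ∫_F f² as the cell integral of d f² + 2 f ∇f·(x - a).
  -- Then |x - a| ≤ D and 2|f||∇f| ≤ f² + |∇f|² give the bound.
  have hbound : ∀ n, ∫ x in facet K a, ‖f n x‖ ^ 2 ∂(surf d) ≤
      h⁻¹ * ((d + D) * (∫ x in hull K, ‖f n x‖ ^ 2) + D * ∫ x in hull K, ‖gradient (f n) x‖ ^ 2) := by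
    intro n
    have hfc := (hf n).continuous
    have hfd : Continuous (fderiv ℝ (f n)) := (hf n).continuous_fderiv one_ne_zero
    have hfg := hgc n
    have hsq : ContDiff ℝ 1 fun x => f n x ^ 2 := (hf n).pow 2
    have hdiv := hK.integral_div_vertex hd ha hh hF hsq
    rw [le_inv_mul_iff₀ hh]
    simp only [Real.norm_eq_abs, sq_abs] at hdiv ⊢
    rw [hdiv, ← integral_const_mul, ← integral_const_mul,
      ← integral_add (hint _ (by fun_prop)) (hint _ (by fun_prop))]
    have hsqd : Continuous (fderiv ℝ fun x => f n x ^ 2) := hsq.continuous_fderiv one_ne_zero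
    refine setIntegral_mono_on (hint _ (by fun_prop)) (hint _ (by fun_prop))
      (isCompact_hull K).measurableSet fun x hx => ?_
    have hxf := ((hf n).differentiable one_ne_zero x)
    have h2 : fderiv ℝ (fun y => f n y ^ 2) x (x - a) = 2 * f n x * ⟪gradient (f n) x, x - a⟫ := by
      rw [inner_eq_fderiv hxf, (hxf.hasFDerivAt.pow 2).fderiv]
      simp
    have hDx : ‖x - a‖ ≤ D := hD x hx
    have h3 : |⟪gradient (f n) x, x - a⟫| ≤ ‖gradient (f n) x‖ * D :=
      (abs_real_inner_le_norm _ _).trans (by gcongr)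
    have h4 : 2 * f n x * ⟪gradient (f n) x, x - a⟫ ≤ D * (2 * |f n x| * ‖gradient (f n) x‖) := by
      refine (le_abs_self _).trans ?_
      rw [abs_mul, abs_mul, abs_two]
      calc 2 * |f n x| * |⟪gradient (f n) x, x - a⟫| ≤ 2 * |f n x| * (‖gradient (f n) x‖ * D) := by
            gcongr
        _ = _ := by ring
    have hD0 : 0 ≤ D := (norm_nonneg _).trans hDx
    have h5 : 2 * |f n x| * ‖gradient (f n) x‖ ≤ f n x ^ 2 + ‖gradient (f n) x‖ ^ 2 := by
      have := two_mul_le_add_sq |f n x| ‖gradient (f n) x‖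
      rwa [sq_abs] at this
    rw [h2]
    nlinarith [mul_le_mul_of_nonneg_left h5 hD0]
  refine squeeze_zero (fun n => integral_nonneg fun x => by positivity) hbound ?_
  have := (((h0.const_mul ((d : ℝ) + D)).add (h1.const_mul D)).const_mul h⁻¹)
  simpa using this

end IsSimplex

/-! ### Functions with vanishing gradient on a convex set -/

section Poincare

variable {d : ℕ}

/-- The Jacobian of the substitution is t^(-d), which is at most 2^d because t ≥ 1/2. -/
theorem lintegral_comp_add_smul (G : E d → ENNReal) (hG : Measurable G) (c : E d) {t : ℝ}
    (ht : 1 / 2 ≤ t) : ∫⁻ x, G (c + t • x) ≤ 2 ^ d * ∫⁻ x, G x := by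
  have ht0 : 0 < t := by linarith
  have h1 : ∫⁻ x, G (c + t • x) = ∫⁻ y, G (c + y) ∂(volume.map (fun x : E d => t • x)) :=
    (lintegral_map (f := fun y => G (c + y)) (g := fun x : E d => t • x) (by fun_prop)
      (by fun_prop)).symm
  rw [h1, Measure.map_addHaar_smul _ ht0.ne', lintegral_smul_measure,
    lintegral_add_left_eq_self G c, finrank_euclideanSpace_fin, smul_eq_mul]
  gcongr
  rw [abs_of_pos (by positivity), ← inv_pow]
  calc ENNReal.ofReal (t⁻¹ ^ d) ≤ ENNReal.ofReal (2 ^ d) := by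
        refine ENNReal.ofReal_le_ofReal (pow_le_pow_left₀ (by positivity) ?_ d)
        rw [inv_le_comm₀ ht0 two_pos]; linarith
    _ = 2 ^ d := by rw [ENNReal.ofReal_pow two_pos.le]; simp

theorem enorm_sub_le_lintegral {ψ : E d → ℝ} (hψ : ContDiff ℝ 1 ψ) (x y : E d) :
    ‖ψ x - ψ y‖ₑ ≤ ‖x - y‖ₑ * ∫⁻ t in Set.Ioc (0 : ℝ) 1, ‖fderiv ℝ ψ (y + t • (x - y))‖ₑ := by
  have hfd : Continuous (fderiv ℝ ψ) := hψ.continuous_fderiv one_ne_zero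
  have hder : ∀ t : ℝ, HasDerivAt (fun t : ℝ => ψ (y + t • (x - y)))
      (fderiv ℝ ψ (y + t • (x - y)) (x - y)) t := by
    intro t
    have h1 : HasDerivAt (fun t : ℝ => y + t • (x - y)) (x - y) t := by
      simpa using ((hasDerivAt_id t).smul_const (x - y)).const_add y
    exact (hψ.differentiable one_ne_zero _).hasFDerivAt.comp_hasDerivAt t h1
  have hFTC := intervalIntegral.integral_eq_sub_of_hasDerivAt (a := 0) (b := 1)
    (fun t _ => hder t) ((by fun_prop : Continuous fun t : ℝ =>
      fderiv ℝ ψ (y + t • (x - y)) (x - y)).intervalIntegrable _ _)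
  rw [intervalIntegral.integral_of_le zero_le_one] at hFTC
  simp only [one_smul, zero_smul, add_zero, add_sub_cancel] at hFTC
  rw [← hFTC]
  refine (enorm_integral_le_lintegral_enorm _).trans ?_
  rw [← lintegral_const_mul _ (by fun_prop)]
  refine lintegral_mono fun t => ?_
  rw [mul_comm]
  exact ContinuousLinearMap.le_opENorm _ _

/-- A Poincaré inequality on a compact convex set. -/
theorem lintegral_enorm_sub_le {A : Set (E d)} (hA : IsCompact A) (hconv : Convex ℝ A)
    {ψ : E d → ℝ} (hψ : ContDiff ℝ 1 ψ) :
    ∫⁻ x in A, ∫⁻ y in A, ‖ψ x - ψ y‖ₑ ≤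
      ENNReal.ofReal (Metric.diam A) * (volume A * (2 ^ d * ∫⁻ x in A, ‖fderiv ℝ ψ x‖ₑ)) := by
  have hfd : Continuous (fderiv ℝ ψ) := hψ.continuous_fderiv one_ne_zero
  -- Extending |∇ψ| by zero permits changes of variables on the whole space. Nothing is lost, since
  -- by convexity the segments stay in A.
  set G : E d → ENNReal := A.indicator fun x => ‖fderiv ℝ ψ x‖ₑ with hG
  have hGm : Measurable G := (by fun_prop : Measurable fun x => ‖fderiv ℝ ψ x‖ₑ).indicator
    hA.measurableSet
  have hGint : ∫⁻ x, G x = ∫⁻ x in A, ‖fderiv ℝ ψ x‖ₑ := lintegral_indicator hA.measurableSet _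
  have hpt : ∀ x ∈ A, ∀ y ∈ A, ‖ψ x - ψ y‖ₑ ≤
      ENNReal.ofReal (Metric.diam A) * ∫⁻ t in Set.Ioc (0 : ℝ) 1, G (y + t • (x - y)) := by
    intro x hx y hy
    refine (enorm_sub_le_lintegral hψ x y).trans (mul_le_mul' ?_ ?_)
    · rw [← ofReal_norm, ← dist_eq_norm]
      exact ENNReal.ofReal_le_ofReal (Metric.dist_le_diam_of_mem hA.isBounded hx hy)
    · refine lintegral_mono_ae ?_
      filter_upwards [ae_restrict_mem measurableSet_Ioc] with t ht
      rw [hG, Set.indicator_of_mem]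
      exact hconv.add_smul_sub_mem hy hx ⟨ht.1.le, ht.2⟩
  have hmeas3 : Measurable fun z : (E d × E d) × ℝ => G (z.1.2 + z.2 • (z.1.1 - z.1.2)) :=
    hGm.comp (by fun_prop)
  have hbound : ∀ t : ℝ, ∫⁻ x in A, ∫⁻ y in A, G (y + t • (x - y)) ≤
      volume A * (2 ^ d * ∫⁻ x, G x) := by
    intro t
    have hm2 : Measurable fun z : E d × E d => G (z.2 + t • (z.1 - z.2)) := hGm.comp (by fun_prop)
    -- In y + t(x - y) = (1 - t)y + tx one of the coefficients is at least 1/2. Integrating first in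
    -- the variable carrying it keeps the Jacobian below 2^d.
    rcases le_total (1 / 2) t with ht | ht
    · rw [lintegral_lintegral_swap hm2.aemeasurable]
      calc ∫⁻ y in A, ∫⁻ x in A, G (y + t • (x - y)) ≤ ∫⁻ _ in A, 2 ^ d * ∫⁻ x, G x := by
            refine lintegral_mono fun y => (setLIntegral_le_lintegral _ _).trans ?_
            have := lintegral_comp_add_smul G hGm (y - t • y) ht
            refine le_of_eq_of_le (lintegral_congr fun x => ?_) this
            congr 1; rw [smul_sub]; abel
        _ = _ := by rw [setLIntegral_const, mul_comm]
    · calc ∫⁻ x in A, ∫⁻ y in A, G (y + t • (x - y)) ≤ ∫⁻ _ in A, 2 ^ d * ∫⁻ x, G x := by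
            refine lintegral_mono fun x => (setLIntegral_le_lintegral _ _).trans ?_
            have := lintegral_comp_add_smul G hGm (t • x) (t := 1 - t) (by linarith)
            refine le_of_eq_of_le (lintegral_congr fun y => ?_) this
            congr 1; rw [smul_sub, sub_smul, one_smul]; abel
        _ = _ := by rw [setLIntegral_const, mul_comm]
  calc ∫⁻ x in A, ∫⁻ y in A, ‖ψ x - ψ y‖ₑ
      ≤ ∫⁻ x in A, ∫⁻ y in A, ENNReal.ofReal (Metric.diam A) *
          ∫⁻ t in Set.Ioc (0 : ℝ) 1, G (y + t • (x - y)) := by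
        refine lintegral_mono_ae ?_
        filter_upwards [ae_restrict_mem hA.measurableSet] with x hx
        refine lintegral_mono_ae ?_
        filter_upwards [ae_restrict_mem hA.measurableSet] with y hy using hpt x hx y hy
    _ = ENNReal.ofReal (Metric.diam A) * ∫⁻ z : E d × E d,
          (∫⁻ t in Set.Ioc (0 : ℝ) 1, G (z.2 + t • (z.1 - z.2)))
            ∂((volume.restrict A).prod (volume.restrict A)) := by
        rw [lintegral_prod _ hmeas3.lintegral_prod_right'.aemeasurable,
          ← lintegral_const_mul' _ _ ENNReal.ofReal_ne_top]
        refine lintegral_congr fun x => ?_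
        rw [lintegral_const_mul' _ _ ENNReal.ofReal_ne_top]
    _ = ENNReal.ofReal (Metric.diam A) * ∫⁻ t in Set.Ioc (0 : ℝ) 1, ∫⁻ z : E d × E d,
          G (z.2 + t • (z.1 - z.2)) ∂((volume.restrict A).prod (volume.restrict A)) := by
        rw [lintegral_lintegral_swap hmeas3.aemeasurable]
    _ ≤ ENNReal.ofReal (Metric.diam A) *
          ∫⁻ _ in Set.Ioc (0 : ℝ) 1, volume A * (2 ^ d * ∫⁻ x, G x) := by
        gcongr with t
        have hm2 : Measurable fun z : E d × E d => G (z.2 + t • (z.1 - z.2)) :=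
          hGm.comp (by fun_prop)
        rw [lintegral_prod _ hm2.aemeasurable]
        exact hbound t
    _ = _ := by rw [setLIntegral_const, hGint]; simp

theorem enorm_gradient (f : E d → ℝ) (x : E d) : ‖gradient f x‖ₑ = ‖fderiv ℝ f x‖ₑ := by
  rw [gradient, LinearIsometryEquiv.enorm_map]

/-- An `L²` limit of functions whose gradients tend to zero is constant on a convex set. -/
theorem exists_ae_eq_const_of_tendsto {A : Set (E d)} (hA : IsCompact A) (hconv : Convex ℝ A)
    {ψ : ℕ → E d → ℝ} (hψ : ∀ n, ContDiff ℝ 1 (ψ n)) {u : E d → ℝ} (hu : Measurable u)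
    (h0 : Tendsto (fun n => eLpNorm (fun x => ψ n x - u x) 2 (volume.restrict A)) atTop (𝓝 0))
    (h1 : Tendsto (fun n => eLpNorm (gradient (ψ n)) 2 (volume.restrict A)) atTop (𝓝 0)) :
    ∃ c, ∀ᵐ x ∂volume.restrict A, u x = c := by
  set μ := volume.restrict A with hμ
  have hAt : volume A < ⊤ := hA.measure_lt_top
  have hfin : IsFiniteMeasure μ := ⟨by simpa [hμ] using hAt⟩
  have hψm : ∀ n, Measurable (ψ n) := fun n => (hψ n).continuous.measurable
  have hcomp : ∀ (F : Type) [NormedAddCommGroup F] (f : ℕ → E d → F),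
      (∀ n, AEStronglyMeasurable (f n) μ) → Tendsto (fun n => eLpNorm (f n) 2 μ) atTop (𝓝 0) →
      Tendsto (fun n => ∫⁻ x, ‖f n x‖ₑ ∂μ) atTop (𝓝 0) := by
    intro F _ f hf h
    have hle : ∀ n, ∫⁻ x, ‖f n x‖ₑ ∂μ ≤ eLpNorm (f n) 2 μ * μ Set.univ ^ (1 / (1 : ENNReal).toReal -
        1 / (2 : ENNReal).toReal) := by
      intro n
      rw [← eLpNorm_one_eq_lintegral_enorm]
      exact eLpNorm_le_eLpNorm_mul_rpow_measure_univ (by norm_num) (hf n)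
    refine tendsto_of_tendsto_of_tendsto_of_le_of_le tendsto_const_nhds ?_ (fun _ => zero_le) hle
    have hne : μ Set.univ ^ (1 / (1 : ENNReal).toReal - 1 / (2 : ENNReal).toReal) ≠ ⊤ :=
      ENNReal.rpow_ne_top_of_nonneg (by norm_num) (measure_ne_top _ _)
    simpa using ENNReal.Tendsto.mul_const h (Or.inr hne)
  have hgc : ∀ n, Continuous (gradient (ψ n)) := fun n => by
    unfold gradient
    exact (LinearIsometryEquiv.continuous _).comp ((hψ n).continuous_fderiv one_ne_zero)
  have h0' := hcomp ℝ _ (fun n => ((hψm n).sub hu).aestronglyMeasurable) h0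
  have h1' := hcomp (E d) _ (fun n => (hgc n).aestronglyMeasurable) h1
  simp_rw [enorm_gradient] at h1'
  -- Passing through ψ n at both points bounds the double oscillation of u by an L¹ error and a
  -- Poincaré term. Both tend to zero, because on a set of finite measure L² convergence implies L¹
  -- convergence.
  have hle : ∀ n, ∫⁻ x, ∫⁻ y, ‖u x - u y‖ₑ ∂μ ∂μ ≤
      (2 * μ Set.univ) * (∫⁻ x, ‖ψ n x - u x‖ₑ ∂μ) +
      (ENNReal.ofReal (Metric.diam A) * (volume A * 2 ^ d)) * ∫⁻ x, ‖fderiv ℝ (ψ n) x‖ₑ ∂μ := by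
    intro n
    have hmn := hψm n
    have hP := lintegral_enorm_sub_le hA hconv (hψ n)
    have hpt : ∀ x y, ‖u x - u y‖ₑ ≤
        ‖ψ n x - u x‖ₑ + (‖ψ n x - ψ n y‖ₑ + ‖ψ n y - u y‖ₑ) := by
      intro x y
      have : u x - u y = -(ψ n x - u x) + ((ψ n x - ψ n y) + (ψ n y - u y)) := by ring
      rw [this]
      refine (enorm_add_le _ _).trans ?_
      rw [enorm_neg]
      gcongr
      exact enorm_add_le _ _
    calc ∫⁻ x, ∫⁻ y, ‖u x - u y‖ₑ ∂μ ∂μ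
        ≤ ∫⁻ x, ∫⁻ y, (‖ψ n x - u x‖ₑ + (‖ψ n x - ψ n y‖ₑ + ‖ψ n y - u y‖ₑ)) ∂μ ∂μ :=
          lintegral_mono fun x => lintegral_mono fun y => hpt x y
      _ = ∫⁻ x, (‖ψ n x - u x‖ₑ * μ Set.univ + ((∫⁻ y, ‖ψ n x - ψ n y‖ₑ ∂μ) +
            ∫⁻ y, ‖ψ n y - u y‖ₑ ∂μ)) ∂μ := by
          refine lintegral_congr fun x => ?_
          rw [lintegral_add_left (by fun_prop), lintegral_const, lintegral_add_left (by fun_prop)]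
      _ = (∫⁻ x, ‖ψ n x - u x‖ₑ ∂μ) * μ Set.univ + ((∫⁻ x, ∫⁻ y, ‖ψ n x - ψ n y‖ₑ ∂μ ∂μ) +
            (∫⁻ y, ‖ψ n y - u y‖ₑ ∂μ) * μ Set.univ) := by
          rw [lintegral_add_left (by fun_prop), lintegral_mul_const _ (by fun_prop),
            lintegral_add_right _ (by fun_prop), lintegral_const]
      _ ≤ (∫⁻ x, ‖ψ n x - u x‖ₑ ∂μ) * μ Set.univ + ((ENNReal.ofReal (Metric.diam A) *
            (volume A * (2 ^ d * ∫⁻ x in A, ‖fderiv ℝ (ψ n) x‖ₑ))) +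
            (∫⁻ y, ‖ψ n y - u y‖ₑ ∂μ) * μ Set.univ) := by gcongr
      _ = _ := by rw [← hμ]; ring
  have hzero : ∫⁻ x, ∫⁻ y, ‖u x - u y‖ₑ ∂μ ∂μ = 0 := by
    refine le_antisymm ?_ zero_le
    refine ge_of_tendsto' (x := atTop) ?_ hle
    have hc1 : 2 * μ Set.univ ≠ ⊤ := ENNReal.mul_ne_top (by simp) (measure_ne_top _ _)
    have hc2 : ENNReal.ofReal (Metric.diam A) * (volume A * 2 ^ d) ≠ ⊤ :=
      ENNReal.mul_ne_top ENNReal.ofReal_ne_top (ENNReal.mul_ne_top hAt.ne (by simp))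
    simpa using (ENNReal.Tendsto.const_mul h0' (Or.inr hc1)).add
      (ENNReal.Tendsto.const_mul h1' (Or.inr hc2))
  have hm : Measurable fun z : E d × E d => ‖u z.1 - u z.2‖ₑ := by fun_prop
  rw [lintegral_eq_zero_iff hm.lintegral_prod_right'] at hzero
  by_cases hμ0 : μ = 0
  · exact ⟨0, by simp [hμ0]⟩
  have : NeBot (ae μ) := ae_neBot.2 hμ0
  have hzero' : ∀ᵐ x ∂μ, ∫⁻ y, ‖u x - u y‖ₑ ∂μ = 0 := hzero
  -- The constant is the value of u at one point x with u x = u y for almost every y.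
  obtain ⟨x, hx⟩ := hzero'.exists
  rw [lintegral_eq_zero_iff (by fun_prop)] at hx
  refine ⟨u x, ?_⟩
  filter_upwards [hx] with y hy
  have : u x - u y = 0 := by simpa using hy
  linarith

end Poincare

/-! ### Geometry of meshes -/

/-- Near each of its points the boundary lies in a Lipschitz graph, and distinct translates of that
graph along its axis e are disjoint. Infinitely many disjoint translates by bounded amounts force
measure zero. -/
theorem Domain.volume_frontier {d : ℕ} (Ω : Domain d) : volume (frontier Ω.carrier) = 0 := by
  refine measure_null_of_locally_null _ fun x hx => ?_
  obtain ⟨e, he, r, hr, L, g, hg, hgr⟩ := Ω.lipschitz x hx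
  set P := (ℝ ∙ e)ᗮ.orthogonalProjectionOnto with hP
  set Γ : Set (E d) := {y | g (P y) = ⟪e, y⟫} with hΓ
  have hgc : Continuous fun y : E d => g (P y) := hg.continuous.comp P.continuous
  refine ⟨Γ, ?_, ?_⟩
  · refine mem_nhdsWithin.2 ⟨Metric.ball x r, Metric.isOpen_ball, Metric.mem_ball_self hr, ?_⟩
    rintro y ⟨hyb, hyf⟩
    by_contra hne
    rcases lt_or_gt_of_ne (show g (P y) ≠ ⟪e, y⟫ from hne) with hlt | hgt
    · have hyΩ : y ∈ Ω.carrier := (hgr y hyb).2 hlt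
      rw [Ω.isOpen.frontier_eq] at hyf
      exact hyf.2 hyΩ
    · have hnhds : Metric.ball x r ∩ {y | ⟪e, y⟫ < g (P y)} ∈ 𝓝 y :=
        (Metric.isOpen_ball.inter (isOpen_lt (by fun_prop) hgc)).mem_nhds ⟨hyb, hgt⟩
      obtain ⟨z, hz, hzΩ⟩ := mem_closure_iff_nhds.1 (frontier_subset_closure hyf) _ hnhds
      have h1 := (hgr z hz.1).1 hzΩ
      have h2 : ⟪e, z⟫ < g (P z) := hz.2
      exact lt_asymm h1 h2
  · have hPe : P e = 0 := by
      rw [hP, Submodule.orthogonalProjectionOnto_eq_zero_iff]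
      exact Submodule.le_orthogonal_orthogonal _ (Submodule.mem_span_singleton_self e)
    -- The translations e/(n + 1) are pairwise distinct and form a bounded sequence.
    have hlim : Tendsto (fun n : ℕ => (1 / ((n : ℝ) + 1)) • e) atTop (𝓝 ((0 : ℝ) • e)) :=
      tendsto_one_div_add_atTop_nhds_zero_nat.smul_const e
    refine Measure.addHaar_eq_zero_of_disjoint_translates volume _
      (Metric.isBounded_range_of_tendsto _ hlim) ?_ (isClosed_eq hgc (by fun_prop)).measurableSet
    intro m n hmn
    refine Set.disjoint_left.2 ?_
    rintro z hz1 hz2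
    beta_reduce at hz1 hz2
    rw [Set.singleton_add] at hz1 hz2
    obtain ⟨y, hy, rfl⟩ := hz1
    obtain ⟨y', hy', hyy⟩ := hz2
    have hee : ⟪e, e⟫ = (1 : ℝ) := by rw [real_inner_self_eq_norm_sq, he]; norm_num
    have h1 : P y' = P y := by simpa [map_add, map_smul, hPe] using congrArg P hyy
    have h2 := congrArg (fun z => ⟪e, z⟫) hyy
    have h3 : g (P y) = ⟪e, y⟫ := hy
    have h4 : g (P y') = ⟪e, y'⟫ := hy'
    simp only [inner_add_right, inner_smul_right, hee, mul_one] at h2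
    rw [← h4, h1, h3] at h2
    have h5 : 1 / ((n : ℝ) + 1) = 1 / ((m : ℝ) + 1) := by linarith
    refine hmn ?_
    have h6 : (n : ℝ) + 1 = (m : ℝ) + 1 := by
      rw [one_div, one_div] at h5
      exact inv_injective h5
    have h7 : (n : ℝ) = m := by linarith
    exact (Nat.cast_injective h7).symm

namespace IsSimplex

variable {d : ℕ} {K K' : Finset (E d)}

theorem sum_coord_mul (hK : IsSimplex K) (f : E d →ᵃ[ℝ] ℝ) (x : E d) :
    f x = ∑ b, hK.bary.coord b x * f b := by
  conv_lhs => rw [← hK.bary.affineCombination_coord_eq_self x]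
  rw [Finset.map_affineCombination _ _ _ (hK.bary.sum_coord_apply_eq_one x),
    Finset.affineCombination_eq_linear_combination _ _ _ (hK.bary.sum_coord_apply_eq_one x)]
  rfl

theorem eq_vertex_of_coord_eq_one (hK : IsSimplex K) {a : K} {x : E d} (hx : x ∈ hull K)
    (h1 : 1 ≤ hK.bary.coord a x) : x = a := by
  classical
  rw [hK.mem_hull_iff] at hx
  have hs := hK.bary.sum_coord_apply_eq_one x
  rw [← Finset.add_sum_erase _ _ (Finset.mem_univ a)] at hs
  have hnn : ∀ b ∈ Finset.univ.erase a, 0 ≤ hK.bary.coord b x := fun b _ => hx b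
  have h0 : ∑ b ∈ Finset.univ.erase a, hK.bary.coord b x = 0 :=
    le_antisymm (by linarith) (Finset.sum_nonneg hnn)
  have hz := (Finset.sum_eq_zero_iff_of_nonneg hnn).1 h0
  have ha1 : hK.bary.coord a x = 1 := by linarith
  rw [← hK.sum_coord_smul x, ← Finset.add_sum_erase _ _ (Finset.mem_univ a), ha1,
    Finset.sum_eq_zero fun b hb => by rw [hz b hb, zero_smul]]
  simp

/-- A vertex is an extreme point: its barycentric coordinate reaches 1 on the simplex only there. If
it were missing from W', that coordinate would stay below 1 on the whole hull of W'. -/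
theorem subset_of_hull_eq (hK : IsSimplex K) {W W' : Finset (E d)} (hW : W ⊆ K)
    (h : hull W = hull W') : W ⊆ W' := by
  classical
  intro a ha
  by_contra hna
  have hsub : hull W' ⊆ (hK.bary.coord ⟨a, hW ha⟩ : E d → ℝ) ⁻¹' Set.Iio 1 := by
    refine convexHull_min (fun w hw => ?_) ((convex_Iio (1 : ℝ)).affine_preimage _)
    by_contra hge
    have hwK : w ∈ hull K := hull_mono hW (h ▸ subset_hull hw)
    have := hK.eq_vertex_of_coord_eq_one hwK (not_lt.1 hge)
    have hwa : w = a := this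
    exact hna (hwa ▸ hw)
  have h1 : a ∈ hull W' := h ▸ subset_hull ha
  have h2 := hsub h1
  have h3 := hK.coord_vertex ⟨a, hW ha⟩ ⟨a, hW ha⟩
  rw [if_pos rfl] at h3
  exact absurd h3 (ne_of_lt h2)

end IsSimplex

namespace Mesh

variable {d : ℕ} {Ω : Domain d} (M : Mesh Ω)

theorem hull_subset_closure {K : Finset (E d)} (hK : K ∈ M.cells) :
    hull K ⊆ closure Ω.carrier := by
  rw [M.cover]
  exact Set.subset_biUnion_of_mem (u := fun K => hull K) hK

/-- Cells are only known to lie in the closure of Ω. Since the frontier is null, almost-everywhere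
statements and integrals on a cell may be taken in Ω or in the whole space. -/
theorem hull_ae_subset {K : Finset (E d)} (hK : K ∈ M.cells) :
    hull K ≤ᵐ[volume] Ω.carrier := by
  have h0 : ∀ᵐ x ∂(volume : Measure (E d)), x ∉ frontier Ω.carrier :=
    measure_eq_zero_iff_ae_notMem.1 Ω.volume_frontier
  filter_upwards [h0] with x hx hxK
  by_contra hxΩ
  exact hx (Ω.isOpen.frontier_eq ▸ ⟨M.hull_subset_closure hK hxK, hxΩ⟩)

theorem restrict_hull_le {K : Finset (E d)} (hK : K ∈ M.cells) :
    volume.restrict (hull K) ≤ Ω.vol := Measure.restrict_mono_ae (M.hull_ae_subset hK)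

theorem ae_hull_iff {K : Finset (E d)} (hK : K ∈ M.cells) {P : E d → Prop} :
    (∀ᵐ x ∂Ω.vol, x ∈ hull K → P x) ↔ ∀ᵐ x ∂volume.restrict (hull K), P x := by
  rw [ae_restrict_iff' (isCompact_hull K).measurableSet, Domain.vol,
    ae_restrict_iff' Ω.isOpen.measurableSet]
  constructor
  · intro h
    filter_upwards [h, M.hull_ae_subset hK] with x hx hsub hxK using hx (hsub hxK) hxK
  · intro h
    filter_upwards [h] with x hx _ hxK using hx hxK

theorem ae_vol_iff {P : E d → Prop} :
    (∀ᵐ x ∂Ω.vol, P x) ↔ ∀ K ∈ M.cells, ∀ᵐ x ∂volume.restrict (hull K), P x := by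
  constructor
  · intro h K hK
    rw [← M.ae_hull_iff hK]
    filter_upwards [h] with x hx _ using hx
  · intro h
    have h1 : ∀ᵐ x ∂Ω.vol, ∀ K ∈ M.cells, x ∈ hull K → P x :=
      (ae_ball_iff M.cells.countable_toSet).2 fun K hK => (M.ae_hull_iff hK).2 (h K hK)
    filter_upwards [h1, ae_restrict_mem Ω.isOpen.measurableSet] with x hx hxΩ
    have hx' : x ∈ ⋃ K ∈ M.cells, hull K := M.cover ▸ subset_closure hxΩ
    obtain ⟨K, hK, hxK⟩ := Set.mem_iUnion₂.1 hx'
    exact hx K hK hxK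

/-- Matching provides a vertex set inside K and, with the roles exchanged, one inside K'. The two
have the same hull, so extremality of vertices places the first inside K' as well. -/
theorem exists_inter_eq_hull {K K' : Finset (E d)} (hK : K ∈ M.cells) (hK' : K' ∈ M.cells) :
    ∃ W, W ⊆ K ∧ W ⊆ K' ∧ hull K ∩ hull K' = hull W := by
  obtain ⟨W, hW, hWe⟩ := M.matching K hK K' hK'
  obtain ⟨W', hW', hWe'⟩ := M.matching K' hK' K hK
  have heq : hull W = hull W' := by rw [← hWe, ← hWe', Set.inter_comm]
  exact ⟨W, hW, ((M.isSimplex hK).subset_of_hull_eq hW heq).trans hW', hWe⟩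

theorem eq_of_subset {K K' : Finset (E d)} (hK : K ∈ M.cells) (hK' : K' ∈ M.cells)
    (h : K ⊆ K') : K = K' :=
  Finset.eq_of_subset_of_card_le h (by rw [M.card_eq K hK, M.card_eq K' hK'])

theorem volume_inter_eq_zero {K K' : Finset (E d)} (hK : K ∈ M.cells) (hK' : K' ∈ M.cells)
    (hne : K ≠ K') : volume (hull K ∩ hull K') = 0 := by
  obtain ⟨W, hW, hW', hWe⟩ := M.exists_inter_eq_hull hK hK'
  obtain ⟨b, hb, hbW⟩ : ∃ b ∈ K, b ∉ W := by
    by_contra! hall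
    exact hne (M.eq_of_subset hK hK' (fun b hb => hW' (hall b hb)))
  refine measure_mono_null ?_ (IsSimplex.volume_frontier K)
  rw [hWe]
  intro x hx
  rw [(M.isSimplex hK).mem_hull_subset_iff hW] at hx
  refine ⟨subset_closure hx.1, fun hint => ?_⟩
  rw [(M.isSimplex hK).mem_interior_hull_iff] at hint
  exact (hint ⟨b, hb⟩).ne' (hx.2 ⟨b, hb⟩ hbW)

/-- The intersection lies in the common face W. If W misses a vertex of either facet, the
intersection lies in a null subface of that facet. Otherwise W contains the vertices of both: for
distinct cells a count of vertices would make the facets equal, and for a single cell two different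
facets meet in a null set. -/
theorem surf_facet_inter_eq_zero (hd : 1 ≤ d) {K K' : Finset (E d)} (hK : K ∈ M.cells)
    (hK' : K' ∈ M.cells) {a a' : E d} (ha : a ∈ K) (ha' : a' ∈ K')
    (hne : facet K a ≠ facet K' a') : surf d (facet K a ∩ facet K' a') = 0 := by
  classical
  obtain ⟨W, hW, hW', hWe⟩ := M.exists_inter_eq_hull hK hK'
  have hs := M.isSimplex hK
  have hs' := M.isSimplex hK'
  have hsub : facet K a ∩ facet K' a' ⊆ hull W := by
    rw [← hWe]
    exact Set.inter_subset_inter (facet_subset_hull K a) (facet_subset_hull K' a')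
  by_cases h1 : ∃ b ∈ K.erase a, b ∉ W
  · obtain ⟨b, hb, hbW⟩ := h1
    rw [Finset.mem_erase] at hb
    refine measure_mono_null (fun x hx => ?_)
      (hs.surf_facet_inter_coord_eq_zero hd ha hb.2 hb.1)
    exact ⟨hx.1, ((hs.mem_hull_subset_iff hW).1 (hsub hx)).2 ⟨b, hb.2⟩ hbW⟩
  by_cases h2 : ∃ b ∈ K'.erase a', b ∉ W
  · obtain ⟨b, hb, hbW⟩ := h2
    rw [Finset.mem_erase] at hb
    refine measure_mono_null (fun x hx => ?_)
      (hs'.surf_facet_inter_coord_eq_zero hd ha' hb.2 hb.1)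
    exact ⟨hx.2, ((hs'.mem_hull_subset_iff hW').1 (hsub hx)).2 ⟨b, hb.2⟩ hbW⟩
  push Not at h1 h2
  by_cases hKK : K = K'
  · subst hKK
    have haa : a' ≠ a := by rintro rfl; exact hne rfl
    refine measure_mono_null (fun x hx => ?_)
      (hs.surf_facet_inter_coord_eq_zero hd ha ha' haa)
    exact ⟨hx.1, ((hs.mem_facet_iff ha').1 hx.2).2⟩
  · exfalso
    have hlt : W.card < d + 1 := by
      by_contra hge
      have : W = K := Finset.eq_of_subset_of_card_le hW (by rw [hs.card_eq]; omega)
      exact hKK (M.eq_of_subset hK hK' (this ▸ hW'))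
    have e1 : K.erase a = W := Finset.eq_of_subset_of_card_le h1 (by
      rw [Finset.card_erase_of_mem ha, hs.card_eq]; omega)
    have e2 : K'.erase a' = W := Finset.eq_of_subset_of_card_le h2 (by
      rw [Finset.card_erase_of_mem ha', hs'.card_eq]; omega)
    exact hne (by rw [facet_eq_hull, facet_eq_hull, e1, e2])

/-! ### Neighbouring cells and propagation of values through the mesh -/

open Classical in
/-- A facet that is not a boundary face belongs to a second cell, on its other side. -/
theorem exists_neighbour {K : Finset (E d)} (hd : 1 ≤ d) (hK : K ∈ M.cells) {a : E d} (ha : a ∈ K)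
    (hF : ¬ facet K a ⊆ frontier Ω.carrier) :
    ∃ K' ∈ M.cells, ∃ a' ∈ K', K'.erase a' = K.erase a ∧
      (M.isSimplex hK).bary.coord ⟨a, ha⟩ a' < 0 := by
  have hs := M.isSimplex hK
  set lam := fun b : K => hs.bary.coord b with hlam
  obtain ⟨z, hzF, hzf⟩ := Set.not_subset.1 hF
  have hzΩ : z ∈ Ω.carrier := by
    by_contra h
    exact hzf (Ω.isOpen.frontier_eq ▸
      ⟨M.hull_subset_closure hK (facet_subset_hull K a hzF), h⟩)
  obtain ⟨hzK, hza⟩ := (hs.mem_facet_iff ha).1 hzF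
  rw [hs.mem_hull_iff] at hzK
  -- a point in the relative interior of the facet
  obtain ⟨m, hma, hmb⟩ : ∃ m : E d, lam ⟨a, ha⟩ m = 0 ∧ ∀ b : K, (b : E d) ≠ a → 0 < lam b m := by
    obtain ⟨c, hc⟩ := hs.interior_nonempty
    rw [hs.mem_interior_hull_iff] at hc
    obtain ⟨b₀, hb₀, hba⟩ : ∃ b ∈ K, b ≠ a := Finset.exists_mem_ne (by rw [hs.card_eq]; omega) a
    -- project the interior point `c` from the vertex `a` onto the facet
    set t := lam ⟨a, ha⟩ c with ht
    have ht1 : t < 1 := by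
      by_contra hge
      have := hs.eq_vertex_of_coord_eq_one (hs.mem_hull_iff.2 fun b => (hc b).le) (not_lt.1 hge)
      have h1 := hs.coord_vertex ⟨b₀, hb₀⟩ ⟨a, ha⟩
      rw [if_neg (by simpa using hba), ← this] at h1
      exact (hc _).ne' h1
    have hline : ∀ b : K, lam b (AffineMap.lineMap a c (1 / (1 - t))) =
        lam b a + (1 / (1 - t)) * (lam b c - lam b a) := by
      intro b
      rw [AffineMap.apply_lineMap, AffineMap.lineMap_apply]
      simp [add_comm]
    refine ⟨AffineMap.lineMap a c (1 / (1 - t)), ?_, fun b hb => ?_⟩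
    · rw [hline, hs.coord_vertex ⟨a, ha⟩ ⟨a, ha⟩, if_pos rfl, ← ht]
      have : 1 - t ≠ 0 := by linarith
      field_simp
      ring
    · rw [hline, hs.coord_vertex b ⟨a, ha⟩, if_neg (fun h => hb (congrArg Subtype.val h))]
      have := hc b
      have : 0 < 1 - t := by linarith
      simp only [zero_add, sub_zero]
      positivity
  -- A small step from z ∈ Ω towards the relatively interior point m stays in Ω by openness and
  -- makes all facet coordinates positive.
  obtain ⟨y, hyΩ, hya, hyb⟩ : ∃ y ∈ Ω.carrier, lam ⟨a, ha⟩ y = 0 ∧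
      ∀ b : K, (b : E d) ≠ a → 0 < lam b y := by
    have hcont : Continuous fun s : ℝ => AffineMap.lineMap z m s := AffineMap.lineMap_continuous
    have h0 : ∀ᶠ s in 𝓝[>] (0 : ℝ), AffineMap.lineMap z m s ∈ Ω.carrier := by
      refine nhdsWithin_le_nhds (hcont.continuousAt.preimage_mem_nhds (Ω.isOpen.mem_nhds ?_))
      simpa using hzΩ
    have h1 : ∀ᶠ s in 𝓝[>] (0 : ℝ), s ∈ Set.Ioo (0 : ℝ) 1 := Ioo_mem_nhdsGT one_pos
    obtain ⟨s, hsΩ, hs0, hs1⟩ := (h0.and h1).exists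
    have hline : ∀ b : K, lam b (AffineMap.lineMap z m s) = (1 - s) * lam b z + s * lam b m := by
      intro b
      rw [AffineMap.apply_lineMap, AffineMap.lineMap_apply_ring]
    refine ⟨_, hsΩ, ?_, fun b hb => ?_⟩
    · rw [hline, hma]
      simp only [hlam, hza]
      ring
    · rw [hline]
      have h2 := mul_pos hs0 (hmb b hb)
      have h3 := mul_nonneg (by linarith : 0 ≤ 1 - s) (hzK b)
      simp only [hlam] at h2 h3 ⊢
      linarith
  -- points on the other side of the facet
  set Y : ℝ → E d := fun ε => AffineMap.lineMap y a (-ε) with hY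
  have hYc : Continuous Y := AffineMap.lineMap_continuous.comp continuous_neg
  have hY0 : Y 0 = y := by simp [hY]
  have hYa : ∀ ε, lam ⟨a, ha⟩ (Y ε) = -ε := by
    intro ε
    simp only [hY]
    rw [AffineMap.apply_lineMap, AffineMap.lineMap_apply_ring, hya,
      hs.coord_vertex ⟨a, ha⟩ ⟨a, ha⟩, if_pos rfl]
    ring
  have hYt : Tendsto Y (𝓝[>] 0) (𝓝 y) := by
    have := hYc.tendsto 0
    rw [hY0] at this
    exact this.mono_left nhdsWithin_le_nhds
  have hev : ∀ᶠ ε in 𝓝[>] (0 : ℝ), Y ε ∈ Ω.carrier := hYt (Ω.isOpen.mem_nhds hyΩ)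
  -- There are finitely many cells, so one of them contains Y ε for arbitrarily small ε > 0; being
  -- closed, it also contains y.
  obtain ⟨K', hK', hfreq⟩ : ∃ K' ∈ M.cells, ∃ᶠ ε in 𝓝[>] (0 : ℝ), Y ε ∈ hull K' := by
    by_contra! hall
    have h1 : ∀ᶠ ε in 𝓝[>] (0 : ℝ), ∀ K' ∈ M.cells, Y ε ∉ hull K' :=
      (eventually_all_finset _).2 fun K' hK' => not_frequently.1 (by simpa using hall K' hK')
    obtain ⟨ε, hε1, hε2⟩ := (h1.and hev).exists
    have hx' : Y ε ∈ ⋃ K ∈ M.cells, hull K := M.cover ▸ subset_closure hε2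
    obtain ⟨K', hK', hxK⟩ := Set.mem_iUnion₂.1 hx'
    exact hε1 K' hK' hxK
  have hs' := M.isSimplex hK'
  have hyK' : y ∈ hull K' :=
    (isCompact_hull K').isClosed.mem_of_frequently_of_tendsto hfreq hYt
  obtain ⟨ε, hεK', hε0⟩ := (hfreq.and_eventually self_mem_nhdsWithin).exists
  have hε0 : 0 < ε := hε0
  have hKK : K ≠ K' := by
    rintro rfl
    have h1 := hs.mem_hull_iff.1 hεK' ⟨a, ha⟩
    have h2 := hYa ε
    simp only [hlam] at h2
    linarith
  obtain ⟨W, hW, hW', hWe⟩ := M.exists_inter_eq_hull hK hK'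
  have hyK : y ∈ hull K := by
    rw [hs.mem_hull_iff]
    intro b
    by_cases hb : (b : E d) = a
    · have : b = ⟨a, ha⟩ := Subtype.ext hb
      rw [this]; exact hya.ge
    · exact (hyb b hb).le
  have hyW : y ∈ hull W := hWe ▸ ⟨hyK, hyK'⟩
  -- The point y is in the relative interior of the facet and belongs to the common face W, so no
  -- vertex of the facet can be missing from W.
  have hsubW : K.erase a ⊆ W := by
    intro b hb
    rw [Finset.mem_erase] at hb
    by_contra hbW
    have h0 := ((hs.mem_hull_subset_iff hW).1 hyW).2 ⟨b, hb.2⟩ hbW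
    exact (hyb ⟨b, hb.2⟩ hb.1).ne' h0
  have hlt : W.card < d + 1 := by
    by_contra hge
    have : W = K := Finset.eq_of_subset_of_card_le hW (by rw [hs.card_eq]; omega)
    exact hKK (M.eq_of_subset hK hK' (this ▸ hW'))
  have e1 : K.erase a = W := Finset.eq_of_subset_of_card_le hsubW (by
    rw [Finset.card_erase_of_mem ha, hs.card_eq]; omega)
  obtain ⟨a', ha', haW⟩ : ∃ a' ∈ K', a' ∉ W := by
    by_contra! hall
    have := Finset.card_le_card (show K' ⊆ W from hall)
    rw [hs'.card_eq] at this
    omega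
  have e2 : W = K'.erase a' := by
    refine Finset.eq_of_subset_of_card_le (fun b hb => Finset.mem_erase.2 ⟨?_, hW' hb⟩) ?_
    · rintro rfl; exact haW hb
    · rw [Finset.card_erase_of_mem ha', hs'.card_eq, ← e1, Finset.card_erase_of_mem ha, hs.card_eq]
  refine ⟨K', hK', a', ha', by rw [← e2, e1], ?_⟩
  -- If a' were not strictly on the far side, the coordinate of a would be nonnegative on all of K',
  -- whereas at Y ε it equals -ε.
  by_contra hge
  have hsub : hull K' ⊆ (lam ⟨a, ha⟩ : E d → ℝ) ⁻¹' Set.Ici 0 := by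
    refine convexHull_min (fun b hb => ?_) ((convex_Ici (0 : ℝ)).affine_preimage _)
    by_cases hb' : b = a'
    · subst hb'; exact not_lt.1 hge
    · have hbe : b ∈ K.erase a := by
        rw [e1, e2]; exact Finset.mem_erase.2 ⟨hb', hb⟩
      rw [Finset.mem_erase] at hbe
      have := hs.coord_vertex ⟨a, ha⟩ ⟨b, hbe.2⟩
      rw [if_neg (fun h => hbe.1 (congrArg Subtype.val h).symm)] at this
      exact this.ge
  have h1 : 0 ≤ lam ⟨a, ha⟩ (Y ε) := hsub hεK'
  rw [hYa] at h1
  linarith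

open Classical in
/-- Two cells on the two sides of a common facet cover a neighbourhood of each of its relative
interior points. -/
theorem union_mem_nhds {K K' : Finset (E d)} (hK : K ∈ M.cells) (hK' : K' ∈ M.cells) {a a' : E d}
    (ha : a ∈ K) (ha' : a' ∈ K') (he : K'.erase a' = K.erase a)
    (hneg : (M.isSimplex hK).bary.coord ⟨a, ha⟩ a' < 0) {x : E d} (hx : x ∈ facet K a)
    (hpos : ∀ b : K, (b : E d) ≠ a → 0 < (M.isSimplex hK).bary.coord b x) :
    hull K ∪ hull K' ∈ 𝓝 x := by
  have hs := M.isSimplex hK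
  have hs' := M.isSimplex hK'
  have hmem : ∀ b ∈ K', b ≠ a' → b ∈ K ∧ b ≠ a := by
    intro b hb hne
    have : b ∈ K.erase a := he ▸ Finset.mem_erase.2 ⟨hne, hb⟩
    rw [Finset.mem_erase] at this
    exact ⟨this.2, this.1⟩
  have hx' : x ∈ facet K' a' := by rw [facet_eq_hull, he, ← facet_eq_hull]; exact hx
  -- The point is also relatively interior for K': a vanishing coordinate would put it in a subface
  -- of the common facet, and then a coordinate with respect to K would vanish too.
  have hpos' : ∀ b : K', (b : E d) ≠ a' → 0 < hs'.bary.coord b x := by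
    intro b hb
    have hxK' := (hs'.mem_facet_iff ha').1 hx'
    refine lt_of_le_of_ne (hs'.mem_hull_iff.1 hxK'.1 b) fun h0 => ?_
    obtain ⟨hbK, hba⟩ := hmem b b.2 hb
    have h1 : x ∈ hull ((K'.erase a').erase b) := by
      rw [hs'.mem_hull_subset_iff ((Finset.erase_subset _ _).trans (Finset.erase_subset _ _))]
      refine ⟨hxK'.1, fun c hc => ?_⟩
      by_cases hcb : (c : E d) = b
      · rw [Subtype.ext hcb, ← h0]
      · have hca : (c : E d) = a' := by
          by_contra hne
          exact hc (Finset.mem_erase.2 ⟨hcb, Finset.mem_erase.2 ⟨hne, c.2⟩⟩)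
        have : c = ⟨a', ha'⟩ := Subtype.ext hca
        rw [this]; exact hxK'.2
    rw [he, hs.mem_hull_subset_iff ((Finset.erase_subset _ _).trans (Finset.erase_subset _ _))]
      at h1
    have h2 := h1.2 ⟨b, hbK⟩ (by simp)
    exact (hpos ⟨b, hbK⟩ hba).ne' h2
  have hev1 : ∀ᶠ y in 𝓝 x, ∀ b : K, (b : E d) ≠ a → 0 < hs.bary.coord b y := by
    rw [eventually_all]
    intro b
    by_cases hb : (b : E d) = a
    · exact Eventually.of_forall fun _ h => absurd hb h
    · filter_upwards [(isOpen_lt continuous_const (hs.continuous_coord b)).mem_nhds (hpos b hb)]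
        with y hy _ using hy
  have hev2 : ∀ᶠ y in 𝓝 x, ∀ b : K', (b : E d) ≠ a' → 0 < hs'.bary.coord b y := by
    rw [eventually_all]
    intro b
    by_cases hb : (b : E d) = a'
    · exact Eventually.of_forall fun _ h => absurd hb h
    · filter_upwards [(isOpen_lt continuous_const (hs'.continuous_coord b)).mem_nhds (hpos' b hb)]
        with y hy _ using hy
  filter_upwards [hev1, hev2] with y hy1 hy2
  rcases le_or_gt 0 (hs.bary.coord ⟨a, ha⟩ y) with h | h
  · left
    rw [hs.mem_hull_iff]
    intro b
    by_cases hb : (b : E d) = a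
    · have : b = ⟨a, ha⟩ := Subtype.ext hb
      rw [this]; exact h
    · exact (hy1 b hb).le
  · right
    rw [hs'.mem_hull_iff]
    intro b
    by_cases hb : (b : E d) = a'
    · have hba : b = ⟨a', ha'⟩ := Subtype.ext hb
      -- On K' the coordinate of a is affine and vanishes at every vertex except a'. It is thus the
      -- coordinate of a' times a negative number, so negativity at y makes the coordinate of a'
      -- positive.
      have hsum := hs'.sum_coord_mul (hs.bary.coord ⟨a, ha⟩) y
      rw [Finset.sum_eq_single (⟨a', ha'⟩ : K') (fun c _ hc => by
        have hc' : (c : E d) ≠ a' := fun h => hc (Subtype.ext h)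
        obtain ⟨hcK, hca⟩ := hmem c c.2 hc'
        have := hs.coord_vertex ⟨a, ha⟩ ⟨c, hcK⟩
        rw [if_neg (fun h => hca (congrArg Subtype.val h).symm)] at this
        rw [show hs.bary.coord ⟨a, ha⟩ (c : E d) = 0 from this, mul_zero]) (by simp)] at hsum
      rw [hba]
      by_contra hlt
      have := mul_pos_of_neg_of_neg (not_le.1 hlt) hneg
      rw [← hsum] at this
      exact lt_asymm this h
    · exact (hy2 b hb).le

open Classical in
/-- A function on the cells that takes the same value on cells sharing a facet and vanishes on the
cells with a boundary face is zero. -/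
theorem eq_zero_of_forall_facet (hd : 1 ≤ d) (c : Finset (E d) → ℝ)
    (hint : ∀ K ∈ M.cells, ∀ K' ∈ M.cells, ∀ a ∈ K, ∀ a' ∈ K', facet K a = facet K' a' → c K = c K')
    (hbd : ∀ K ∈ M.cells, ∀ a ∈ K, facet K a ⊆ frontier Ω.carrier → c K = 0) :
    ∀ K ∈ M.cells, c K = 0 := by
  by_contra! hex
  obtain ⟨K₀, hK₀, hc₀⟩ := hex
  have hs₀ := M.isSimplex hK₀
  obtain ⟨x₀, hx₀⟩ := hs₀.interior_nonempty
  -- U is the union of the cells with nonzero value. A segment from inside U to a point outside the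
  -- closure of Ω must leave U, and the place where it does so gives the contradiction.
  set U : Set (E d) := ⋃ K ∈ M.cells.filter (fun K => c K ≠ 0), hull K with hU
  have hUc : IsCompact U := Finset.isCompact_biUnion _ fun K _ => isCompact_hull K
  have hUmem : ∀ K ∈ M.cells, c K ≠ 0 → hull K ⊆ U := fun K hK hc =>
    Set.subset_biUnion_of_mem (u := fun K => hull K) (Finset.mem_filter.2 ⟨hK, hc⟩)
  have hUΩ : U ⊆ closure Ω.carrier := Set.iUnion₂_subset fun K hK =>
    M.hull_subset_closure (Finset.mem_filter.1 hK).1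
  -- the end point of a generic segment
  obtain ⟨y, hyΩ, hygen⟩ : ∃ y ∉ closure Ω.carrier, ∀ K ∈ M.cells, ∀ a ∈ K, ∀ b ∈ K, b ≠ a →
      y ∉ affineSpan ℝ (insert x₀ (((K.erase a).erase b : Finset (E d)) : Set (E d))) := by
    -- Removing two vertices leaves d - 1 points; together with x₀ they span at most a hyperplane.
    -- Almost every end point y avoids all these finitely many spans.
    have hnull : ∀ K ∈ M.cells, ∀ a ∈ K, ∀ b ∈ K, b ≠ a → volume
        (affineSpan ℝ (insert x₀ (((K.erase a).erase b : Finset (E d)) : Set (E d))) : Set (E d))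
          = 0 := by
      intro K hK a ha b hb hba
      refine Measure.addHaar_affineSubspace _ _ fun htop => ?_
      have hcard : ((K.erase a).erase b).card = d - 1 := by
        rw [Finset.card_erase_of_mem (Finset.mem_erase.2 ⟨hba, hb⟩), Finset.card_erase_of_mem ha,
          M.card_eq K hK]
        omega
      have h1 := finrank_vectorSpan_insert_le_set ℝ
        (((K.erase a).erase b : Finset (E d)) : Set (E d)) x₀
      have h2 : Module.finrank ℝ (vectorSpan ℝ
          (insert x₀ (((K.erase a).erase b : Finset (E d)) : Set (E d)))) = d := by
        rw [← direction_affineSpan, htop, AffineSubspace.direction_top, finrank_top,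
          finrank_euclideanSpace_fin]
      rcases Nat.eq_or_lt_of_le hd with hd1 | hd1
      · have hemp : (K.erase a).erase b = ∅ := Finset.card_eq_zero.1 (by omega)
        have hset : insert x₀ (((K.erase a).erase b : Finset (E d)) : Set (E d)) = {x₀} := by
          rw [hemp, Finset.coe_empty, Set.insert_eq, Set.union_empty]
        rw [hset, vectorSpan_singleton, finrank_bot] at h2
        omega
      · have h3 := finrank_vectorSpan_image_finset_le ℝ (fun x : E d => x) ((K.erase a).erase b)
          (n := d - 2) (by omega)
        rw [Finset.image_id'] at h3
        omega
    have hev : ∀ᵐ y ∂(volume : Measure (E d)), ∀ K ∈ M.cells, ∀ a ∈ K, ∀ b ∈ K, b ≠ a →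
        y ∉ affineSpan ℝ (insert x₀ (((K.erase a).erase b : Finset (E d)) : Set (E d))) := by
      refine (ae_ball_iff M.cells.countable_toSet).2 fun K hK => ?_
      refine (ae_ball_iff K.countable_toSet).2 fun a ha => ?_
      refine (ae_ball_iff K.countable_toSet).2 fun b hb => ?_
      by_cases hba : b = a
      · exact Eventually.of_forall fun _ h => absurd hba h
      · filter_upwards [measure_eq_zero_iff_ae_notMem.1 (hnull K hK a ha b hb hba)] with y hy _
          using hy
    have hne : volume ((closure Ω.carrier)ᶜ) ≠ 0 := by
      have hopen : IsOpen (closure Ω.carrier)ᶜ := isClosed_closure.isOpen_compl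
      refine (hopen.measure_pos volume ?_).ne'
      have : Nontrivial (E d) := by
        refine Module.nontrivial_of_finrank_pos (R := ℝ) ?_
        rw [finrank_euclideanSpace_fin]; omega
      by_contra hemp
      rw [Set.not_nonempty_iff_eq_empty, Set.compl_empty_iff] at hemp
      exact NormedSpace.unbounded_univ ℝ (E d) (hemp ▸ Ω.isBounded.closure)
    obtain ⟨y, hy⟩ := (Filter.Frequently.and_eventually
      (show ∃ᵐ y ∂volume, y ∈ (closure Ω.carrier)ᶜ from frequently_ae_mem_iff.2 hne) hev).exists
    exact ⟨y, hy.1, hy.2⟩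
  -- the last time the segment is in `U`
  set X : ℝ → E d := fun t => AffineMap.lineMap x₀ y t with hX
  have hXc : Continuous X := AffineMap.lineMap_continuous
  set T : Set ℝ := Set.Icc 0 1 ∩ X ⁻¹' U with hT
  have hTc : IsCompact T := isCompact_Icc.inter_right (hUc.isClosed.preimage hXc)
  have hK₀U : hull K₀ ⊆ U := hUmem K₀ hK₀ hc₀
  have hX0 : X 0 = x₀ := by simp [hX]
  have hX1 : X 1 = y := by simp [hX]
  have hT0 : (0 : ℝ) ∈ T := ⟨by simp, by
    show X 0 ∈ U
    rw [hX0]; exact hK₀U (interior_subset hx₀)⟩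
  obtain ⟨t, htT, htmax⟩ := hTc.exists_isGreatest ⟨0, hT0⟩
  have ht1 : t < 1 := by
    refine lt_of_le_of_ne htT.1.2 fun h => hyΩ (hUΩ ?_)
    rw [← hX1, ← h]; exact htT.2
  -- After the last time t the segment is outside U, so U cannot be a neighbourhood of X t.
  have hnot : U ∉ 𝓝 (X t) := by
    intro hmem
    have h1 : ∀ᶠ s in 𝓝[>] t, X s ∈ U := nhdsWithin_le_nhds (hXc.continuousAt hmem)
    have h2 : ∀ᶠ s in 𝓝[>] t, s ∈ Set.Ioo t 1 := Ioo_mem_nhdsGT ht1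
    obtain ⟨s, hsU, hst, hs1⟩ := (h1.and h2).exists
    exact absurd (htmax ⟨⟨htT.1.1.trans hst.le, hs1.le⟩, hsU⟩) (not_le.2 hst)
  have ht0 : 0 < t := by
    refine lt_of_le_of_ne htT.1.1 fun h => hnot ?_
    rw [← h, hX0]
    exact Filter.mem_of_superset (mem_interior_iff_mem_nhds.1 hx₀) hK₀U
  obtain ⟨K, hK, hxK⟩ := Set.mem_iUnion₂.1 htT.2
  obtain ⟨hK, hcK⟩ := Finset.mem_filter.1 hK
  have hs := M.isSimplex hK
  obtain ⟨a, ha0⟩ : ∃ a : K, hs.bary.coord a (X t) = 0 := by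
    by_contra! hall
    refine hnot (Filter.mem_of_superset (mem_interior_iff_mem_nhds.1 ?_) (hUmem K hK hcK))
    rw [hs.mem_interior_hull_iff]
    exact fun b => lt_of_le_of_ne (hs.mem_hull_iff.1 hxK b) (hall b).symm
  have hxF : X t ∈ facet K a := (hs.mem_facet_iff a.2).2 ⟨hxK, ha0⟩
  -- If a second coordinate vanished, X t would lie on a face with d - 1 vertices. As t > 0, the
  -- line through x₀ and X t would then carry y into one of the excluded spans.
  have hpos : ∀ b : K, (b : E d) ≠ a → 0 < hs.bary.coord b (X t) := by
    intro b hba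
    refine lt_of_le_of_ne (hs.mem_hull_iff.1 hxK b) fun h0 => ?_
    refine hygen K hK a a.2 b b.2 hba ?_
    have h1 : X t ∈ hull ((K.erase a).erase b) := by
      rw [hs.mem_hull_subset_iff ((Finset.erase_subset _ _).trans (Finset.erase_subset _ _))]
      refine ⟨hxK, fun e he => ?_⟩
      by_cases heb : e = b
      · rw [heb, ← h0]
      · by_cases hea : e = a
        · rw [hea, ha0]
        · exact absurd (Finset.mem_erase.2 ⟨fun h => heb (Subtype.ext h),
            Finset.mem_erase.2 ⟨fun h => hea (Subtype.ext h), e.2⟩⟩) he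
    have h2 : X t ∈ affineSpan ℝ (insert x₀ (((K.erase a).erase b : Finset (E d)) : Set (E d))) :=
      affineSpan_mono ℝ (Set.subset_insert _ _) (convexHull_subset_affineSpan _ h1)
    have h3 : x₀ ∈ affineSpan ℝ (insert x₀ (((K.erase a).erase b : Finset (E d)) : Set (E d))) :=
      mem_affineSpan ℝ (Set.mem_insert _ _)
    have h4 := AffineMap.lineMap_mem (t⁻¹) h3 h2
    have h5 : AffineMap.lineMap x₀ (X t) t⁻¹ = y := by
      have h6 : X t = t • (y - x₀) + x₀ := AffineMap.lineMap_apply _ _ _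
      rw [AffineMap.lineMap_apply, h6, vsub_eq_sub, vadd_eq_add, add_sub_cancel_right, smul_smul,
        inv_mul_cancel₀ ht0.ne', one_smul, sub_add_cancel]
    rwa [h5] at h4
  have hFb : ¬ facet K a ⊆ frontier Ω.carrier := fun h => hcK (hbd K hK a a.2 h)
  -- The exit facet is not a boundary facet, and the neighbour across it has the same nonzero value.
  -- Hence U contains both cells, whose union is a neighbourhood of X t.
  obtain ⟨K', hK', a', ha', he, hneg⟩ := M.exists_neighbour hd hK a.2 hFb
  have hcK' : c K' ≠ 0 := by
    rw [← hint K hK K' hK' a a.2 a' ha' (by rw [facet_eq_hull, facet_eq_hull, he])]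
    exact hcK
  exact hnot (Filter.mem_of_superset (M.union_mem_nhds hK hK' a.2 ha' he hneg hxF hpos)
    (Set.union_subset (hUmem K hK hcK) (hUmem K' hK' hcK')))

end Mesh

/-! ### Restrictions to cells and facets -/

namespace Mesh

variable {d : ℕ} {Ω : Domain d} (M : Mesh Ω)

theorem facet_mem_faces {K : Finset (E d)} (hK : K ∈ M.cells) {a : E d} (ha : a ∈ K) :
    facet K a ∈ M.faces := ⟨K, hK, a, ha, rfl⟩

theorem subset_skeleton {F : Set (E d)} (hF : F ∈ M.faces) : F ⊆ M.skeleton :=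
  Set.subset_biUnion_of_mem (u := fun F => F) hF

theorem measurableSet_face {F : Set (E d)} (hF : F ∈ M.faces) : MeasurableSet F := by
  obtain ⟨K, _, a, _, rfl⟩ := hF
  exact (isCompact_facet K a).measurableSet

theorem restrict_face_le {F : Set (E d)} (hF : F ∈ M.faces) : (surf d).restrict F ≤ M.skel :=
  Measure.restrict_mono (M.subset_skeleton hF) le_rfl

theorem skel_restrict {F : Set (E d)} (hF : F ∈ M.faces) :
    M.skel.restrict F = (surf d).restrict F := by
  rw [skel, Measure.restrict_restrict (M.measurableSet_face hF),
    Set.inter_eq_left.2 (M.subset_skeleton hF)]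

theorem vol_restrict {K : Finset (E d)} (hK : K ∈ M.cells) :
    Ω.vol.restrict (hull K) = volume.restrict (hull K) := by
  rw [Domain.vol, Measure.restrict_restrict (isCompact_hull K).measurableSet]
  refine Measure.restrict_congr_set ?_
  filter_upwards [M.hull_ae_subset hK] with x hx
  exact propext ⟨fun h => h.1, fun h => ⟨h, hx h⟩⟩

theorem ae_face_iff {F : Set (E d)} (hF : F ∈ M.faces) {P : E d → Prop} :
    (∀ᵐ x ∂M.skel, x ∈ F → P x) ↔ ∀ᵐ x ∂(surf d).restrict F, P x := by
  rw [← M.skel_restrict hF, ae_restrict_iff' (M.measurableSet_face hF)]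

theorem ae_skel_iff {P : E d → Prop} :
    (∀ᵐ x ∂M.skel, P x) ↔ ∀ F ∈ M.faces, ∀ᵐ x ∂(surf d).restrict F, P x := by
  constructor
  · intro h F hF
    rw [← M.ae_face_iff hF]
    filter_upwards [h] with x hx _ using hx
  · intro h
    have h1 : ∀ᵐ x ∂M.skel, ∀ F ∈ M.faces, x ∈ F → P x :=
      (ae_ball_iff M.finite_faces.countable).2 fun F hF => (M.ae_face_iff hF).2 (h F hF)
    filter_upwards [h1, ae_restrict_mem M.measurableSet_skeleton] with x hx hxs
    obtain ⟨F, hF, hxF⟩ := Set.mem_iUnion₂.1 hxs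
    exact hx F hF hxF

theorem memLp_hull {K : Finset (E d)} (hK : K ∈ M.cells) {V : Type*} [NormedAddCommGroup V]
    (s : Lp V 2 Ω.vol) : MemLp s 2 (volume.restrict (hull K)) :=
  (Lp.memLp s).mono_measure (M.restrict_hull_le hK)

theorem memLp_face {F : Set (E d)} (hF : F ∈ M.faces) (g : L2 M.skel) :
    MemLp g 2 ((surf d).restrict F) :=
  (Lp.memLp g).mono_measure (M.restrict_face_le hF)

theorem ae_hull_of_ae {K : Finset (E d)} (hK : K ∈ M.cells) {P : E d → Prop}
    (h : ∀ᵐ x ∂Ω.vol, P x) : ∀ᵐ x ∂volume.restrict (hull K), P x :=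
  M.ae_vol_iff.1 h K hK

theorem memLp_face_of_continuous (hd : 1 ≤ d) {F : Set (E d)} (hF : F ∈ M.faces) {V : Type*}
    [NormedAddCommGroup V] {f : E d → V} (hf : Continuous f) (p : ENNReal) :
    MemLp f p ((surf d).restrict F) := by
  obtain ⟨K, hK, a, ha, rfl⟩ := hF
  exact (M.isSimplex hK).memLp_facet hd ha hf p

/-! ### Broken polynomials -/

theorem mem_brokenPoly_iff {n : ℕ} {s : L2 Ω.vol} : s ∈ M.brokenPoly n ↔
    ∀ K ∈ M.cells, ∃ q ∈ Poly d n, ∀ᵐ x ∂volume.restrict (hull K), s x = polyFun q x := by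
  constructor
  · intro h K hK
    obtain ⟨q, hq, hs⟩ := h (hull K) ⟨K, hK, rfl⟩
    exact ⟨q, hq, (M.ae_hull_iff hK).1 hs⟩
  · rintro h _ ⟨K, hK, rfl⟩
    obtain ⟨q, hq, hs⟩ := h K hK
    exact ⟨q, hq, (M.ae_hull_iff hK).2 hs⟩

/-- The choice inside `cellPoly` is harmless: polynomials that agree almost everywhere on a
nondegenerate simplex are equal. -/
theorem cellPoly_eq {K : Finset (E d)} (hK : K ∈ M.cells) {s : L2 Ω.vol}
    {q : MvPolynomial (Fin d) ℝ} (h : ∀ᵐ x ∂volume.restrict (hull K), s x = polyFun q x) :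
    cellPoly s K = q := by
  have hex : ∃ q : MvPolynomial (Fin d) ℝ, ∀ᵐ x ∂Ω.vol, x ∈ hull K → s x = polyFun q x :=
    ⟨q, (M.ae_hull_iff hK).2 h⟩
  have hspec := (M.ae_hull_iff hK).1 hex.choose_spec
  rw [cellPoly, dif_pos hex]
  refine eq_of_ae_eq_on (M.isSimplex hK).interior_nonempty ?_
  rw [← ae_restrict_iff' (isCompact_hull K).measurableSet]
  filter_upwards [h, hspec] with x h1 h2
  rw [← h1, h2]

theorem cellPoly_spec {n : ℕ} {s : L2 Ω.vol} (hs : s ∈ M.brokenPoly n) {K : Finset (E d)}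
    (hK : K ∈ M.cells) : cellPoly s K ∈ Poly d n ∧
      ∀ᵐ x ∂volume.restrict (hull K), s x = polyFun (cellPoly s K) x := by
  obtain ⟨q, hq, h⟩ := M.mem_brokenPoly_iff.1 hs K hK
  rw [M.cellPoly_eq hK h]
  exact ⟨hq, h⟩

theorem brokenPoly_mono {m n : ℕ} (h : m ≤ n) : M.brokenPoly m ≤ M.brokenPoly n := by
  intro s hs
  rw [mem_brokenPoly_iff] at *
  intro K hK
  obtain ⟨q, hq, hsq⟩ := hs K hK
  exact ⟨q, Poly_mono h hq, hsq⟩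

theorem cellPoly_add {n : ℕ} {s t : L2 Ω.vol} (hs : s ∈ M.brokenPoly n) (ht : t ∈ M.brokenPoly n)
    {K : Finset (E d)} (hK : K ∈ M.cells) : cellPoly (s + t) K = cellPoly s K + cellPoly t K := by
  refine M.cellPoly_eq hK ?_
  filter_upwards [(M.cellPoly_spec hs hK).2, (M.cellPoly_spec ht hK).2,
    M.ae_hull_of_ae hK (Lp.coeFn_add s t)] with x h1 h2 h3
  rw [h3, Pi.add_apply, h1, h2, polyFun_add]

theorem cellPoly_sub {n : ℕ} {s t : L2 Ω.vol} (hs : s ∈ M.brokenPoly n) (ht : t ∈ M.brokenPoly n)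
    {K : Finset (E d)} (hK : K ∈ M.cells) : cellPoly (s - t) K = cellPoly s K - cellPoly t K := by
  refine M.cellPoly_eq hK ?_
  filter_upwards [(M.cellPoly_spec hs hK).2, (M.cellPoly_spec ht hK).2,
    M.ae_hull_of_ae hK (Lp.coeFn_sub s t)] with x h1 h2 h3
  rw [h3, Pi.sub_apply, h1, h2, polyFun_sub]

theorem ext_of_cellPoly {n : ℕ} {s t : L2 Ω.vol} (hs : s ∈ M.brokenPoly n)
    (ht : t ∈ M.brokenPoly n) (h : ∀ K ∈ M.cells, cellPoly s K = cellPoly t K) : s = t := by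
  refine Lp.ext ((M.ae_vol_iff).2 fun K hK => ?_)
  filter_upwards [(M.cellPoly_spec hs hK).2, (M.cellPoly_spec ht hK).2] with x h1 h2
  rw [h1, h2, h K hK]

/-- Polynomials on the cells can be glued. -/
theorem exists_cellPoly_eq {n : ℕ} (Q : Finset (E d) → MvPolynomial (Fin d) ℝ)
    (hQ : ∀ K ∈ M.cells, Q K ∈ Poly d n) :
    ∃ s ∈ M.brokenPoly n, ∀ K ∈ M.cells, cellPoly s K = Q K := by
  set f : E d → ℝ := fun x => ∑ K ∈ M.cells, (hull K).indicator (polyFun (Q K)) x with hf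
  have hmem : MemLp f 2 Ω.vol := by
    refine memLp_finsetSum _ fun K hK => ?_
    rw [memLp_indicator_iff_restrict (isCompact_hull K).measurableSet, M.vol_restrict hK]
    exact IsSimplex.memLp_hull K (continuous_polyFun _) 2
  have hval : ∀ K ∈ M.cells, ∀ᵐ x ∂volume.restrict (hull K), hmem.toLp f x = polyFun (Q K) x := by
    intro K hK
    -- Distinct cells meet in null sets, so at almost every point of K only the summand of K
    -- survives.
    have hoff : ∀ᵐ x ∂volume.restrict (hull K), ∀ K' ∈ M.cells, K' ≠ K → x ∉ hull K' := by
      refine (ae_ball_iff M.cells.countable_toSet).2 fun K' hK' => ?_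
      by_cases hne : K' = K
      · exact Eventually.of_forall fun _ h => absurd hne h
      have h0 := M.volume_inter_eq_zero hK hK' (Ne.symm hne)
      rw [ae_restrict_iff' (isCompact_hull K).measurableSet]
      filter_upwards [measure_eq_zero_iff_ae_notMem.1 h0] with x hx hxK _ hxK'
      exact hx ⟨hxK, hxK'⟩
    filter_upwards [M.ae_hull_of_ae hK hmem.coeFn_toLp, hoff,
      ae_restrict_mem (isCompact_hull K).measurableSet] with x h1 h2 h3
    rw [h1, hf]
    simp only
    rw [Finset.sum_eq_single_of_mem K hK fun K' hK' hne =>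
      Set.indicator_of_notMem (h2 K' hK' hne) _, Set.indicator_of_mem h3]
  exact ⟨hmem.toLp f, M.mem_brokenPoly_iff.2 fun K hK => ⟨Q K, hQ K hK, hval K hK⟩,
    fun K hK => M.cellPoly_eq hK (hval K hK)⟩

/-! ### The reconstruction -/

/-- The right-hand side of the reconstruction on the cell `K`. -/
def reconFunctional (K : Finset (E d)) (s : M.Pairs) (q : MvPolynomial (Fin d) ℝ) : ℝ :=
  -(∫ x in hull K, s.1 x * polyLapl q x) +
    ∑ a ∈ K, ∫ x in facet K a, s.2 x * ⟪polyGrad q x, outerNormal K a⟫ ∂(surf d)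

theorem integrable_mul_hull {K : Finset (E d)} (hK : K ∈ M.cells) (s : L2 Ω.vol) {g : E d → ℝ}
    (hg : Continuous g) : Integrable (fun x => s x * g x) (volume.restrict (hull K)) :=
  (M.memLp_hull hK s).integrable_mul (IsSimplex.memLp_hull K hg 2)

theorem integrable_mul_face (hd : 1 ≤ d) {F : Set (E d)} (hF : F ∈ M.faces) (s : L2 M.skel)
    {g : E d → ℝ} (hg : Continuous g) : Integrable (fun x => s x * g x) ((surf d).restrict F) :=
  (M.memLp_face hF s).integrable_mul (M.memLp_face_of_continuous hd hF hg 2)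

theorem polyLapl_add (q r : MvPolynomial (Fin d) ℝ) (x : E d) :
    polyLapl (q + r) x = polyLapl q x + polyLapl r x := by
  simp [polyLapl, Finset.sum_add_distrib]

theorem polyLapl_smul (c : ℝ) (q : MvPolynomial (Fin d) ℝ) (x : E d) :
    polyLapl (c • q) x = c * polyLapl q x := by
  simp [polyLapl, Finset.mul_sum]

theorem reconFunctional_add_right (hd : 1 ≤ d) {K : Finset (E d)} (hK : K ∈ M.cells) (s : M.Pairs)
    (q r : MvPolynomial (Fin d) ℝ) :
    M.reconFunctional K s (q + r) = M.reconFunctional K s q + M.reconFunctional K s r := by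
  have h2 : ∀ a ∈ K, ∫ x in facet K a, s.2 x * ⟪polyGrad (q + r) x, outerNormal K a⟫ ∂(surf d) =
      (∫ x in facet K a, s.2 x * ⟪polyGrad q x, outerNormal K a⟫ ∂(surf d)) +
      ∫ x in facet K a, s.2 x * ⟪polyGrad r x, outerNormal K a⟫ ∂(surf d) := by
    intro a ha
    rw [← integral_add (M.integrable_mul_face hd (M.facet_mem_faces hK ha) _ (by fun_prop))
      (M.integrable_mul_face hd (M.facet_mem_faces hK ha) _ (by fun_prop))]
    refine integral_congr_ae (Eventually.of_forall fun x => ?_)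
    simp only [polyGrad_add, inner_add_left, mul_add]
  have h1 : ∫ x in hull K, s.1 x * polyLapl (q + r) x =
      (∫ x in hull K, s.1 x * polyLapl q x) + ∫ x in hull K, s.1 x * polyLapl r x := by
    rw [← integral_add (M.integrable_mul_hull hK _ (by fun_prop))
      (M.integrable_mul_hull hK _ (by fun_prop))]
    refine integral_congr_ae (Eventually.of_forall fun x => ?_)
    simp only [polyLapl_add, mul_add]
  rw [reconFunctional, h1, Finset.sum_congr rfl h2, Finset.sum_add_distrib]
  simp only [reconFunctional]
  ring

theorem reconFunctional_smul_right (K : Finset (E d)) (s : M.Pairs) (c : ℝ)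
    (q : MvPolynomial (Fin d) ℝ) :
    M.reconFunctional K s (c • q) = c * M.reconFunctional K s q := by
  simp only [reconFunctional, polyGrad_smul, polyLapl_smul, inner_smul_left, conj_trivial,
    mul_left_comm _ c, integral_const_mul, ← Finset.mul_sum]
  ring

theorem reconFunctional_add_left (hd : 1 ≤ d) {K : Finset (E d)} (hK : K ∈ M.cells) (s t : M.Pairs)
    (q : MvPolynomial (Fin d) ℝ) :
    M.reconFunctional K (s + t) q = M.reconFunctional K s q + M.reconFunctional K t q := by
  have h2 : ∀ a ∈ K, ∫ x in facet K a, (s + t).2 x * ⟪polyGrad q x, outerNormal K a⟫ ∂(surf d) =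
      (∫ x in facet K a, s.2 x * ⟪polyGrad q x, outerNormal K a⟫ ∂(surf d)) +
      ∫ x in facet K a, t.2 x * ⟪polyGrad q x, outerNormal K a⟫ ∂(surf d) := by
    intro a ha
    have hF := M.facet_mem_faces hK ha
    rw [← integral_add (M.integrable_mul_face hd hF _ (by fun_prop))
      (M.integrable_mul_face hd hF _ (by fun_prop))]
    refine integral_congr_ae ?_
    filter_upwards [M.ae_skel_iff.1 (Lp.coeFn_add s.2 t.2) _ hF] with x hx
    rw [Prod.snd_add, hx, Pi.add_apply, add_mul]
  have h1 : ∫ x in hull K, (s + t).1 x * polyLapl q x =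
      (∫ x in hull K, s.1 x * polyLapl q x) + ∫ x in hull K, t.1 x * polyLapl q x := by
    rw [← integral_add (M.integrable_mul_hull hK _ (by fun_prop))
      (M.integrable_mul_hull hK _ (by fun_prop))]
    refine integral_congr_ae ?_
    filter_upwards [M.ae_hull_of_ae hK (Lp.coeFn_add s.1 t.1)] with x hx
    rw [Prod.fst_add, hx, Pi.add_apply, add_mul]
  rw [reconFunctional, h1, Finset.sum_congr rfl h2, Finset.sum_add_distrib]
  simp only [reconFunctional]
  ring

theorem reconFunctional_C (K : Finset (E d)) (s : M.Pairs) (c : ℝ) :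
    M.reconFunctional K s (MvPolynomial.C c) = 0 := by
  simp [reconFunctional, polyLapl]

theorem eq_C_of_integral_inner_polyGrad {K : Finset (E d)} (hK : IsSimplex K)
    {q : MvPolynomial (Fin d) ℝ} (h : ∫ x in hull K, ⟪polyGrad q x, polyGrad q x⟫ = 0) :
    ∃ c, q = MvPolynomial.C c := by
  refine exists_eq_C_of_polyGrad_eq_zero hK.interior_nonempty ?_
  rw [← ae_restrict_iff' (isCompact_hull K).measurableSet]
  have hint : Integrable (fun x => ⟪polyGrad q x, polyGrad q x⟫) (volume.restrict (hull K)) :=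
    memLp_one_iff_integrable.1 (IsSimplex.memLp_hull K (by fun_prop) 1)
  rw [integral_eq_zero_iff_of_nonneg (fun x => real_inner_self_nonneg) hint] at h
  filter_upwards [h] with x hx using inner_self_eq_zero.1 hx

theorem integral_hull_const {K : Finset (E d)} (hK : IsSimplex K) {c : ℝ}
    (h : ∫ _ in hull K, c = 0) : c = 0 := by
  rw [setIntegral_const, smul_eq_mul, mul_eq_zero] at h
  refine h.resolve_left ?_
  exact (ENNReal.toReal_pos hK.volume_pos.ne' (IsSimplex.volume_lt_top K).ne).ne'

/-- Solvability of the discrete Neumann problem on a simplex. -/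
theorem exists_neumann {K : Finset (E d)} (hK : IsSimplex K) (n : ℕ)
    (l : MvPolynomial (Fin d) ℝ →ₗ[ℝ] ℝ) (hl : l 1 = 0) (m : ℝ) :
    ∃ r ∈ Poly d n, (∀ q ∈ Poly d n, ∫ x in hull K, ⟪polyGrad r x, polyGrad q x⟫ = l q) ∧
      ∫ x in hull K, polyFun r x = m := by
  have hint : ∀ g : E d → ℝ, Continuous g → Integrable g (volume.restrict (hull K)) := fun g hg =>
    hg.continuousOn.integrableOn_compact (isCompact_hull K)
  let I : MvPolynomial (Fin d) ℝ →ₗ[ℝ] ℝ :=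
    { toFun := fun q => ∫ x in hull K, polyFun q x
      map_add' := fun q r => by
        simp only [polyFun_add]
        exact integral_add (hint _ (by fun_prop)) (hint _ (by fun_prop))
      map_smul' := fun c q => by simp only [polyFun_smul, integral_const_mul]; rfl }
  -- The product of the integrals is added to the Neumann form to remove its kernel, the constants.
  -- The resulting form is definite, so in finite dimension every functional is represented.
  let B : MvPolynomial (Fin d) ℝ →ₗ[ℝ] MvPolynomial (Fin d) ℝ →ₗ[ℝ] ℝ :=
    LinearMap.mk₂ ℝ (fun r q => (∫ x in hull K, ⟪polyGrad r x, polyGrad q x⟫) + I r * I q)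
      (fun r r' q => by
        simp only [polyGrad_add, inner_add_left, map_add]
        rw [integral_add (hint _ (by fun_prop)) (hint _ (by fun_prop))]; ring)
      (fun c r q => by
        simp only [polyGrad_smul, inner_smul_left, map_smul, conj_trivial, integral_const_mul,
          smul_eq_mul]; ring)
      (fun r q q' => by
        simp only [polyGrad_add, inner_add_right, map_add]
        rw [integral_add (hint _ (by fun_prop)) (hint _ (by fun_prop))]; ring)
      (fun c r q => by
        simp only [polyGrad_smul, inner_smul_right, map_smul, integral_const_mul,
          smul_eq_mul]; ring)
  let T : Poly d n →ₗ[ℝ] Module.Dual ℝ (Poly d n) := B.domRestrict₁₂ (Poly d n) (Poly d n)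
  have hT : ∀ r q : Poly d n, T r q =
      (∫ x in hull K, ⟪polyGrad r.1 x, polyGrad q.1 x⟫) + I r.1 * I q.1 := fun r q => rfl
  have hinj : Function.Injective T := by
    rw [injective_iff_map_eq_zero]
    intro r hr
    have h0 : (∫ x in hull K, ⟪polyGrad r.1 x, polyGrad r.1 x⟫) + I r.1 * I r.1 = 0 := by
      rw [← hT, hr]; rfl
    have h1 : 0 ≤ ∫ x in hull K, ⟪polyGrad r.1 x, polyGrad r.1 x⟫ :=
      integral_nonneg fun x => real_inner_self_nonneg
    have h2 := mul_self_nonneg (I r.1)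
    obtain ⟨c, hc⟩ := eq_C_of_integral_inner_polyGrad hK (q := r.1) (by linarith)
    have h3 : I r.1 = 0 := mul_self_eq_zero.1 (by linarith)
    have h4 : ∫ _ in hull K, c = 0 := by
      have : I r.1 = ∫ x in hull K, polyFun r.1 x := rfl
      rw [← h3, this, hc]
      simp
    ext1
    rw [hc, integral_hull_const hK h4]
    simp
  have hsurj : Function.Surjective T :=
    (LinearMap.injective_iff_surjective_of_finrank_eq_finrank Subspace.dual_finrank_eq.symm).1 hinj
  obtain ⟨r, hr⟩ := hsurj ((l + m • I).domRestrict (Poly d n))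
  have hr' : ∀ q ∈ Poly d n, (∫ x in hull K, ⟪polyGrad r.1 x, polyGrad q x⟫) + I r.1 * I q =
      l q + m * I q := fun q hq => LinearMap.congr_fun hr ⟨q, hq⟩
  -- Testing with q = 1 and using the compatibility condition l 1 = 0 shows that the integral of r
  -- is m. The added terms then cancel, leaving the Neumann equation.
  have h1 := hr' 1 (by simpa using C_mem_Poly (d := d) 1 n)
  have hg1 : ∀ x : E d, polyGrad (1 : MvPolynomial (Fin d) ℝ) x = 0 := fun x => by
    simpa using polyGrad_C (d := d) 1 x
  simp only [hg1, inner_zero_right, integral_zero, zero_add, hl] at h1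
  have hI1 : I 1 ≠ 0 := by
    intro h0
    have h2 : ∫ _ in hull K, (1 : ℝ) = 0 := by
      rw [← h0]; exact integral_congr_ae (Eventually.of_forall fun x => (polyFun_one x).symm)
    exact one_ne_zero (integral_hull_const hK h2)
  have hIm : I r.1 = m := mul_right_cancel₀ hI1 h1
  refine ⟨r.1, r.2, fun q hq => ?_, hIm⟩
  have h2 := hr' q hq
  rw [hIm] at h2
  linarith

theorem isReconstruction_iff {p : ℕ} {s : M.Pairs} {r : L2 Ω.vol} :
    M.IsReconstruction p s r ↔ r ∈ M.brokenPoly (p + 1) ∧ ∀ K ∈ M.cells,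
      (∀ q ∈ Poly d (p + 1), ∫ x in hull K, ⟪polyGrad (cellPoly r K) x, polyGrad q x⟫ =
        M.reconFunctional K s q) ∧
      ∫ x in hull K, polyFun (cellPoly r K) x = ∫ x in hull K, s.1 x := by
  refine and_congr_right fun hr => forall₂_congr fun K hK => and_congr_right fun _ => ?_
  rw [integral_congr_ae (M.cellPoly_spec hr hK).2]

theorem exists_isReconstruction (hd : 1 ≤ d) (p : ℕ) (s : M.Pairs) :
    ∃ r, M.IsReconstruction p s r := by
  have hloc : ∀ K ∈ M.cells, ∃ r ∈ Poly d (p + 1),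
      (∀ q ∈ Poly d (p + 1), ∫ x in hull K, ⟪polyGrad r x, polyGrad q x⟫ =
        M.reconFunctional K s q) ∧ ∫ x in hull K, polyFun r x = ∫ x in hull K, s.1 x := by
    intro K hK
    let l : MvPolynomial (Fin d) ℝ →ₗ[ℝ] ℝ :=
      { toFun := M.reconFunctional K s
        map_add' := M.reconFunctional_add_right hd hK s
        map_smul' := M.reconFunctional_smul_right K s }
    exact exists_neumann (M.isSimplex hK) (p + 1) l (M.reconFunctional_C K s 1) _
  choose! Q hQ hQ1 hQ2 using hloc
  obtain ⟨r, hr, hrQ⟩ := M.exists_cellPoly_eq Q hQ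
  refine ⟨r, M.isReconstruction_iff.2 ⟨hr, fun K hK => ?_⟩⟩
  rw [hrQ K hK]
  exact ⟨hQ1 K hK, hQ2 K hK⟩

/-- On each cell the difference of two solutions, tested against itself, has zero gradient energy;
it is a constant with zero integral. Uniqueness also makes the reconstruction additive. -/
theorem IsReconstruction.unique {p : ℕ} {s : M.Pairs} {r r' : L2 Ω.vol}
    (h : M.IsReconstruction p s r) (h' : M.IsReconstruction p s r') : r = r' := by
  rw [isReconstruction_iff] at h h'
  refine M.ext_of_cellPoly h.1 h'.1 fun K hK => ?_
  have hint : ∀ g : E d → ℝ, Continuous g → Integrable g (volume.restrict (hull K)) := fun g hg =>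
    hg.continuousOn.integrableOn_compact (isCompact_hull K)
  obtain ⟨h1, h2⟩ := h.2 K hK
  obtain ⟨h1', h2'⟩ := h'.2 K hK
  set e := cellPoly r K - cellPoly r' K with he
  have heP : e ∈ Poly d (p + 1) :=
    Submodule.sub_mem _ (M.cellPoly_spec h.1 hK).1 (M.cellPoly_spec h'.1 hK).1
  have h3 : ∫ x in hull K, ⟪polyGrad e x, polyGrad e x⟫ = 0 := by
    have : ∀ x, ⟪polyGrad e x, polyGrad e x⟫ = ⟪polyGrad (cellPoly r K) x, polyGrad e x⟫ -
        ⟪polyGrad (cellPoly r' K) x, polyGrad e x⟫ := by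
      intro x
      rw [← inner_sub_left, ← polyGrad_sub]
    simp only [this]
    rw [integral_sub (hint _ (by fun_prop)) (hint _ (by fun_prop)), h1 e heP, h1' e heP, sub_self]
  obtain ⟨c, hc⟩ := eq_C_of_integral_inner_polyGrad (M.isSimplex hK) h3
  have h4 : ∫ _ in hull K, c = 0 := by
    have : ∀ x, c = polyFun (cellPoly r K) x - polyFun (cellPoly r' K) x := by
      intro x
      rw [← polyFun_sub, ← he, hc, polyFun_C]
    rw [integral_congr_ae (Eventually.of_forall this),
      integral_sub (hint _ (by fun_prop)) (hint _ (by fun_prop)), h2, h2', sub_self]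
  rw [← sub_eq_zero, ← he, hc, integral_hull_const (M.isSimplex hK) h4, map_zero]

theorem isReconstruction_reconstruction (hd : 1 ≤ d) (p : ℕ) (s : M.Pairs) :
    M.IsReconstruction p s (M.reconstruction p s) := by
  have h := M.exists_isReconstruction hd p s
  rw [reconstruction, dif_pos h]
  exact h.choose_spec

theorem reconstruction_eq (hd : 1 ≤ d) {p : ℕ} {s : M.Pairs} {r : L2 Ω.vol}
    (h : M.IsReconstruction p s r) : M.reconstruction p s = r :=
  IsReconstruction.unique M (M.isReconstruction_reconstruction hd p s) h

theorem reconstruction_mem (hd : 1 ≤ d) (p : ℕ) (s : M.Pairs) :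
    M.reconstruction p s ∈ M.brokenPoly (p + 1) := (M.isReconstruction_reconstruction hd p s).1

theorem reconstruction_add (hd : 1 ≤ d) (p : ℕ) (s t : M.Pairs) :
    M.reconstruction p (s + t) = M.reconstruction p s + M.reconstruction p t := by
  refine M.reconstruction_eq hd ?_
  have hs := M.isReconstruction_iff.1 (M.isReconstruction_reconstruction hd p s)
  have ht := M.isReconstruction_iff.1 (M.isReconstruction_reconstruction hd p t)
  refine M.isReconstruction_iff.2 ⟨Submodule.add_mem _ hs.1 ht.1, fun K hK => ?_⟩
  have hint : ∀ g : E d → ℝ, Continuous g → Integrable g (volume.restrict (hull K)) := fun g hg =>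
    hg.continuousOn.integrableOn_compact (isCompact_hull K)
  rw [M.cellPoly_add hs.1 ht.1 hK]
  constructor
  · intro q hq
    simp only [polyGrad_add, inner_add_left]
    rw [integral_add (hint _ (by fun_prop)) (hint _ (by fun_prop)),
      M.reconFunctional_add_left hd hK, (hs.2 K hK).1 q hq, (ht.2 K hK).1 q hq]
  · simp only [polyFun_add]
    rw [integral_add (hint _ (by fun_prop)) (hint _ (by fun_prop)), (hs.2 K hK).2, (ht.2 K hK).2,
      ← integral_add]
    · refine integral_congr_ae ?_
      filter_upwards [M.ae_hull_of_ae hK (Lp.coeFn_add s.1 t.1)] with x hx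
      rw [Prod.fst_add, hx, Pi.add_apply]
    · simpa using M.integrable_mul_hull hK s.1 (continuous_const (y := (1 : ℝ)))
    · simpa using M.integrable_mul_hull hK t.1 (continuous_const (y := (1 : ℝ)))

theorem reconstruction_sub (hd : 1 ≤ d) (p : ℕ) (s t : M.Pairs) :
    M.reconstruction p (s - t) = M.reconstruction p s - M.reconstruction p t := by
  have h := M.reconstruction_add hd p (s - t) t
  rw [sub_add_cancel] at h
  rw [h, add_sub_cancel_right]

end Mesh

/-! ### Test functions and weak gradients -/

section WeakGradient

variable {d : ℕ} {Ω : Domain d}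

theorem continuous_gradient {f : E d → ℝ} (hf : ContDiff ℝ 1 f) : Continuous (gradient f) := by
  unfold gradient
  exact (LinearIsometryEquiv.continuous _).comp (hf.continuous_fderiv one_ne_zero)

theorem IsTest.contDiff_one {φ : E d → ℝ} (hφ : IsTest Ω φ) : ContDiff ℝ 1 φ :=
  hφ.1.of_le (by exact_mod_cast le_top)

theorem IsTest.differentiable {φ : E d → ℝ} (hφ : IsTest Ω φ) : Differentiable ℝ φ :=
  hφ.contDiff_one.differentiable one_ne_zero

theorem IsTest.hasCompactSupport_gradient {φ : E d → ℝ} (hφ : IsTest Ω φ) :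
    HasCompactSupport (gradient φ) :=
  (hφ.2.1.fderiv (𝕜 := ℝ)).comp_left (g := (InnerProductSpace.toDual ℝ (E d)).symm) (map_zero _)

theorem gradient_sub {f g : E d → ℝ} (hf : Differentiable ℝ f) (hg : Differentiable ℝ g) :
    gradient (fun x => f x - g x) = fun x => gradient f x - gradient g x := by
  funext x
  simp only [gradient]
  rw [fderiv_fun_sub (hf x) (hg x), map_sub]

theorem IsTest.sub {φ ψ : E d → ℝ} (hφ : IsTest Ω φ) (hψ : IsTest Ω ψ) :
    IsTest Ω (fun x => φ x - ψ x) := by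
  refine ⟨hφ.1.sub hψ.1, hφ.2.1.sub hψ.2.1, ?_⟩
  exact (tsupport_sub φ ψ).trans (Set.union_subset hφ.2.2 hψ.2.2)

instance (Ω : Domain d) : IsFiniteMeasure Ω.vol :=
  ⟨by simpa [Domain.vol] using Ω.isBounded.measure_lt_top⟩

theorem IsTest.memLp {φ : E d → ℝ} (hφ : IsTest Ω φ) : MemLp φ 2 Ω.vol :=
  hφ.1.continuous.memLp_of_hasCompactSupport hφ.2.1

theorem IsTest.memLp_gradient {φ : E d → ℝ} (hφ : IsTest Ω φ) : MemLp (gradient φ) 2 Ω.vol :=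
  (continuous_gradient hφ.contDiff_one).memLp_of_hasCompactSupport hφ.hasCompactSupport_gradient

theorem IsTest.integrable_smul_gradient {φ : E d → ℝ} (hφ : IsTest Ω φ) (v : L2 Ω.vol) :
    Integrable (fun x => v x • gradient φ x) Ω.vol :=
  memLp_one_iff_integrable.1 (hφ.memLp_gradient.smul (Lp.memLp v))

theorem IsTest.integrable_smul {φ : E d → ℝ} (hφ : IsTest Ω φ) (G : Lp (E d) 2 Ω.vol) :
    Integrable (fun x => φ x • G x) Ω.vol :=
  memLp_one_iff_integrable.1 ((Lp.memLp G).smul hφ.memLp)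

/-- The fundamental lemma of the calculus of variations; it frees `weakGradient` from the choice in
its definition. -/
theorem HasWeakGradient.unique {v : L2 Ω.vol} {G G' : Lp (E d) 2 Ω.vol}
    (h : HasWeakGradient v G) (h' : HasWeakGradient v G') : G = G' := by
  have hloc : LocallyIntegrableOn (fun x => G x - G' x) Ω.carrier Ω.vol :=
    (((Lp.memLp G).sub (Lp.memLp G')).integrable (by norm_num)).integrableOn.locallyIntegrableOn
  have h0 := Ω.isOpen.ae_eq_zero_of_integral_contDiff_smul_eq_zero hloc (fun φ h1 h2 h3 => by
    have hφ : IsTest Ω φ := ⟨h1, h2, h3⟩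
    have e : ∫ x, φ x • G x ∂Ω.vol = ∫ x, φ x • G' x ∂Ω.vol := by
      rw [← neg_inj, ← h φ hφ, ← h' φ hφ]
    simp only [smul_sub]
    rw [integral_sub (hφ.integrable_smul G) (hφ.integrable_smul G'), e, sub_self])
  refine Lp.ext ?_
  filter_upwards [h0, ae_restrict_mem Ω.isOpen.measurableSet] with x hx hxΩ
  exact sub_eq_zero.1 (hx hxΩ)

theorem hasWeakGradient_weakGradient {v : L2 Ω.vol} (h : ∃ G, HasWeakGradient v G) :
    HasWeakGradient v (weakGradient v) := by
  rw [weakGradient, dif_pos h]; exact h.choose_spec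

theorem HasWeakGradient.weakGradient_eq {v : L2 Ω.vol} {G : Lp (E d) 2 Ω.vol}
    (h : HasWeakGradient v G) : weakGradient v = G :=
  (hasWeakGradient_weakGradient ⟨G, h⟩).unique h

theorem HasWeakGradient.sub {v v' : L2 Ω.vol} {G G' : Lp (E d) 2 Ω.vol}
    (h : HasWeakGradient v G) (h' : HasWeakGradient v' G') : HasWeakGradient (v - v') (G - G') := by
  intro φ hφ
  have e1 : ∫ x, (v - v') x • gradient φ x ∂Ω.vol =
      (∫ x, v x • gradient φ x ∂Ω.vol) - ∫ x, v' x • gradient φ x ∂Ω.vol := by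
    rw [← integral_sub (hφ.integrable_smul_gradient v) (hφ.integrable_smul_gradient v')]
    refine integral_congr_ae ?_
    filter_upwards [Lp.coeFn_sub v v'] with x hx
    rw [hx, Pi.sub_apply, sub_smul]
  have e2 : ∫ x, φ x • (G - G') x ∂Ω.vol =
      (∫ x, φ x • G x ∂Ω.vol) - ∫ x, φ x • G' x ∂Ω.vol := by
    rw [← integral_sub (hφ.integrable_smul G) (hφ.integrable_smul G')]
    refine integral_congr_ae ?_
    filter_upwards [Lp.coeFn_sub G G'] with x hx
    rw [hx, Pi.sub_apply, smul_sub]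
  rw [e1, e2, h φ hφ, h' φ hφ]
  abel

theorem tendsto_eLpNorm_sub_sub {α F : Type*} [MeasurableSpace α] [NormedAddCommGroup F]
    {μ : Measure α} {f f' : ℕ → α → F} {g g' : α → F}
    (hf : ∀ n, AEStronglyMeasurable (fun x => f n x - g x) μ)
    (hf' : ∀ n, AEStronglyMeasurable (fun x => f' n x - g' x) μ)
    (h : Tendsto (fun n => eLpNorm (fun x => f n x - g x) 2 μ) atTop (𝓝 0))
    (h' : Tendsto (fun n => eLpNorm (fun x => f' n x - g' x) 2 μ) atTop (𝓝 0)) :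
    Tendsto (fun n => eLpNorm (fun x => (f n x - f' n x) - (g x - g' x)) 2 μ) atTop (𝓝 0) := by
  have hsum := h.add h'
  rw [add_zero] at hsum
  refine tendsto_of_tendsto_of_tendsto_of_le_of_le tendsto_const_nhds hsum (fun _ => zero_le)
    fun n => ?_
  have : (fun x => (f n x - f' n x) - (g x - g' x)) =
      (fun x => f n x - g x) - fun x => f' n x - g' x := by
    funext x; simp only [Pi.sub_apply]; abel
  rw [this]
  exact eLpNorm_sub_le (hf n) (hf' n) (by norm_num)

theorem TendstoH1.sub {φ ψ : ℕ → E d → ℝ} {v w : L2 Ω.vol} (hφ : ∀ n, IsTest Ω (φ n))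
    (hψ : ∀ n, IsTest Ω (ψ n)) (hv : ∃ G, HasWeakGradient v G) (hw : ∃ G, HasWeakGradient w G)
    (h : TendstoH1 φ v) (h' : TendstoH1 ψ w) :
    TendstoH1 (fun n x => φ n x - ψ n x) (v - w) := by
  have hG : weakGradient (v - w) = weakGradient v - weakGradient w :=
    ((hasWeakGradient_weakGradient hv).sub (hasWeakGradient_weakGradient hw)).weakGradient_eq
  constructor
  · have := tendsto_eLpNorm_sub_sub
      (fun n => ((hφ n).memLp.sub (Lp.memLp v)).aestronglyMeasurable)
      (fun n => ((hψ n).memLp.sub (Lp.memLp w)).aestronglyMeasurable) h.1 h'.1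
    refine this.congr fun n => eLpNorm_congr_ae ?_
    filter_upwards [Lp.coeFn_sub v w] with x hx
    rw [hx, Pi.sub_apply]
  · have := tendsto_eLpNorm_sub_sub
      (fun n => ((hφ n).memLp_gradient.sub (Lp.memLp _)).aestronglyMeasurable)
      (fun n => ((hψ n).memLp_gradient.sub (Lp.memLp _)).aestronglyMeasurable) h.2 h'.2
    refine this.congr fun n => eLpNorm_congr_ae ?_
    rw [hG, gradient_sub (hφ n).differentiable (hψ n).differentiable]
    filter_upwards [Lp.coeFn_sub (weakGradient v) (weakGradient w)] with x hx
    rw [hx, Pi.sub_apply]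

/-- Integration by parts against a test function. -/
theorem integral_polyFun_smul_gradient {φ : E d → ℝ} (hφ : IsTest Ω φ)
    (q : MvPolynomial (Fin d) ℝ) :
    ∫ x, polyFun q x • gradient φ x = -∫ x, φ x • polyGrad q x := by
  have hφc : Continuous φ := hφ.1.continuous
  have hgc := continuous_gradient hφ.contDiff_one
  have hfd : Continuous (fderiv ℝ φ) := hφ.contDiff_one.continuous_fderiv one_ne_zero
  have hc0 : Continuous (fun x => polyFun q x • gradient φ x) := (continuous_polyFun q).smul hgc
  have hs0 : HasCompactSupport (fun x => polyFun q x • gradient φ x) :=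
    hφ.hasCompactSupport_gradient.mono fun x hx h => hx (by simp [h])
  have i1 : Integrable (fun x => polyFun q x • gradient φ x) :=
    hc0.integrable_of_hasCompactSupport hs0
  have i2 : Integrable (fun x => φ x • polyGrad q x) :=
    (by fun_prop : Continuous fun x => φ x • polyGrad q x).integrable_of_hasCompactSupport
      hφ.2.1.smul_right
  refine ext_inner_right ℝ fun v => ?_
  rw [inner_neg_left, real_inner_comm, real_inner_comm v, ← integral_inner i1, ← integral_inner i2]
  have hfq : Continuous (fderiv ℝ (polyFun q : E d → ℝ)) :=
    (contDiff_one_polyFun q).continuous_fderiv one_ne_zero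
  have hs1 : HasCompactSupport (fun x => (fderiv ℝ (polyFun q : E d → ℝ) x) v * φ x) :=
    hφ.2.1.mul_left
  have hs2 : HasCompactSupport (fun x => polyFun q x * (fderiv ℝ φ x) v) :=
    (hφ.2.1.fderiv_apply (𝕜 := ℝ) v).mul_left
  have hs3 : HasCompactSupport (fun x => polyFun q x * φ x) := hφ.2.1.mul_left
  have hc1 : Continuous (fun x => (fderiv ℝ (polyFun q : E d → ℝ) x) v * φ x) :=
    (hfq.clm_apply continuous_const).mul hφc
  have hc2 : Continuous (fun x => polyFun q x * (fderiv ℝ φ x) v) :=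
    (continuous_polyFun q).mul (hfd.clm_apply continuous_const)
  have hc3 : Continuous (fun x => polyFun q x * φ x) := (continuous_polyFun q).mul hφc
  have hq1 : ∀ x, DifferentiableAt ℝ (polyFun q : E d → ℝ) x :=
    fun x => (hasGradientAt_polyFun q x).hasFDerivAt.differentiableAt
  have key := integral_mul_fderiv_eq_neg_fderiv_mul_of_integrable (μ := (volume : Measure (E d)))
    (f := polyFun q) (g := φ) (v := v)
    (hc1.integrable_of_hasCompactSupport hs1) (hc2.integrable_of_hasCompactSupport hs2)
    (hc3.integrable_of_hasCompactSupport hs3) (fun x _ => hq1 x) (fun x _ => hφ.differentiable x)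
  have e1 : ∀ x, ⟪v, polyFun q x • gradient φ x⟫ = polyFun q x * (fderiv ℝ φ x) v := fun x => by
    rw [inner_smul_right, real_inner_comm, inner_eq_fderiv (hφ.differentiable x)]
  have e2 : ∀ x, ⟪v, φ x • polyGrad q x⟫ = (fderiv ℝ (polyFun q) x) v * φ x := fun x => by
    rw [inner_smul_right, real_inner_comm, ← gradient_polyFun,
      inner_eq_fderiv (hq1 x), mul_comm]
  simp only [e1, e2]
  exact key

end WeakGradient

/-! ### The continuous space -/

namespace Mesh

variable {d : ℕ} {Ω : Domain d} (M : Mesh Ω)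

/-- Differences of the approximating sequences approximate the difference. The sequence defining the
trace also converges in H¹, so it serves for membership in H¹₀ as well. -/
theorem sub_mem_contSpace {v w : M.Pairs} (hv : v ∈ M.contSpace) (hw : w ∈ M.contSpace) :
    v - w ∈ M.contSpace := by
  obtain ⟨⟨hvG, -⟩, φ, hφ, hφ1, hφ2⟩ := hv
  obtain ⟨⟨hwG, -⟩, ψ, hψ, hψ1, hψ2⟩ := hw
  have h1 := TendstoH1.sub hφ hψ hvG hwG hφ1 hψ1
  have htest := fun n => (hφ n).sub (hψ n)
  refine ⟨⟨?_, _, htest, h1⟩, _, htest, h1, ?_⟩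
  · exact ⟨_, (hasWeakGradient_weakGradient hvG).sub (hasWeakGradient_weakGradient hwG)⟩
  · have := tendsto_eLpNorm_sub_sub
      (fun n => (hφ n).1.continuous.aestronglyMeasurable.sub (Lp.memLp v.2).aestronglyMeasurable)
      (fun n => (hψ n).1.continuous.aestronglyMeasurable.sub (Lp.memLp w.2).aestronglyMeasurable)
      hφ2 hψ2
    refine this.congr fun n => eLpNorm_congr_ae ?_
    filter_upwards [Lp.coeFn_sub v.2 w.2] with x hx
    rw [Prod.snd_sub, hx, Pi.sub_apply]

theorem weakGradient_sub {v w : M.Pairs} (hv : v ∈ M.contSpace) (hw : w ∈ M.contSpace) :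
    weakGradient (v - w).1 = weakGradient v.1 - weakGradient w.1 :=
  ((hasWeakGradient_weakGradient hv.1.1).sub (hasWeakGradient_weakGradient hw.1.1)).weakGradient_eq

/-- The approximation of an element of the continuous space by test functions. -/
theorem exists_approx {v : M.Pairs} (hv : v ∈ M.contSpace) : ∃ φ : ℕ → E d → ℝ,
    (∀ n, IsTest Ω (φ n)) ∧
    (∀ K ∈ M.cells,
      Tendsto (fun n => eLpNorm (fun x => φ n x - v.1 x) 2 (volume.restrict (hull K))) atTop (𝓝 0) ∧
      Tendsto (fun n => eLpNorm (fun x => gradient (φ n) x - weakGradient v.1 x) 2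
        (volume.restrict (hull K))) atTop (𝓝 0)) ∧
    ∀ F ∈ M.faces,
      Tendsto (fun n => eLpNorm (fun x => φ n x - v.2 x) 2 ((surf d).restrict F)) atTop (𝓝 0) := by
  obtain ⟨-, φ, hφ, h1, h2⟩ := hv
  refine ⟨φ, hφ, fun K hK => ⟨?_, ?_⟩, fun F hF => ?_⟩
  · exact tendsto_of_tendsto_of_tendsto_of_le_of_le tendsto_const_nhds h1.1 (fun _ => zero_le)
      fun n => eLpNorm_mono_measure _ (M.restrict_hull_le hK)
  · exact tendsto_of_tendsto_of_tendsto_of_le_of_le tendsto_const_nhds h1.2 (fun _ => zero_le)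
      fun n => eLpNorm_mono_measure _ (M.restrict_hull_le hK)
  · exact tendsto_of_tendsto_of_tendsto_of_le_of_le tendsto_const_nhds h2 (fun _ => zero_le)
      fun n => eLpNorm_mono_measure _ (M.restrict_face_le hF)

/-- The trace vanishes on the boundary faces. -/
theorem trace_boundary {v : M.Pairs} (hv : v ∈ M.contSpace) {F : Set (E d)}
    (hF : F ∈ M.boundaryFaces) : ∀ᵐ x ∂(surf d).restrict F, v.2 x = 0 := by
  obtain ⟨φ, hφ, -, h2⟩ := M.exists_approx hv
  -- A test function is supported in the open set Ω, which does not meet its frontier.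
  have hφ0 : ∀ n, ∀ x ∈ F, φ n x = 0 := by
    intro n x hx
    by_contra hne
    have h1 : x ∈ Ω.carrier := (hφ n).2.2 (subset_tsupport _ hne)
    have h3 := hF.2 hx
    rw [Ω.isOpen.frontier_eq] at h3
    exact h3.2 h1
  have hconst : ∀ n, eLpNorm (fun x => φ n x - v.2 x) 2 ((surf d).restrict F) =
      eLpNorm v.2 2 ((surf d).restrict F) := by
    intro n
    rw [← eLpNorm_neg]
    refine eLpNorm_congr_ae ?_
    filter_upwards [ae_restrict_mem (M.measurableSet_face hF.1)] with x hx
    simp [hφ0 n x hx]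
  have h3 := h2 F hF.1
  simp only [hconst] at h3
  have h4 : eLpNorm v.2 2 ((surf d).restrict F) = 0 := tendsto_nhds_unique tendsto_const_nhds h3
  exact (eLpNorm_eq_zero_iff (M.memLp_face hF.1 v.2).aestronglyMeasurable (by norm_num)).1 h4

/-- On a cell where the function is a polynomial, so is the weak gradient. -/
theorem weakGradient_eq_polyGrad {v : M.Pairs} (hv : v ∈ M.contSpace) {K : Finset (E d)}
    (hK : K ∈ M.cells) {q : MvPolynomial (Fin d) ℝ}
    (hq : ∀ᵐ x ∂volume.restrict (hull K), v.1 x = polyFun q x) :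
    ∀ᵐ x ∂volume.restrict (hull K), weakGradient v.1 x = polyGrad q x := by
  set G := weakGradient v.1 with hG
  have hw : HasWeakGradient v.1 G := hasWeakGradient_weakGradient hv.1.1
  -- Test functions supported in U are admissible both for the weak gradient in Ω and for
  -- integration by parts of q. What remains of the cell is almost nothing, as its frontier is null.
  set U := interior (hull K) ∩ Ω.carrier with hU
  have hUo : IsOpen U := isOpen_interior.inter Ω.isOpen
  have hmemq : MemLp (polyGrad q) 2 (Ω.vol.restrict (hull K)) := by
    rw [M.vol_restrict hK]
    exact IsSimplex.memLp_hull K (continuous_polyGrad q) 2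
  have hloc : LocallyIntegrableOn (fun x => G x - polyGrad q x) U Ω.vol := by
    have h1 : LocallyIntegrableOn G U Ω.vol :=
      ((Lp.memLp G).integrable (by norm_num)).integrableOn.locallyIntegrableOn
    exact h1.sub ((continuous_polyGrad q).locallyIntegrable.locallyIntegrableOn U)
  have h0 := hUo.ae_eq_zero_of_integral_contDiff_smul_eq_zero hloc (fun φ h1 h2 h3 => by
    have hφ : IsTest Ω φ := ⟨h1, h2, h3.trans Set.inter_subset_right⟩
    have hsupp : ∀ x, x ∉ U → φ x = 0 := fun x hx =>
      image_eq_zero_of_notMem_tsupport fun hx' => hx (h3 hx')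
    have hsuppg : ∀ x, x ∉ U → gradient φ x = 0 := fun x hx => by
      have : fderiv ℝ φ x = 0 :=
        image_eq_zero_of_notMem_tsupport fun hx' => hx (h3 (tsupport_fderiv_subset ℝ hx'))
      rw [gradient, this, map_zero]
    have hφc : Continuous φ := h1.continuous
    have i2 : Integrable (fun x => φ x • polyGrad q x) :=
      (by fun_prop : Continuous fun x => φ x • polyGrad q x).integrable_of_hasCompactSupport
        h2.smul_right
    have e1 : ∫ x, v.1 x • gradient φ x ∂Ω.vol = ∫ x, polyFun q x • gradient φ x := by
      rw [← setIntegral_eq_integral_of_forall_compl_eq_zero (s := Ω.carrier)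
        (f := fun x => polyFun q x • gradient φ x)
        (fun x hx => by rw [hsuppg x (fun h => hx h.2), smul_zero])]
      refine integral_congr_ae ?_
      filter_upwards [(M.ae_hull_iff hK).2 hq] with x hx
      by_cases hxU : x ∈ U
      · rw [hx (interior_subset hxU.1)]
      · rw [hsuppg x hxU, smul_zero, smul_zero]
    have e2 : ∫ x, φ x • polyGrad q x ∂Ω.vol = ∫ x, φ x • polyGrad q x :=
      setIntegral_eq_integral_of_forall_compl_eq_zero
        (fun x hx => by rw [hsupp x (fun h => hx h.2), zero_smul])
    simp only [smul_sub]
    rw [integral_sub (hφ.integrable_smul G) i2.integrableOn, e2, sub_eq_zero, ← neg_inj,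
      ← hw φ hφ, e1, integral_polyFun_smul_gradient hφ])
  rw [← M.ae_hull_iff hK]
  have hfr : ∀ᵐ x ∂Ω.vol, x ∉ frontier (hull K) :=
    ae_restrict_of_ae (measure_eq_zero_iff_ae_notMem.1 (IsSimplex.volume_frontier K))
  filter_upwards [h0, hfr, ae_restrict_mem Ω.isOpen.measurableSet] with x hx hxf hxΩ hxK
  have hxi : x ∈ interior (hull K) := by
    by_contra hni
    exact hxf ⟨subset_closure hxK, hni⟩
  exact sub_eq_zero.1 (hx ⟨hxi, hxΩ⟩)

/-- On the facets of a cell where the function is a polynomial, so is its trace. -/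
theorem trace_eq_polyFun (hd : 1 ≤ d) {v : M.Pairs} (hv : v ∈ M.contSpace) {K : Finset (E d)}
    (hK : K ∈ M.cells) {q : MvPolynomial (Fin d) ℝ}
    (hq : ∀ᵐ x ∂volume.restrict (hull K), v.1 x = polyFun q x) {a : E d} (ha : a ∈ K) :
    ∀ᵐ x ∂(surf d).restrict (facet K a), v.2 x = polyFun q x := by
  obtain ⟨φ, hφ, h1, h2⟩ := M.exists_approx hv
  have hF := M.facet_mem_faces hK ha
  have hψ : ∀ n, ContDiff ℝ 1 (fun x => φ n x - polyFun q x) := fun n =>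
    (hφ n).contDiff_one.sub (contDiff_one_polyFun q)
  have hqd : Differentiable ℝ (polyFun q : E d → ℝ) := fun x =>
    (hasGradientAt_polyFun q x).hasFDerivAt.differentiableAt
  -- The functions φ n - q tend to zero in H¹ of the cell, so their traces tend to zero on the
  -- facet. Since φ n also tends to v.2 there, the two limits agree.
  have t0 := (M.isSimplex hK).tendsto_trace hd ha hψ
    ((h1 K hK).1.congr fun n => eLpNorm_congr_ae (by
      filter_upwards [hq] with x hx; rw [hx]))
    ((h1 K hK).2.congr fun n => eLpNorm_congr_ae (by
      filter_upwards [M.weakGradient_eq_polyGrad hv hK hq] with x hx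
      rw [hx, gradient_sub (hφ n).differentiable hqd, gradient_polyFun]))
  have t1 := tendsto_eLpNorm_sub_sub
    (fun n => ((hφ n).1.continuous.sub (continuous_polyFun q)).aestronglyMeasurable)
    (fun n => (hφ n).1.continuous.aestronglyMeasurable.sub
      (M.memLp_face hF v.2).aestronglyMeasurable) t0 (h2 _ hF)
  simp only [sub_self, zero_sub, neg_sub] at t1
  have h4 : eLpNorm (fun x => v.2 x - polyFun q x) 2 ((surf d).restrict (facet K a)) = 0 :=
    tendsto_nhds_unique tendsto_const_nhds t1
  have h5 := (eLpNorm_eq_zero_iff (f := fun x => v.2 x - polyFun q x)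
    ((M.memLp_face hF v.2).aestronglyMeasurable.sub
      (continuous_polyFun q).aestronglyMeasurable) (by norm_num)).1 h4
  filter_upwards [h5] with x hx
  exact sub_eq_zero.1 hx

/-- Green's formula on a cell for functions in `H¹₀(Ω)`. -/
theorem green_contSpace (hd : 1 ≤ d) {v : M.Pairs} (hv : v ∈ M.contSpace) {K : Finset (E d)}
    (hK : K ∈ M.cells) (q : MvPolynomial (Fin d) ℝ) :
    ∫ x in hull K, ⟪weakGradient v.1 x, polyGrad q x⟫ = M.reconFunctional K v q := by
  obtain ⟨φ, hφ, h1, h2⟩ := M.exists_approx hv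
  have hs := M.isSimplex hK
  -- Green's formula holds for the test functions φ n. Each of its terms passes to the limit by the
  -- convergence of gradients, values and traces.
  have l1 := tendsto_integral_inner
    (fun n => IsSimplex.memLp_hull K (continuous_gradient (hφ n).contDiff_one) 2)
    (M.memLp_hull hK (weakGradient v.1)) (IsSimplex.memLp_hull K (continuous_polyGrad q) 2)
    (h1 K hK).2
  have l2 := tendsto_integral_inner
    (fun n => IsSimplex.memLp_hull K (hφ n).1.continuous 2)
    (M.memLp_hull hK v.1) (IsSimplex.memLp_hull K (continuous_polyLapl q) 2)
    (h1 K hK).1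
  have l3 : ∀ a ∈ K, _ := fun a ha => tendsto_integral_inner
    (fun n => hs.memLp_facet hd ha (hφ n).1.continuous 2)
    (M.memLp_face (M.facet_mem_faces hK ha) v.2)
    (hs.memLp_facet hd ha (by fun_prop : Continuous fun x => ⟪polyGrad q x, outerNormal K a⟫) 2)
    (h2 _ (M.facet_mem_faces hK ha))
  have l4 := l2.neg.add (tendsto_finsetSum K l3)
  refine tendsto_nhds_unique l1 ?_
  have hR : M.reconFunctional K v q = -(∫ x in hull K, ⟪v.1 x, polyLapl q x⟫) +
      ∑ a ∈ K, ∫ x in facet K a, ⟪v.2 x, ⟪polyGrad q x, outerNormal K a⟫⟫ ∂(surf d) := by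
    simp only [reconFunctional, RCLike.inner_apply, conj_trivial, mul_comm]
  rw [hR]
  refine l4.congr fun n => ?_
  rw [hs.green hd (hφ n).contDiff_one q]
  simp only [RCLike.inner_apply, conj_trivial, mul_comm]

/-- A function whose gradient is the gradient of a polynomial on a cell is a polynomial there. -/
theorem exists_eq_add_const {v : M.Pairs} (hv : v ∈ M.contSpace) {K : Finset (E d)}
    (hK : K ∈ M.cells) {r : MvPolynomial (Fin d) ℝ}
    (h : ∀ᵐ x ∂volume.restrict (hull K), weakGradient v.1 x = polyGrad r x) :
    ∃ c, ∀ᵐ x ∂volume.restrict (hull K), v.1 x = polyFun (r + MvPolynomial.C c) x := by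
  obtain ⟨φ, hφ, h1, -⟩ := M.exists_approx hv
  have hrd : Differentiable ℝ (polyFun r : E d → ℝ) := fun x =>
    (hasGradientAt_polyFun r x).hasFDerivAt.differentiableAt
  -- The gradients of φ n - r tend to zero on the convex cell, so the L² limit v - r is constant
  -- there.
  obtain ⟨c, hc⟩ := exists_ae_eq_const_of_tendsto (isCompact_hull K) (convex_hull K)
    (ψ := fun n x => φ n x - polyFun r x) (u := fun x => v.1 x - polyFun r x)
    (fun n => (hφ n).contDiff_one.sub (contDiff_one_polyFun r))
    ((Lp.stronglyMeasurable v.1).measurable.sub (continuous_polyFun r).measurable)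
    ((h1 K hK).1.congr fun n => eLpNorm_congr_ae (Eventually.of_forall fun x => by
      simp only [sub_sub_sub_cancel_right]))
    ((h1 K hK).2.congr fun n => eLpNorm_congr_ae (by
      filter_upwards [h] with x hx
      rw [hx, gradient_sub (hφ n).differentiable hrd, gradient_polyFun]))
  refine ⟨c, ?_⟩
  filter_upwards [hc] with x hx
  rw [polyFun_add, polyFun_C, ← hx]
  ring

end Mesh

/-! ### Orthogonal projections -/

section Projection

variable {d : ℕ}

/-- The extension by zero of a polynomial on `A`, as a test function in `L²`. -/
theorem exists_indicator_polyFun {μ : Measure (E d)} {A : Set (E d)} (hA : MeasurableSet A)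
    {q : MvPolynomial (Fin d) ℝ} (hq : MemLp (polyFun q) 2 (μ.restrict A)) :
    ∃ s : L2 μ, (∀ᵐ x ∂μ, s x = A.indicator (polyFun q) x) ∧
      ∀ u : L2 μ, ⟪u, s⟫ = ∫ x in A, u x * polyFun q x ∂μ := by
  have hm : MemLp (A.indicator (polyFun q)) 2 μ := (memLp_indicator_iff_restrict hA).2 hq
  refine ⟨hm.toLp _, hm.coeFn_toLp, fun u => ?_⟩
  rw [L2.inner_def, ← integral_indicator hA]
  refine integral_congr_ae ?_
  filter_upwards [hm.coeFn_toLp] with x hx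
  rw [hx]
  by_cases hxA : x ∈ A
  · simp [hxA, mul_comm]
  · simp [hxA]

theorem inner_starProjection_eq {H : Type*} [NormedAddCommGroup H] [InnerProductSpace ℝ H]
    (V : Submodule ℝ H) [V.HasOrthogonalProjection] (u : H) {s : H} (hs : s ∈ V) :
    ⟪V.starProjection u, s⟫ = ⟪u, s⟫ := by
  have h := V.starProjection_inner_eq_zero u s hs
  rw [inner_sub_left, sub_eq_zero] at h
  exact h.symm

variable {F : Set (E d)} {p : ℕ} {f g : E d → ℝ}

theorem faceProj_congr (h : f =ᵐ[(surf d).restrict F] g) : faceProj F p f = faceProj F p g := by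
  by_cases hf : MemLp f 2 ((surf d).restrict F)
  · have hg : MemLp g 2 ((surf d).restrict F) := (memLp_congr_ae h).1 hf
    rw [faceProj, faceProj, dif_pos hf, dif_pos hg, (MemLp.toLp_eq_toLp_iff hf hg).2 h]
  · have hg : ¬MemLp g 2 ((surf d).restrict F) := fun hg => hf ((memLp_congr_ae h).2 hg)
    rw [faceProj, faceProj, dif_neg hf, dif_neg hg]

theorem memLp_faceProj (F : Set (E d)) (p : ℕ) (f : E d → ℝ) :
    MemLp (faceProj F p f) 2 ((surf d).restrict F) := by
  rw [faceProj]
  split_ifs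
  · exact Lp.memLp _
  · exact MemLp.zero

theorem faceProj_sub (hf : MemLp f 2 ((surf d).restrict F))
    (hg : MemLp g 2 ((surf d).restrict F)) :
    faceProj F p (fun x => f x - g x) =ᵐ[(surf d).restrict F]
      fun x => faceProj F p f x - faceProj F p g x := by
  have hfg : MemLp (fun x => f x - g x) 2 ((surf d).restrict F) := hf.sub hg
  have h0 : hfg.toLp _ = hf.toLp f - hg.toLp g := MemLp.toLp_sub hf hg
  rw [faceProj, faceProj, faceProj, dif_pos hf, dif_pos hg, dif_pos hfg, h0, map_sub]
  exact Lp.coeFn_sub _ _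

theorem mem_facePoly_of_ae {s : L2 ((surf d).restrict F)} {q : MvPolynomial (Fin d) ℝ}
    (hq : q ∈ Poly d p) (h : s =ᵐ[(surf d).restrict F] polyFun q) : s ∈ facePoly F p := by
  rintro A rfl
  refine ⟨q, hq, ?_⟩
  filter_upwards [h] with x hx _ using hx

theorem faceProj_eq_self {q : MvPolynomial (Fin d) ℝ} (hq : q ∈ Poly d p)
    (hf : MemLp f 2 ((surf d).restrict F)) (h : f =ᵐ[(surf d).restrict F] polyFun q) :
    faceProj F p f =ᵐ[(surf d).restrict F] f := by
  have hmem : hf.toLp f ∈ facePoly F p := mem_facePoly_of_ae hq (hf.coeFn_toLp.trans h)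
  rw [faceProj, dif_pos hf, Submodule.starProjection_eq_self_iff.2 hmem]
  exact hf.coeFn_toLp

theorem faceProj_eq_zero (hf : MemLp f 2 ((surf d).restrict F))
    (h : ∀ q ∈ Poly d p, ∫ x in F, f x * polyFun q x ∂(surf d) = 0) :
    faceProj F p f =ᵐ[(surf d).restrict F] 0 := by
  have h0 : (facePoly F p).starProjection (hf.toLp f) = 0 := by
    rw [Submodule.starProjection_apply_eq_zero_iff, Submodule.mem_orthogonal']
    intro s hs
    obtain ⟨q, hq, hsq⟩ := hs Set.univ rfl
    rw [L2.inner_def, ← h q hq]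
    refine integral_congr_ae ?_
    filter_upwards [hf.coeFn_toLp, hsq] with x h1 h2
    rw [h1, h2 trivial]
    simp [mul_comm]
  rw [faceProj, dif_pos hf, h0]
  exact Lp.coeFn_zero _ _ _

end Projection

namespace Mesh

variable {d : ℕ} {Ω : Domain d} (M : Mesh Ω)

theorem projCells_mem (p : ℕ) (v : L2 Ω.vol) : M.projCells p v ∈ M.brokenPoly p :=
  Submodule.starProjection_apply_mem _ _

theorem projCells_eq_self {p : ℕ} {v : L2 Ω.vol} (hv : v ∈ M.brokenPoly p) :
    M.projCells p v = v := Submodule.starProjection_eq_self_iff.2 hv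

theorem projSkeleton_mem (p : ℕ) (g : L2 M.skel) : M.projSkeleton p g ∈ M.skeletonPoly p :=
  Submodule.starProjection_apply_mem _ _

theorem projSkeleton_eq_self {p : ℕ} {g : L2 M.skel} (hg : g ∈ M.skeletonPoly p) :
    M.projSkeleton p g = g := Submodule.starProjection_eq_self_iff.2 hg

theorem interpolant_mem (p : ℕ) (v : M.Pairs) : M.interpolant p v ∈ M.hhoSpace p :=
  ⟨M.projCells_mem p v.1, M.projSkeleton_mem p v.2⟩

/-- The polynomial q, extended by zero outside K, is itself a broken polynomial, so orthogonality of
the projection may be tested with it on one cell at a time. -/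
theorem integral_projCells {K : Finset (E d)} (hK : K ∈ M.cells) {p : ℕ} (v : L2 Ω.vol)
    {q : MvPolynomial (Fin d) ℝ} (hq : q ∈ Poly d p) :
    ∫ x in hull K, M.projCells p v x * polyFun q x = ∫ x in hull K, v x * polyFun q x := by
  obtain ⟨s, hs, hinner⟩ := exists_indicator_polyFun (μ := Ω.vol) (q := q)
    (isCompact_hull K).measurableSet (by
      rw [M.vol_restrict hK]; exact IsSimplex.memLp_hull K (continuous_polyFun q) 2)
  have hmem : s ∈ M.brokenPoly p := by
    refine M.mem_brokenPoly_iff.2 fun K' hK' => ?_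
    by_cases hne : K' = K
    · subst hne
      refine ⟨q, hq, ?_⟩
      filter_upwards [M.ae_hull_of_ae hK hs, ae_restrict_mem (isCompact_hull K').measurableSet]
        with x hx hxK
      rw [hx, Set.indicator_of_mem hxK]
    · refine ⟨0, Submodule.zero_mem _, ?_⟩
      filter_upwards [M.ae_hull_of_ae hK' hs, ae_restrict_mem (isCompact_hull K').measurableSet,
        ae_restrict_of_ae (measure_eq_zero_iff_ae_notMem.1 (M.volume_inter_eq_zero hK' hK hne))]
        with x hx hxK' hxi
      rw [hx, Set.indicator_of_notMem fun h => hxi ⟨hxK', h⟩, polyFun_zero]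
  have h := inner_starProjection_eq (M.brokenPoly p) v hmem
  rw [hinner, hinner, M.vol_restrict hK] at h
  exact h

/-- The test function is again q extended by zero, and distinct faces overlap in null sets. The face
must not be a boundary face, since the extension has to vanish on all of those. -/
theorem integral_projSkeleton (hd : 1 ≤ d) {F : Set (E d)} (hF : F ∈ M.faces)
    (hFb : F ∉ M.boundaryFaces) {p : ℕ} (g : L2 M.skel) {q : MvPolynomial (Fin d) ℝ}
    (hq : q ∈ Poly d p) :
    ∫ x in F, M.projSkeleton p g x * polyFun q x ∂(surf d) =
      ∫ x in F, g x * polyFun q x ∂(surf d) := by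
  obtain ⟨s, hs, hinner⟩ := exists_indicator_polyFun (μ := M.skel) (q := q)
    (M.measurableSet_face hF) (by
      rw [M.skel_restrict hF]; exact M.memLp_face_of_continuous hd hF (continuous_polyFun q) 2)
  have hoff : ∀ F' ∈ M.faces, F' ≠ F → ∀ᵐ x ∂M.skel, x ∈ F' → s x = 0 := by
    intro F' hF' hne
    have h0 : surf d (F' ∩ F) = 0 := by
      obtain ⟨K, hK, a, ha, rfl⟩ := hF
      obtain ⟨K', hK', a', ha', rfl⟩ := hF'
      exact M.surf_facet_inter_eq_zero hd hK' hK ha' ha hne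
    filter_upwards [hs, (ae_restrict_of_ae (measure_eq_zero_iff_ae_notMem.1 h0) :
      ∀ᵐ x ∂M.skel, x ∉ F' ∩ F)] with x hx hxi hxF'
    rw [hx, Set.indicator_of_notMem fun h => hxi ⟨hxF', h⟩]
  have hmem : s ∈ M.skeletonPoly p := by
    refine ⟨fun F' hF' => ?_, fun F' hF' => hoff F' hF'.1 fun h => hFb (h ▸ hF')⟩
    by_cases hne : F' = F
    · subst hne
      refine ⟨q, hq, ?_⟩
      filter_upwards [hs] with x hx hxF
      rw [hx, Set.indicator_of_mem hxF]
    · refine ⟨0, Submodule.zero_mem _, ?_⟩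
      filter_upwards [hoff F' hF' hne] with x hx hxF'
      rw [hx hxF', polyFun_zero]
  have h := inner_starProjection_eq (M.skeletonPoly p) g hmem
  rw [hinner, hinner, M.skel_restrict hF] at h
  exact h

theorem skeletonPoly_boundary {p : ℕ} {g : L2 M.skel} (hg : g ∈ M.skeletonPoly p)
    {F : Set (E d)} (hF : F ∈ M.boundaryFaces) : ∀ᵐ x ∂(surf d).restrict F, g x = 0 :=
  (M.ae_face_iff hF.1).1 (hg.2 F hF)

theorem skeletonPoly_face {p : ℕ} {g : L2 M.skel} (hg : g ∈ M.skeletonPoly p)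
    {F : Set (E d)} (hF : F ∈ M.faces) :
    ∃ q ∈ Poly d p, ∀ᵐ x ∂(surf d).restrict F, g x = polyFun q x := by
  obtain ⟨q, hq, h⟩ := hg.1 F hF
  exact ⟨q, hq, (M.ae_face_iff hF).1 h⟩

/-! ### The interpolant -/

/-- On each face the interpolant has the same moments as the trace. -/
theorem integral_projSkeleton_contSpace (hd : 1 ≤ d) {v : M.Pairs} (hv : v ∈ M.contSpace)
    {F : Set (E d)} (hF : F ∈ M.faces) {p : ℕ} {q : MvPolynomial (Fin d) ℝ} (hq : q ∈ Poly d p) :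
    ∫ x in F, M.projSkeleton p v.2 x * polyFun q x ∂(surf d) =
      ∫ x in F, v.2 x * polyFun q x ∂(surf d) := by
  by_cases hFb : F ∈ M.boundaryFaces
  -- On a boundary face the projection is zero by definition of its range and the trace is zero by
  -- H¹₀, so the moments agree trivially.
  · refine integral_congr_ae ?_
    filter_upwards [M.trace_boundary hv hFb,
      M.skeletonPoly_boundary (M.projSkeleton_mem p v.2) hFb] with x h1 h2
    rw [h1, h2]
  · exact M.integral_projSkeleton hd hF hFb v.2 hq

/-- For q of degree p + 1 the weights Δq on cells and ∇q·n on faces are polynomials of degree at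
most p, and such moments survive interpolation. -/
theorem reconFunctional_interpolant (hd : 1 ≤ d) {v : M.Pairs} (hv : v ∈ M.contSpace)
    {K : Finset (E d)} (hK : K ∈ M.cells) {p : ℕ} {q : MvPolynomial (Fin d) ℝ}
    (hq : q ∈ Poly d (p + 1)) :
    M.reconFunctional K (M.interpolant p v) q = M.reconFunctional K v q := by
  rw [reconFunctional, reconFunctional]
  congr 1
  · obtain ⟨r, hr, hrq⟩ := exists_polyLapl_eq hq
    simp only [hrq]
    rw [neg_inj]
    exact M.integral_projCells hK v.1 hr
  · refine Finset.sum_congr rfl fun a ha => ?_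
    obtain ⟨r, hr, hrq⟩ := exists_inner_polyGrad_eq hq (outerNormal K a)
    simp only [hrq]
    exact M.integral_projSkeleton_contSpace hd hv (M.facet_mem_faces hK ha) hr

/-- The reconstruction of the interpolant reproduces conforming polynomials. -/
theorem reconstruction_interpolant (hd : 1 ≤ d) {v : M.Pairs} (hv : v ∈ M.contSpace) {p : ℕ}
    (hvp : v.1 ∈ M.brokenPoly (p + 1)) : M.reconstruction p (M.interpolant p v) = v.1 := by
  refine M.reconstruction_eq hd (M.isReconstruction_iff.2 ⟨hvp, fun K hK => ⟨fun q hq => ?_, ?_⟩⟩)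
  · rw [M.reconFunctional_interpolant hd hv hK hq, ← M.green_contSpace hd hv hK q]
    refine integral_congr_ae ?_
    filter_upwards [M.weakGradient_eq_polyGrad hv hK (M.cellPoly_spec hvp hK).2] with x hx
    rw [hx]
  · rw [← integral_congr_ae (M.cellPoly_spec hvp hK).2]
    have h := M.integral_projCells hK v.1 (p := p) (q := 1) (by simpa using C_mem_Poly (d := d) 1 p)
    simp only [polyFun_one, mul_one] at h
    exact h.symm

theorem stabOp_interpolant (hd : 1 ≤ d) {v : M.Pairs} (hv : v ∈ M.contSpace) {p : ℕ}
    (hvp : v.1 ∈ M.brokenPoly (p + 1)) : M.stabOp p (M.interpolant p v) = v.1 := by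
  rw [stabOp, M.reconstruction_interpolant hd hv hvp]
  exact add_sub_cancel _ _

/-- As S Î v = v, the difference on the face is the projected trace minus the trace, whose moments
of degree at most p all vanish. -/
theorem stabDiff_interpolant (hd : 1 ≤ d) {v : M.Pairs} (hv : v ∈ M.contSpace) {p : ℕ}
    (hvp : v.1 ∈ M.brokenPoly (p + 1)) {K : Finset (E d)} (hK : K ∈ M.cells) {a : E d}
    (ha : a ∈ K) :
    M.stabDiff p (M.interpolant p v) K a =ᵐ[(surf d).restrict (facet K a)] 0 := by
  have hF := M.facet_mem_faces hK ha
  have hc : (fun x => (M.interpolant p v).2 x -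
      polyFun (cellPoly (M.stabOp p (M.interpolant p v)) K) x)
      =ᵐ[(surf d).restrict (facet K a)] fun x => M.projSkeleton p v.2 x - v.2 x := by
    filter_upwards [M.trace_eq_polyFun hd hv hK (M.cellPoly_spec hvp hK).2 ha] with x hx
    rw [M.stabOp_interpolant hd hv hvp, hx]
    rfl
  rw [stabDiff, faceProj_congr hc]
  refine faceProj_eq_zero ((M.memLp_face hF _).sub (M.memLp_face hF _)) fun q hq => ?_
  simp only [sub_mul]
  rw [integral_sub (M.integrable_mul_face hd hF _ (by fun_prop))
    (M.integrable_mul_face hd hF _ (by fun_prop)),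
    M.integral_projSkeleton_contSpace hd hv hF hq, sub_self]

/-! ### The stabilization -/

theorem stabOp_mem (hd : 1 ≤ d) {p : ℕ} {s : M.Pairs} (hs : s ∈ M.hhoSpace p) :
    M.stabOp p s ∈ M.brokenPoly (p + 1) := by
  have hle := M.brokenPoly_mono (Nat.le_succ p)
  exact Submodule.add_mem _ (hle hs.1) (Submodule.sub_mem _ (M.reconstruction_mem hd p s)
    (hle (M.projCells_mem p _)))

theorem stabOp_sub (hd : 1 ≤ d) (p : ℕ) (s t : M.Pairs) :
    M.stabOp p (s - t) = M.stabOp p s - M.stabOp p t := by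
  simp only [stabOp, projCells, M.reconstruction_sub hd, map_sub, Prod.fst_sub]
  abel

theorem stabDiff_sub (hd : 1 ≤ d) {p : ℕ} {s t : M.Pairs} (hs : s ∈ M.hhoSpace p)
    (ht : t ∈ M.hhoSpace p) {K : Finset (E d)} (hK : K ∈ M.cells) {a : E d} (ha : a ∈ K) :
    M.stabDiff p (s - t) K a =ᵐ[(surf d).restrict (facet K a)]
      fun x => M.stabDiff p s K a x - M.stabDiff p t K a x := by
  have hF := M.facet_mem_faces hK ha
  have hm : ∀ u : M.Pairs, MemLp (fun x => u.2 x - polyFun (cellPoly (M.stabOp p u) K) x) 2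
      ((surf d).restrict (facet K a)) := fun u =>
    (M.memLp_face hF u.2).sub (M.memLp_face_of_continuous hd hF (continuous_polyFun _) 2)
  have hc : (fun x => (s - t).2 x - polyFun (cellPoly (M.stabOp p (s - t)) K) x)
      =ᵐ[(surf d).restrict (facet K a)] fun x =>
        (s.2 x - polyFun (cellPoly (M.stabOp p s) K) x) -
          (t.2 x - polyFun (cellPoly (M.stabOp p t) K) x) := by
    filter_upwards [M.ae_skel_iff.1 (Lp.coeFn_sub s.2 t.2) _ hF] with x hx
    rw [M.stabOp_sub hd, M.cellPoly_sub (M.stabOp_mem hd hs) (M.stabOp_mem hd ht) hK,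
      polyFun_sub, Prod.snd_sub, hx, Pi.sub_apply]
    ring
  rw [stabDiff, faceProj_congr hc]
  exact faceProj_sub (hm s) (hm t)

end Mesh

/-- The radial formula with f = 1 says that height times facet area is d times the volume. Facets
being non-null, constants that agree almost everywhere on one are equal. -/
theorem IsSimplex.surf_facet_ne_zero {d : ℕ} {K : Finset (E d)} (hK : IsSimplex K) (hd : 1 ≤ d)
    {a : E d} (ha : a ∈ K) : surf d (facet K a) ≠ 0 := by
  intro h0
  obtain ⟨h, hh, hF⟩ := hK.exists_height hd ha
  have h1 := hK.integral_div_vertex hd ha hh hF (f := fun _ => 1) contDiff_const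
  rw [Measure.restrict_eq_zero.2 h0] at h1
  have h2 : ∫ _ in hull K, (d : ℝ) = 0 := by simpa using h1.symm
  have h3 : (d : ℝ) = 0 := Mesh.integral_hull_const hK h2
  have h4 : d = 0 := by exact_mod_cast h3
  omega

namespace Mesh

variable {d : ℕ} {Ω : Domain d} (M : Mesh Ω)

/-! ### The kernel of the discrete energy -/

theorem ae_facet_exists {K : Finset (E d)} (hK : K ∈ M.cells) (hd : 1 ≤ d) {a : E d} (ha : a ∈ K)
    {P : Prop} (h : ∀ᵐ _x ∂(surf d).restrict (facet K a), P) : P := by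
  have hne : (ae ((surf d).restrict (facet K a))).NeBot := by
    rw [ae_neBot, Ne, Measure.restrict_eq_zero]
    exact (M.isSimplex hK).surf_facet_ne_zero hd ha
  exact eventually_const.1 h

/-- If the reconstruction is locally constant and the stabilization vanishes, then the faces carry
the traces of the cell polynomials. -/
theorem face_eq_cellPoly (hd : 1 ≤ d) {p : ℕ} {δ : M.Pairs} (hδ : δ ∈ M.hhoSpace p)
    (hR : M.reconstruction p δ ∈ M.brokenPoly p) {K : Finset (E d)} (hK : K ∈ M.cells) {a : E d}
    (ha : a ∈ K) (hstab : M.stabDiff p δ K a =ᵐ[(surf d).restrict (facet K a)] 0) :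
    ∀ᵐ x ∂(surf d).restrict (facet K a), δ.2 x = polyFun (cellPoly δ.1 K) x := by
  have hF := M.facet_mem_faces hK ha
  -- The reconstruction is already of degree p, so the projection leaves it unchanged and the
  -- correction in S disappears.
  have hS : M.stabOp p δ = δ.1 := by
    rw [stabOp, M.projCells_eq_self hR, sub_self, add_zero]
  obtain ⟨r, hr, hδr⟩ := M.skeletonPoly_face hδ.2 hF
  -- Both terms have degree at most p on the facet, so the face projection loses no information.
  have h1 := faceProj_eq_self (f := fun x => δ.2 x - polyFun (cellPoly δ.1 K) x)
    (F := facet K a) (Submodule.sub_mem _ hr (M.cellPoly_spec hδ.1 hK).1)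
    ((M.memLp_face hF δ.2).sub (M.memLp_face_of_continuous hd hF (continuous_polyFun _) 2)) (by
      filter_upwards [hδr] with x hx
      rw [hx, polyFun_sub])
  rw [stabDiff, hS] at hstab
  filter_upwards [h1, hstab] with x h2 h3
  rw [h3] at h2
  exact (sub_eq_zero.1 h2.symm)

/-- With matching face values, the equation for the reconstruction tested with q = δ_M has the same
right-hand side as Green's formula for q. Hence ∫|∇q|² = ∫∇Rδ·∇q = 0. -/
theorem exists_cellPoly_eq_C {p : ℕ} {δ : M.Pairs} (hd : 1 ≤ d) (hδ : δ ∈ M.hhoSpace p)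
    {K : Finset (E d)} (hK : K ∈ M.cells)
    (hR : ∀ᵐ x ∂volume.restrict (hull K), polyGrad (cellPoly (M.reconstruction p δ) K) x = 0)
    (hface : ∀ a ∈ K, ∀ᵐ x ∂(surf d).restrict (facet K a), δ.2 x = polyFun (cellPoly δ.1 K) x) :
    ∃ c, cellPoly δ.1 K = MvPolynomial.C c := by
  set q := cellPoly δ.1 K with hq
  have hspec := M.cellPoly_spec hδ.1 hK
  refine eq_C_of_integral_inner_polyGrad (M.isSimplex hK) ?_
  have h1 := ((M.isReconstruction_iff.1 (M.isReconstruction_reconstruction hd p δ)).2 K hK).1 q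
    (Poly_mono (Nat.le_succ p) hspec.1)
  have h2 : ∫ x in hull K, ⟪polyGrad (cellPoly (M.reconstruction p δ) K) x, polyGrad q x⟫ = 0 := by
    refine integral_eq_zero_of_ae ?_
    filter_upwards [hR] with x hx
    rw [hx, inner_zero_left, Pi.zero_apply]
  have h3 := (M.isSimplex hK).green hd (contDiff_one_polyFun q) q
  rw [gradient_polyFun] at h3
  rw [h3, ← h2, h1, reconFunctional]
  congr 1
  · rw [neg_inj]
    refine integral_congr_ae ?_
    filter_upwards [hspec.2] with x hx
    rw [hx]
  · refine Finset.sum_congr rfl fun a ha => integral_congr_ae ?_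
    filter_upwards [hface a ha] with x hx
    rw [hx]

/-- The discrete energy is positive definite on the HHO space. -/
theorem eq_zero_of_energy_eq_zero (hd : 1 ≤ d) {p : ℕ} {δ : M.Pairs} (hδ : δ ∈ M.hhoSpace p)
    (hR : ∀ K ∈ M.cells, ∀ᵐ x ∂volume.restrict (hull K),
      polyGrad (cellPoly (M.reconstruction p δ) K) x = 0)
    (hstab : ∀ K ∈ M.cells, ∀ a ∈ K,
      M.stabDiff p δ K a =ᵐ[(surf d).restrict (facet K a)] 0) : δ = 0 := by
  have hRp : M.reconstruction p δ ∈ M.brokenPoly p := by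
    refine M.mem_brokenPoly_iff.2 fun K hK => ?_
    have hspec := M.cellPoly_spec (M.reconstruction_mem hd p δ) hK
    -- A zero gradient makes Rδ constant on the cell, hence of degree at most p even when p = 0.
    obtain ⟨c, hc⟩ := exists_eq_C_of_polyGrad_eq_zero (M.isSimplex hK).interior_nonempty
      ((ae_restrict_iff' (isCompact_hull K).measurableSet).1 (hR K hK))
    refine ⟨_, ?_, hspec.2⟩
    rw [hc]
    exact C_mem_Poly c p
  have hface : ∀ K ∈ M.cells, ∀ a ∈ K, ∀ᵐ x ∂(surf d).restrict (facet K a),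
      δ.2 x = polyFun (cellPoly δ.1 K) x := fun K hK a ha =>
    M.face_eq_cellPoly hd hδ hRp hK ha (hstab K hK a ha)
  have hconst : ∀ K ∈ M.cells, ∃ c, cellPoly δ.1 K = MvPolynomial.C c := fun K hK =>
    M.exists_cellPoly_eq_C hd hδ hK (hR K hK) (hface K hK)
  choose! c hc using hconst
  have hfc : ∀ K ∈ M.cells, ∀ a ∈ K, ∀ᵐ x ∂(surf d).restrict (facet K a), δ.2 x = c K := by
    intro K hK a ha
    filter_upwards [hface K hK a ha] with x hx
    rw [hx, hc K hK, polyFun_C]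
  -- The single-valued face component equates the constants of cells sharing a facet, and its
  -- vanishing on boundary faces supplies the zero.
  have h0 : ∀ K ∈ M.cells, c K = 0 := by
    refine M.eq_zero_of_forall_facet hd c (fun K hK K' hK' a ha a' ha' he => ?_)
      fun K hK a ha hb => ?_
    · refine M.ae_facet_exists hK hd ha ?_
      have h2 := hfc K' hK' a' ha'
      rw [← he] at h2
      filter_upwards [hfc K hK a ha, h2] with x h3 h4
      rw [← h3, h4]
    · refine M.ae_facet_exists hK hd ha ?_
      filter_upwards [hfc K hK a ha,
        M.skeletonPoly_boundary hδ.2 ⟨M.facet_mem_faces hK ha, hb⟩] with x h3 h4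
      rw [← h3, h4]
  refine Prod.ext (M.ext_of_cellPoly hδ.1 (Submodule.zero_mem (M.brokenPoly p)) fun K hK => ?_)
    (Lp.ext (M.ae_skel_iff.2 ?_))
  · rw [hc K hK, h0 K hK, map_zero]
    symm
    refine M.cellPoly_eq hK ?_
    filter_upwards [M.ae_hull_of_ae hK (Lp.coeFn_zero ℝ 2 Ω.vol)] with x hx
    rw [polyFun_zero]
    exact hx
  · rintro F ⟨K, hK, a, ha, rfl⟩
    filter_upwards [hfc K hK a ha,
      M.ae_skel_iff.1 (Lp.coeFn_zero ℝ 2 M.skel) _ (M.facet_mem_faces hK ha)] with x h1 h2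
    rw [h1, h0 K hK]
    exact h2.symm

/-! ### Independence of the decomposition -/

/-- Elements common to the continuous and the HHO space are their own interpolants. -/
theorem interpolant_eq_self {p : ℕ} {u : M.Pairs} (hu : u ∈ M.hhoSpace p) :
    M.interpolant p u = u :=
  Prod.ext (M.projCells_eq_self hu.1) (M.projSkeleton_eq_self hu.2)

theorem reconstruction_eq_fst (hd : 1 ≤ d) {p : ℕ} {u : M.Pairs} (hu : u ∈ M.contSpace)
    (hu' : u ∈ M.hhoSpace p) : M.reconstruction p u = u.1 := by
  conv_lhs => rw [← M.interpolant_eq_self hu']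
  exact M.reconstruction_interpolant hd hu (M.brokenPoly_mono (Nat.le_succ p) hu'.1)

theorem stabDiff_eq_zero (hd : 1 ≤ d) {p : ℕ} {u : M.Pairs} (hu : u ∈ M.contSpace)
    (hu' : u ∈ M.hhoSpace p) {K : Finset (E d)} (hK : K ∈ M.cells) {a : E d} (ha : a ∈ K) :
    M.stabDiff p u K a =ᵐ[(surf d).restrict (facet K a)] 0 := by
  rw [← M.interpolant_eq_self hu']
  exact M.stabDiff_interpolant hd hu (M.brokenPoly_mono (Nat.le_succ p) hu'.1) hK ha

section Decomposition

variable {p : ℕ} {v v' s s' : M.Pairs}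

/-- The discrepancy of two decompositions lies in both spaces. There R reproduces the function and
the stabilization vanishes, which is why the form cannot detect it. -/
theorem mem_of_add_eq_add (hv : v ∈ M.contSpace) (hv' : v' ∈ M.contSpace)
    (hs : s ∈ M.hhoSpace p) (hs' : s' ∈ M.hhoSpace p) (h : v + s = v' + s') :
    s' - s = v - v' ∧ s' - s ∈ M.contSpace ∧ s' - s ∈ M.hhoSpace p := by
  have he : s' - s = v - v' := by
    rw [sub_eq_sub_iff_add_eq_add, add_comm s' v', ← h]
  exact ⟨he, he ▸ M.sub_mem_contSpace hv hv', Submodule.sub_mem _ hs' hs⟩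

theorem brokenGrad_congr (hd : 1 ≤ d) (hv : v ∈ M.contSpace) (hv' : v' ∈ M.contSpace)
    (hs : s ∈ M.hhoSpace p) (hs' : s' ∈ M.hhoSpace p) (h : v + s = v' + s')
    {K : Finset (E d)} (hK : K ∈ M.cells) :
    M.brokenGrad p v s K =ᵐ[volume.restrict (hull K)] M.brokenGrad p v' s' K := by
  obtain ⟨he, hc, hp⟩ := M.mem_of_add_eq_add hv hv' hs hs' h
  have h1 := M.weakGradient_eq_polyGrad hc hK (M.cellPoly_spec hp.1 hK).2
  -- The fact being rearranged is ∇(v - v') = ∇R(s' - s) on the cell; moving terms gives ∇v + ∇R s =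
  -- ∇v' + ∇R s'.
  rw [← M.reconstruction_eq_fst hd hc hp, M.reconstruction_sub hd, M.cellPoly_sub
    (M.reconstruction_mem hd p s') (M.reconstruction_mem hd p s) hK, ← M.reconstruction_sub hd,
    M.reconstruction_eq_fst hd hc hp, he, M.weakGradient_sub hv hv'] at h1
  filter_upwards [h1, M.ae_hull_of_ae hK (Lp.coeFn_sub (weakGradient v.1) (weakGradient v'.1))]
    with x h2 h3
  rw [h3, Pi.sub_apply, polyGrad_sub, sub_eq_sub_iff_add_eq_add] at h2
  simp only [brokenGrad]
  rw [h2, add_comm]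

theorem stabDiff_congr (hd : 1 ≤ d) (hv : v ∈ M.contSpace) (hv' : v' ∈ M.contSpace)
    (hs : s ∈ M.hhoSpace p) (hs' : s' ∈ M.hhoSpace p) (h : v + s = v' + s')
    {K : Finset (E d)} (hK : K ∈ M.cells) {a : E d} (ha : a ∈ K) :
    M.stabDiff p s K a =ᵐ[(surf d).restrict (facet K a)] M.stabDiff p s' K a := by
  obtain ⟨-, hc, hp⟩ := M.mem_of_add_eq_add hv hv' hs hs' h
  filter_upwards [M.stabDiff_eq_zero hd hc hp hK ha, M.stabDiff_sub hd hs' hs hK ha] with x h1 h2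
  rw [h1, Pi.zero_apply] at h2
  exact (sub_eq_zero.1 h2.symm).symm

theorem extFormula_congr (hd : 1 ≤ d) (w : Set (E d) → ℝ) {z z' σ σ' : M.Pairs}
    (hv : v ∈ M.contSpace) (hv' : v' ∈ M.contSpace)
    (hs : s ∈ M.hhoSpace p) (hs' : s' ∈ M.hhoSpace p) (h : v + s = v' + s')
    (hz : z ∈ M.contSpace) (hz' : z' ∈ M.contSpace)
    (hσ : σ ∈ M.hhoSpace p) (hσ' : σ' ∈ M.hhoSpace p) (h' : z + σ = z' + σ') :
    M.extFormula p w v s z σ = M.extFormula p w v' s' z' σ' := by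
  rw [extFormula, extFormula, stab, stab]
  congr 1
  · refine Finset.sum_congr rfl fun K hK => integral_congr_ae ?_
    filter_upwards [M.brokenGrad_congr hd hv hv' hs hs' h hK,
      M.brokenGrad_congr hd hz hz' hσ hσ' h' hK] with x h1 h2
    rw [h1, h2]
  · refine Finset.sum_congr rfl fun K hK => Finset.sum_congr rfl fun a ha => ?_
    congr 1
    refine integral_congr_ae ?_
    filter_upwards [M.stabDiff_congr hd hv hv' hs hs' h hK ha,
      M.stabDiff_congr hd hz hz' hσ hσ' h' hK ha] with x h1 h2
    rw [h1, h2]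

theorem split_spec (hv : v ∈ M.contSpace) (hs : s ∈ M.hhoSpace p) :
    (M.split p (v + s)).1 ∈ M.contSpace ∧ (M.split p (v + s)).2 ∈ M.hhoSpace p ∧
      v + s = (M.split p (v + s)).1 + (M.split p (v + s)).2 := by
  have h : ∃ y : M.Pairs × M.Pairs, y.1 ∈ M.contSpace ∧ y.2 ∈ M.hhoSpace p ∧ v + s = y.1 + y.2 :=
    ⟨(v, s), hv, hs, rfl⟩
  rw [split, dif_pos h]
  exact h.choose_spec

/-- The extended form does not depend on the decompositions. -/
theorem extForm_add_add (hd : 1 ≤ d) (w : Set (E d) → ℝ) {z σ : M.Pairs}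
    (hv : v ∈ M.contSpace) (hs : s ∈ M.hhoSpace p) (hz : z ∈ M.contSpace)
    (hσ : σ ∈ M.hhoSpace p) : M.extForm p w (v + s) (z + σ) = M.extFormula p w v s z σ := by
  obtain ⟨h1, h2, h3⟩ := M.split_spec hv hs
  obtain ⟨h4, h5, h6⟩ := M.split_spec hz hσ
  exact M.extFormula_congr hd w h1 hv h2 hs h3.symm h4 hz h5 hσ h6.symm

end Decomposition

/-! ### Positivity and the kernel of the extended form -/

section Kernel

variable {p : ℕ} {w : Set (E d) → ℝ}

theorem extFormula_self_nonneg (hw : ∀ F ∈ M.faces, 0 < w F) (v s : M.Pairs) :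
    0 ≤ M.extFormula p w v s v s :=
  add_nonneg (Finset.sum_nonneg fun _ _ => integral_nonneg fun _ => real_inner_self_nonneg)
    (Finset.sum_nonneg fun _ hK => Finset.sum_nonneg fun _ ha =>
      mul_nonneg (hw _ (M.facet_mem_faces hK ha)).le
        (integral_nonneg fun _ => mul_self_nonneg _))

theorem memLp_brokenGrad (v s : M.Pairs) {K : Finset (E d)} (hK : K ∈ M.cells) :
    MemLp (M.brokenGrad p v s K) 2 (volume.restrict (hull K)) :=
  (M.memLp_hull hK (weakGradient v.1)).add (IsSimplex.memLp_hull K (continuous_polyGrad _) 2)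

/-- All summands are nonnegative integrals of squares, so the sum vanishes only if each integrand
does; strict positivity of the weights lets them be divided out. -/
theorem extFormula_self_eq_zero_iff (hw : ∀ F ∈ M.faces, 0 < w F) (v s : M.Pairs) :
    M.extFormula p w v s v s = 0 ↔
      (∀ K ∈ M.cells, M.brokenGrad p v s K =ᵐ[volume.restrict (hull K)] 0) ∧
      ∀ K ∈ M.cells, ∀ a ∈ K, M.stabDiff p s K a =ᵐ[(surf d).restrict (facet K a)] 0 := by
  have n1 : ∀ K ∈ M.cells,
      0 ≤ ∫ x in hull K, ⟪M.brokenGrad p v s K x, M.brokenGrad p v s K x⟫ :=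
    fun K _ => integral_nonneg fun _ => real_inner_self_nonneg
  have n2 : ∀ K ∈ M.cells, ∀ a ∈ K, 0 ≤ w (facet K a) *
      ∫ x in facet K a, M.stabDiff p s K a x * M.stabDiff p s K a x ∂(surf d) :=
    fun K hK a ha => mul_nonneg (hw _ (M.facet_mem_faces hK ha)).le
      (integral_nonneg fun _ => mul_self_nonneg _)
  rw [extFormula, stab, add_eq_zero_iff_of_nonneg (Finset.sum_nonneg n1)
    (Finset.sum_nonneg fun K hK => Finset.sum_nonneg (n2 K hK)), Finset.sum_eq_zero_iff_of_nonneg n1,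
    Finset.sum_eq_zero_iff_of_nonneg fun K hK => Finset.sum_nonneg (n2 K hK)]
  refine and_congr (forall₂_congr fun K hK => ?_) (forall₂_congr fun K hK => ?_)
  · have hint : Integrable (fun x => ⟪M.brokenGrad p v s K x, M.brokenGrad p v s K x⟫)
        (volume.restrict (hull K)) := by
      simpa only [real_inner_self_eq_norm_sq] using (M.memLp_brokenGrad v s hK).integrable_norm_pow
        two_ne_zero
    rw [integral_eq_zero_iff_of_nonneg (fun _ => real_inner_self_nonneg) hint]
    exact eventually_congr (Eventually.of_forall fun x => inner_self_eq_zero (𝕜 := ℝ))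
  · rw [Finset.sum_eq_zero_iff_of_nonneg (n2 K hK)]
    refine forall₂_congr fun a ha => ?_
    have hm : MemLp (M.stabDiff p s K a) 2 ((surf d).restrict (facet K a)) :=
      memLp_faceProj _ _ _
    rw [mul_eq_zero, or_iff_right (hw _ (M.facet_mem_faces hK ha)).ne',
      integral_eq_zero_iff_of_nonneg (fun _ => mul_self_nonneg _) (hm.integrable_mul hm)]
    exact eventually_congr (Eventually.of_forall fun x => mul_self_eq_zero)

theorem reconstruction_neg (hd : 1 ≤ d) (s : M.Pairs) :
    M.reconstruction p (-s) = -M.reconstruction p s := by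
  have h := M.reconstruction_sub hd p (s - s) s
  rwa [M.reconstruction_sub hd p s s, sub_self, sub_self, zero_sub, zero_sub] at h

theorem cellPoly_neg {n : ℕ} {s : L2 Ω.vol} (hs : s ∈ M.brokenPoly n) {K : Finset (E d)}
    (hK : K ∈ M.cells) : cellPoly (-s) K = -cellPoly s K := by
  have h := M.cellPoly_sub (Submodule.sub_mem _ hs hs) hs hK
  rwa [M.cellPoly_sub hs hs hK, sub_self, sub_self, zero_sub, zero_sub] at h

theorem brokenGrad_neg (hd : 1 ≤ d) (v s : M.Pairs) {K : Finset (E d)} (hK : K ∈ M.cells)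
    (x : E d) : M.brokenGrad p v (-s) K x =
      weakGradient v.1 x - polyGrad (cellPoly (M.reconstruction p s) K) x := by
  have h0 : -cellPoly (M.reconstruction p s) K = 0 - cellPoly (M.reconstruction p s) K := by simp
  rw [brokenGrad, M.reconstruction_neg hd, M.cellPoly_neg (M.reconstruction_mem hd p s) hK, h0,
    polyGrad_sub]
  have h1 : polyGrad (0 : MvPolynomial (Fin d) ℝ) x = 0 := by simp
  rw [h1, zero_sub, ← sub_eq_add_neg]

theorem stabDiff_neg (hd : 1 ≤ d) {s : M.Pairs} (hs : s ∈ M.hhoSpace p) {K : Finset (E d)}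
    (hK : K ∈ M.cells) {a : E d} (ha : a ∈ K) :
    M.stabDiff p (-s) K a =ᵐ[(surf d).restrict (facet K a)] fun x => -M.stabDiff p s K a x := by
  have h := M.stabDiff_sub hd (Submodule.sub_mem _ hs hs) hs hK ha
  rw [sub_self, zero_sub] at h
  have h' := M.stabDiff_sub hd hs hs hK ha
  rw [sub_self] at h'
  filter_upwards [h, h'] with x h1 h2
  rw [h1, h2, sub_self, zero_sub]

/-- The kernel of the extended form. -/
theorem extFormula_neg_eq_zero_iff (hd : 1 ≤ d) (hw : ∀ F ∈ M.faces, 0 < w F) {v s : M.Pairs}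
    (hv : v ∈ M.contSpace) (hs : s ∈ M.hhoSpace p) :
    M.extFormula p w v (-s) v (-s) = 0 ↔
      v.1 ∈ M.brokenPoly (p + 1) ∧ s = M.interpolant p v := by
  rw [M.extFormula_self_eq_zero_iff hw]
  constructor
  · rintro ⟨hg, hst⟩
    have hg' : ∀ K ∈ M.cells, ∀ᵐ x ∂volume.restrict (hull K),
        weakGradient v.1 x = polyGrad (cellPoly (M.reconstruction p s) K) x := by
      intro K hK
      filter_upwards [hg K hK] with x hx
      rw [M.brokenGrad_neg hd v s hK, Pi.zero_apply, sub_eq_zero] at hx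
      exact hx
    have hvp : v.1 ∈ M.brokenPoly (p + 1) := by
      refine M.mem_brokenPoly_iff.2 fun K hK => ?_
      obtain ⟨c, hc⟩ := M.exists_eq_add_const hv hK (hg' K hK)
      exact ⟨_, Submodule.add_mem _ (M.cellPoly_spec (M.reconstruction_mem hd p s) hK).1
        (C_mem_Poly c _), hc⟩
    refine ⟨hvp, sub_eq_zero.1 ?_⟩
    have hI := M.interpolant_mem p v
    -- Both s and the interpolant reconstruct a function with gradient ∇v, and neither has
    -- stabilization; their difference has zero discrete energy.
    refine M.eq_zero_of_energy_eq_zero hd (Submodule.sub_mem _ hs hI) (fun K hK => ?_)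
      fun K hK a ha => ?_
    · rw [M.reconstruction_sub hd, M.reconstruction_interpolant hd hv hvp,
        M.cellPoly_sub (M.reconstruction_mem hd p s) hvp hK]
      filter_upwards [hg' K hK, M.weakGradient_eq_polyGrad hv hK (M.cellPoly_spec hvp hK).2]
        with x h1 h2
      rw [polyGrad_sub, ← h1, h2, sub_self]
    · filter_upwards [M.stabDiff_sub hd hs hI hK ha, hst K hK a ha, M.stabDiff_neg hd hs hK ha,
        M.stabDiff_interpolant hd hv hvp hK ha] with x h1 h2 h3 h4
      rw [h2, Pi.zero_apply, zero_eq_neg] at h3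
      rw [h1, h3, h4, Pi.zero_apply, sub_zero]
  · rintro ⟨hvp, rfl⟩
    refine ⟨fun K hK => ?_, fun K hK a ha => ?_⟩
    · filter_upwards [M.weakGradient_eq_polyGrad hv hK (M.cellPoly_spec hvp hK).2] with x hx
      rw [M.brokenGrad_neg hd v _ hK, M.reconstruction_interpolant hd hv hvp, hx, sub_self,
        Pi.zero_apply]
    · filter_upwards [M.stabDiff_neg hd (M.interpolant_mem p v) hK ha,
        M.stabDiff_interpolant hd hv hvp hK ha] with x h1 h2
      rw [h1, h2, Pi.zero_apply, neg_zero]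

theorem extForm_self_nonneg (hd : 1 ≤ d) (hw : ∀ F ∈ M.faces, 0 < w F) {x : M.Pairs}
    (hx : x ∈ M.sumSpace p) : 0 ≤ M.extForm p w x x := by
  obtain ⟨v, hv, s, hs, rfl⟩ := hx
  rw [M.extForm_add_add hd w hv hs hv hs]
  exact M.extFormula_self_nonneg hw v s

theorem extForm_sub_eq_zero_iff (hd : 1 ≤ d) (hw : ∀ F ∈ M.faces, 0 < w F) {v s : M.Pairs}
    (hv : v ∈ M.contSpace) (hs : s ∈ M.hhoSpace p) :
    M.extForm p w (v - s) (v - s) = 0 ↔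
      v.1 ∈ M.brokenPoly (p + 1) ∧ s = M.interpolant p v := by
  have hs' := Submodule.neg_mem _ hs
  rw [sub_eq_add_neg, M.extForm_add_add hd w hv hs' hv hs']
  exact M.extFormula_neg_eq_zero_iff hd hw hv hs

theorem sub_mem_sumSpace {v s : M.Pairs} (hv : v ∈ M.contSpace) (hs : s ∈ M.hhoSpace p) :
    v - s ∈ M.sumSpace p := ⟨v, hv, -s, Submodule.neg_mem _ hs, sub_eq_add_neg v s⟩

/-- A conforming function that is a broken polynomial equals its interpolant. -/
theorem interpolant_eq_of_mem (hd : 1 ≤ d) {v : M.Pairs} (hv : v ∈ M.contSpace)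
    (hvp : v.1 ∈ M.brokenPoly p) : M.interpolant p v = v := by
  refine M.interpolant_eq_self ⟨hvp, ?_, fun F hF => (M.ae_face_iff hF.1).2 (M.trace_boundary hv hF)⟩
  rintro F ⟨K, hK, a, ha, rfl⟩
  have hspec := M.cellPoly_spec hvp hK
  exact ⟨_, hspec.1, (M.ae_face_iff (M.facet_mem_faces hK ha)).2
    (M.trace_eq_polyFun hd hv hK hspec.2 ha)⟩

/-- An isotropic element has the form v - Î v with v of degree p + 1. It is zero when v has degree
p, by v = Î v, and otherwise not, because its first component is v minus its projection. -/
theorem exists_extForm_eq_zero_iff (hd : 1 ≤ d) (hw : ∀ F ∈ M.faces, 0 < w F) :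
    (∃ x ∈ M.sumSpace p, x ≠ 0 ∧ M.extForm p w x x = 0) ↔
      ∃ v ∈ M.contSpace, v.1 ∈ M.brokenPoly (p + 1) ∧ v.1 ∉ M.brokenPoly p := by
  constructor
  · rintro ⟨x, ⟨v, hv, s, hs, rfl⟩, hne, h0⟩
    rw [← sub_neg_eq_add] at h0 hne
    obtain ⟨hvp, he⟩ := (M.extForm_sub_eq_zero_iff hd hw hv (Submodule.neg_mem _ hs)).1 h0
    refine ⟨v, hv, hvp, fun hmem => hne ?_⟩
    rw [he, M.interpolant_eq_of_mem hd hv hmem, sub_self]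
  · rintro ⟨v, hv, hvp, hnot⟩
    have hI := M.interpolant_mem p v
    refine ⟨v - M.interpolant p v, M.sub_mem_sumSpace hv hI, fun h => hnot ?_,
      (M.extForm_sub_eq_zero_iff hd hw hv hI).2 ⟨hvp, rfl⟩⟩
    have := M.projCells_mem p v.1
    rwa [show M.projCells p v.1 = v.1 from (congrArg Prod.fst (sub_eq_zero.1 h)).symm] at this

end Kernel

end Mesh

end

end HHO

theorem mainTheorem8 (d : ℕ) (hd : d = 2 ∨ d = 3) (Ω : HHO.Domain d) (M : HHO.Mesh Ω) (p : ℕ)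
    (w : Set (HHO.E d) → ℝ) (hw : ∀ F ∈ M.faces, 0 < w F) :
    -- the extended form is well defined on the sum space
    (∀ v ∈ M.contSpace, ∀ s ∈ M.hhoSpace p, ∀ z ∈ M.contSpace, ∀ σ ∈ M.hhoSpace p,
      M.extForm p w (v + s) (z + σ) = M.extFormula p w v s z σ) ∧
    -- it is positive semi-definite
    (∀ x ∈ M.sumSpace p, 0 ≤ M.extForm p w x x) ∧
    -- kernel of the semi-norm
    (∀ v ∈ M.contSpace, ∀ s ∈ M.hhoSpace p,
      M.extSeminorm p w (v - s) = 0 ↔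
        v.1 ∈ M.brokenPoly (p + 1) ∧ s = M.interpolant p v) ∧
    -- exactly when the form fails to be positive definite
    ((∃ x ∈ M.sumSpace p, x ≠ 0 ∧ M.extForm p w x x = 0) ↔
      ∃ v ∈ M.contSpace, v.1 ∈ M.brokenPoly (p + 1) ∧ v.1 ∉ M.brokenPoly p) := by
  have hd' : 1 ≤ d := by omega
  refine ⟨fun v hv s hs z hz σ hσ => M.extForm_add_add hd' w hv hs hz hσ,
    fun x hx => M.extForm_self_nonneg hd' hw hx, fun v hv s hs => ?_,
    M.exists_extForm_eq_zero_iff hd' hw⟩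
  rw [HHO.Mesh.extSeminorm,
    Real.sqrt_eq_zero (M.extForm_self_nonneg hd' hw (M.sub_mem_sumSpace hv hs))]
  exact M.extForm_sub_eq_zero_iff hd' hw hv hs
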